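/- Let $P$ be a smooth 11-dimensional manifold with a smooth coframe $(\theta^1,\dots,\theta^4,\Omega_1,\dots,\Omega_6,A)$ satisfying $$\begin{aligned} d\theta^1&=(\Omega_1-\tfrac12A)\wedge\theta^1-\Omega_3\wedge\theta^3-\Omega_5\wedge\theta^4, & d\theta^2&=(-\Omega_1-\tfrac12A)\wedge\theta^2-\Omega_2\wedge\theta^3-\Omega_4\wedge\theta^4,\\ d\theta^3&=\Omega_4\wedge\theta^1+\Omega_5\wedge\theta^2+(\Omega_6-\tfrac12A)\wedge\theta^3, & d\theta^4&=\Omega_2\wedge\theta^1+\Omega_3\wedge\theta^2+(-\Omega_6-\tfrac12A)\wedge\theta^4,\\ d\Omega_1&=\Omega_2\wedge\Omega_5-\Omega_3\wedge\Omega_4, & d\Omega_2&=\Omega_2\wedge(\Omega_1+\Omega_6),\\ d\Omega_3&=(\Omega_1-\Omega_6)\wedge\Omega_3, & d\Omega_4&=\Omega_4\wedge(\Omega_1-\Omega_6),\\ d\Omega_5&=(\Omega_1+\Omega_6)\wedge\Omega_5, & d\Omega_6&=\Omega_2\wedge\Omega_5+\Omega_3\wedge\Omega_4,\qquad dA=0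 . \end{aligned}$$ Let $g$ be the matrix of the split metric $2(\theta^1\theta^2+\theta^3\theta^4)$ on $\mathbb R^4$, let $\mathbf{CO}(2,2)=\{h\in GL(4,\mathbb R): h^{T}gh=cg \text{ for some } c>0\}$, and let $\Gamma^i{}_j=g^{ik}(\Gamma_{[kj]}+\tfrac12Ag_{kj})$, where $\Gamma_{[kj]}$ is skew-symmetric with $\Gamma_{[12]}=\Omega_1$, $\Gamma_{[13]}=\Omega_2$, $\Gamma_{[14]}=\Omega_4$, $\Gamma_{[23]}=\Omega_3$, $\Gamma_{[24]}=\Omega_5$, $\Gamma_{[34]}=\Omega_6$. Then every point of $P$ has an open neighbourhood $U$ with the following two properties. (1) $U$ is locally a principal bundle $\mathbf{CO}(2,2)\to U\to\mathcal S$ over a 4-manifold $\mathcal S$: there is a diffeomorphism $(\pi,h)$ of $U$ onto an open subset of the principal bundle $\mathcal S\times\mathbf{CO}(2,2)$, the tangent spaces of the fibres of $\pi$ being the common kernel of $\theta^1,\dots,\theta^4$, such that $\Gamma=h^{-1}dh$ (so $\Gamma$ is the Maurer-Cartan form on the fibres and a principal connection) and $\theta=h^{-1}\pi^*e$ for a smooth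 coframe $e=(e^1,\dots,e^4)$ on $\mathcal S$. (2) $U$ originates from a flat para-CR manifold of type $(1,2,3)$. That is, there is a 6-manifold $\Sigma$ with a smooth coframe $(\lambda,\mu_1,\mu_2,\nu_1,\nu_2,\nu_3)$ for which the distributions $\{\lambda=\mu_1=\mu_2=0\}$ and $\{\lambda=\nu_1=\nu_2=\nu_3=0\}$ are integrable, and which is flat: near each point of $\Sigma$ some diffeomorphism onto an open subset of $\mathbb R^6$, with coordinates $(x,y,a_0,a_1,a_2,a_3)$, pulls the forms $\lambda_0=da_0+x\,da_1+y\,da_2+xy\,da_3$, $\mu^0=(dx,dy)$, $\nu^0=(da_1,da_2,da_3)$ back to $a\lambda$, $f\mu+b\lambda$, $h\nu+c\lambda$ with matrix-valued functions $a,b,c,f,h$, $\det a\det f\det h\neq0$. Moreover: * there is a diffeomorphism $(\sigma,k)$ of $U$ onto an open subset of the principal bundle $\Sigma\times K$, where $K=\mathbf{Aff}(1)\times\mathbf{Aff}(1)\times\mathbb R^*$; the tangent spaces of the fibres of $\sigma$ are the common kernel of $\theta^1,\dots,\theta^4,\Omega_2,\Omega_3$, and on each fibre the Maurer-Cartan form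 $k^{-1}dk$ is $$\left(\begin{pmatrix}\Omega_1-\Omega_6&\Omega_4\\0&0\end{pmatrix},\ \begin{pmatrix}-\Omega_1-\Omega_6&\Omega_5\\0&0\end{pmatrix},\ A\right);$$ * on $U$, $\theta^4=a\,\sigma^*\lambda$, $\ \theta^i=b_i\,\sigma^*\lambda+\sum_{j=1}^3f_{ij}\,\sigma^*\nu_j$ $(i=1,2,3)$, and $(\Omega_3,\Omega_2)=(\Omega^{(1)},\Omega^{(2)})$ with $\Omega^{(\alpha)}=c_\alpha\,\sigma^*\lambda+\sum_{\beta=1}^2h_{\alpha\beta}\,\sigma^*\mu_\beta$, for smooth functions with $a\det(f_{ij})\det(h_{\alpha\beta})\ne0$, such that $(\sigma,a,b,c,f,h)$ is an injective immersion of $U$ into the bundle of all adapted coframes of $\Sigma$; * $\Omega_1,\Omega_4,\Omega_5,\Omega_6,A$ are on $U$ the only forms that complete these six forms to a solution of the above system: if smooth forms $\Omega'_1,\dots,\Omega'_6,A'$ satisfy $\Omega_2'=\Omega_2$, $\Omega_3'=\Omega_3$ on $U$ and, with the same $\theta^i$, the above system on $U$, then $\Omega'_\mu=\Omega_\mu$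 and $A'=A$ on $U$. -/

import Mathlib

open scoped Manifold ContDiff Matrix

noncomputable section

/-! ### One-forms on smooth manifolds -/

/-- A (not necessarily smooth) field of covectors on a manifold `M` modelled on `E`. -/
abbrev OneForm (E : Type*) [NormedAddCommGroup E] [NormedSpace ℝ E]
    (M : Type*) [TopologicalSpace M] [ChartedSpace E M] : Type _ :=
  (p : M) → TangentSpace 𝓘(ℝ, E) p →L[ℝ] ℝ

namespace OneForm

/-- The expression of a one-form in a chart `φ`: the pullback of `η` by `φ⁻¹`, a one-form on the
target of `φ` in the model space. -/
def inChart {E : Type*} [NormedAddCommGroup E] [NormedSpace ℝ E]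
    {M : Type*} [TopologicalSpace M] [ChartedSpace E M]
    (η : OneForm E M) (φ : OpenPartialHomeomorph M E) : E → E →L[ℝ] ℝ :=
  fun y => (η (φ.symm y)).comp (mfderiv 𝓘(ℝ, E) 𝓘(ℝ, E) φ.symm y)

/-- A one-form is smooth if its expression in every chart of the atlas is smooth. -/
def Smooth {E : Type*} [NormedAddCommGroup E] [NormedSpace ℝ E]
    {M : Type*} [TopologicalSpace M] [ChartedSpace E M] (η : OneForm E M) : Prop :=
  ∀ φ ∈ atlas E M, ContDiffOn ℝ ∞ (η.inChart φ) φ.target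

/-- The exterior derivative of a one-form, `dη_p (v, w)`, computed in the preferred chart at `p`.
(For smooth forms every other chart of the manifold gives the same value.) -/
def d {E : Type*} [NormedAddCommGroup E] [NormedSpace ℝ E]
    {M : Type*} [TopologicalSpace M] [ChartedSpace E M] (η : OneForm E M)
    (p : M) (v w : TangentSpace 𝓘(ℝ, E) p) : ℝ :=
  extDeriv (fun y : E => ContinuousAlternatingMap.ofSubsingleton ℝ E ℝ (0 : Fin 1)
      (η.inChart (chartAt E p) y)) (chartAt E p p)
    ![mfderiv 𝓘(ℝ, E) 𝓘(ℝ, E) (chartAt E p) p v, mfderiv 𝓘(ℝ, E) 𝓘(ℝ, E) (chartAt E p) p w]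

/-- The wedge product of two one-forms, `(α ∧ β)_p (v, w) = α(v) β(w) - α(w) β(v)`. -/
def wedge {E : Type*} [NormedAddCommGroup E] [NormedSpace ℝ E]
    {M : Type*} [TopologicalSpace M] [ChartedSpace E M] (α β : OneForm E M)
    (p : M) (v w : TangentSpace 𝓘(ℝ, E) p) : ℝ :=
  α p v * β p w - α p w * β p v

end OneForm

/-- A family of one-forms is a coframe if at each point it is a basis of the cotangent space. -/
def IsCoframe {E : Type*} [NormedAddCommGroup E] [NormedSpace ℝ E]
    {M : Type*} [TopologicalSpace M] [ChartedSpace E M] {ι : Type*}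
    (η : ι → OneForm E M) : Prop :=
  ∀ p : M, LinearIndependent ℝ (fun i => η i p) ∧
    Submodule.span ℝ (Set.range fun i => η i p) = ⊤

/-! ### Para-CR structures -/

/-- A family of one-forms `(λ_i, μ_A, ν_α)`, `i ≤ k`, `A ≤ r`, `α ≤ s`, representing an almost
para-CR structure of type `(k, r, s)` (see `IsParaCR`). -/
structure ParaCRForms (k r s : ℕ) (E : Type*) [NormedAddCommGroup E] [NormedSpace ℝ E]
    (M : Type*) [TopologicalSpace M] [ChartedSpace E M] where
  lam : Fin k → OneForm E M
  mu : Fin r → OneForm E M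
  nu : Fin s → OneForm E M

/-- `(λ_i, μ_A, ν_α)` represents a smooth (integrable) para-CR structure of type `(k, r, s)`:
the forms are a smooth coframe, and both `H⁻ = {λ = μ = 0}` and `H⁺ = {λ = ν = 0}` are integrable,
i.e. the differentials of the forms which define the distribution vanish on it. -/
structure IsParaCR {k r s : ℕ} {E : Type*} [NormedAddCommGroup E] [NormedSpace ℝ E]
    {M : Type*} [TopologicalSpace M] [ChartedSpace E M] (C : ParaCRForms k r s E M) : Prop where
  smooth_lam : ∀ i, (C.lam i).Smooth
  smooth_mu : ∀ i, (C.mu i).Smooth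
  smooth_nu : ∀ i, (C.nu i).Smooth
  coframe : IsCoframe (Sum.elim C.lam (Sum.elim C.mu C.nu))
  integrable_minus : ∀ (p : M) (v w : TangentSpace 𝓘(ℝ, E) p),
    (∀ i, C.lam i p v = 0 ∧ C.lam i p w = 0) → (∀ i, C.mu i p v = 0 ∧ C.mu i p w = 0) →
      (∀ i, (C.lam i).d p v w = 0) ∧ (∀ i, (C.mu i).d p v w = 0)
  integrable_plus : ∀ (p : M) (v w : TangentSpace 𝓘(ℝ, E) p),
    (∀ i, C.lam i p v = 0 ∧ C.lam i p w = 0) → (∀ i, C.nu i p v = 0 ∧ C.nu i p w = 0) →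
      (∀ i, (C.lam i).d p v w = 0) ∧ (∀ i, (C.nu i).d p v w = 0)

/-- Local para-CR equivalence: near every point of `M` there is a diffeomorphism `Φ` onto an open
subset of `M'` with `Φ^* λ' = a λ`, `Φ^* μ' = f μ + b λ`, `Φ^* ν' = h ν + c λ` for matrix-valued
functions `a, b, c, f, h` with `det a · det f · det h ≠ 0`. -/
def ParaCRForms.LocallyEquivalent {k r s : ℕ}
    {E : Type*} [NormedAddCommGroup E] [NormedSpace ℝ E]
    {M : Type*} [TopologicalSpace M] [ChartedSpace E M]
    {E' : Type*} [NormedAddCommGroup E'] [NormedSpace ℝ E']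
    {M' : Type*} [TopologicalSpace M'] [ChartedSpace E' M']
    (C : ParaCRForms k r s E M) (C' : ParaCRForms k r s E' M') : Prop :=
  ∀ q : M, ∃ Φ : OpenPartialHomeomorph M M', q ∈ Φ.source ∧
    ContMDiffOn 𝓘(ℝ, E) 𝓘(ℝ, E') ∞ Φ Φ.source ∧
    ContMDiffOn 𝓘(ℝ, E') 𝓘(ℝ, E) ∞ Φ.symm Φ.target ∧
    ∃ (a : M → Matrix (Fin k) (Fin k) ℝ) (b : M → Matrix (Fin r) (Fin k) ℝ)
      (c : M → Matrix (Fin s) (Fin k) ℝ) (f : M → Matrix (Fin r) (Fin r) ℝ)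
      (h : M → Matrix (Fin s) (Fin s) ℝ),
      ∀ p ∈ Φ.source, (a p).det * (f p).det * (h p).det ≠ 0 ∧
        ∀ v : TangentSpace 𝓘(ℝ, E) p,
          (∀ i, C'.lam i (Φ p) (mfderiv 𝓘(ℝ, E) 𝓘(ℝ, E') Φ p v)
            = ∑ j, a p i j * C.lam j p v) ∧
          (∀ i, C'.mu i (Φ p) (mfderiv 𝓘(ℝ, E) 𝓘(ℝ, E') Φ p v)
            = ∑ j, f p i j * C.mu j p v + ∑ j, b p i j * C.lam j p v) ∧
          (∀ i, C'.nu i (Φ p) (mfderiv 𝓘(ℝ, E) 𝓘(ℝ, E') Φ p v)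
            = ∑ j, h p i j * C.nu j p v + ∑ j, c p i j * C.lam j p v)

/-- The coordinate differential `dx_i` on `ℝⁿ`. -/
def coordForm {n : ℕ} (i : Fin n) :
    OneForm (EuclideanSpace ℝ (Fin n)) (EuclideanSpace ℝ (Fin n)) :=
  fun _ => (EuclideanSpace.proj i : EuclideanSpace ℝ (Fin n) →L[ℝ] ℝ)

/-- The type `(1,2,3)` para-CR structure of the system `z_xx = 0 = z_yy`, whose general solution is
`z = a₀ + a₁ x + a₂ y + a₃ x y`. In the coordinates `(x, y, a₀, a₁, a₂, a₃)` of `ℝ⁶` (numbered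
`0, …, 5`): `λ = da₀ + x da₁ + y da₂ + x y da₃`, `μ = (dx, dy)`, `ν = (da₁, da₂, da₃)`. -/
def flatModel : ParaCRForms 1 2 3 (EuclideanSpace ℝ (Fin 6)) (EuclideanSpace ℝ (Fin 6)) where
  lam := fun _ q => coordForm 2 q + q 0 • coordForm 3 q + q 1 • coordForm 4 q
    + (q 0 * q 1) • coordForm 5 q
  mu := ![coordForm 0, coordForm 1]
  nu := ![coordForm 3, coordForm 4, coordForm 5]

/-- A para-CR structure of type `(1,2,3)` is flat if it is locally equivalent to `flatModel`. -/
def ParaCRForms.IsFlat {E : Type*} [NormedAddCommGroup E] [NormedSpace ℝ E]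
    {M : Type*} [TopologicalSpace M] [ChartedSpace E M] (C : ParaCRForms 1 2 3 E M) : Prop :=
  C.LocallyEquivalent flatModel

/-! ### The flat structure equations -/

/-- The flat structure equations for the forms `(θ¹,…,θ⁴, Ω₁,…,Ω₆, A)` at the points of `U`.
Here `θ i` is `θ^{i+1}` and `Ω i` is `Ω_{i+1}`, the indices of `Fin` starting from `0`. -/
structure FlatSystemOn {E : Type*} [NormedAddCommGroup E] [NormedSpace ℝ E]
    {M : Type*} [TopologicalSpace M] [ChartedSpace E M] (U : Set M)
    (θ : Fin 4 → OneForm E M) (Ω : Fin 6 → OneForm E M) (A : OneForm E M) : Prop where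
  dθ1 : ∀ p ∈ U, (θ 0).d p = (Ω 0 - (1 / 2 : ℝ) • A).wedge (θ 0) p
    - (Ω 2).wedge (θ 2) p - (Ω 4).wedge (θ 3) p
  dθ2 : ∀ p ∈ U, (θ 1).d p = (-Ω 0 - (1 / 2 : ℝ) • A).wedge (θ 1) p
    - (Ω 1).wedge (θ 2) p - (Ω 3).wedge (θ 3) p
  dθ3 : ∀ p ∈ U, (θ 2).d p = (Ω 3).wedge (θ 0) p + (Ω 4).wedge (θ 1) p
    + (Ω 5 - (1 / 2 : ℝ) • A).wedge (θ 2) p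
  dθ4 : ∀ p ∈ U, (θ 3).d p = (Ω 1).wedge (θ 0) p + (Ω 2).wedge (θ 1) p
    + (-Ω 5 - (1 / 2 : ℝ) • A).wedge (θ 3) p
  dΩ1 : ∀ p ∈ U, (Ω 0).d p = (Ω 1).wedge (Ω 4) p - (Ω 2).wedge (Ω 3) p
  dΩ2 : ∀ p ∈ U, (Ω 1).d p = (Ω 1).wedge (Ω 0 + Ω 5) p
  dΩ3 : ∀ p ∈ U, (Ω 2).d p = (Ω 0 - Ω 5).wedge (Ω 2) p
  dΩ4 : ∀ p ∈ U, (Ω 3).d p = (Ω 3).wedge (Ω 0 - Ω 5) p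
  dΩ5 : ∀ p ∈ U, (Ω 4).d p = (Ω 0 + Ω 5).wedge (Ω 4) p
  dΩ6 : ∀ p ∈ U, (Ω 5).d p = (Ω 1).wedge (Ω 4) p + (Ω 2).wedge (Ω 3) p
  dA : ∀ p ∈ U, A.d p = 0

/-! ### The two structure groups -/

/-- The matrix of the metric `2(θ¹θ² + θ³θ⁴)` of signature `(2,2)` on `ℝ⁴`. -/
def splitMetric : Matrix (Fin 4) (Fin 4) ℝ :=
  !![0, 1, 0, 0; 1, 0, 0, 0; 0, 0, 0, 1; 0, 0, 1, 0]

/-- The homothetic group `CO(2,2) = {h : hᵀ g h = c g for some c > 0}` of `splitMetric`. -/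
def CO22 : Subgroup (GL (Fin 4) ℝ) where
  carrier := {h | ∃ c : ℝ, 0 < c ∧
    (h : Matrix (Fin 4) (Fin 4) ℝ)ᵀ * splitMetric * (h : Matrix (Fin 4) (Fin 4) ℝ)
      = c • splitMetric}
  mul_mem' := by
    rintro x y ⟨c, hc, hx⟩ ⟨e, he, hy⟩
    refine ⟨c * e, mul_pos hc he, ?_⟩
    have : ((x * y : GL (Fin 4) ℝ) : Matrix (Fin 4) (Fin 4) ℝ)ᵀ * splitMetric
        * ((x * y : GL (Fin 4) ℝ) : Matrix (Fin 4) (Fin 4) ℝ)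
        = (y : Matrix (Fin 4) (Fin 4) ℝ)ᵀ
          * ((x : Matrix (Fin 4) (Fin 4) ℝ)ᵀ * splitMetric * (x : Matrix (Fin 4) (Fin 4) ℝ))
          * (y : Matrix (Fin 4) (Fin 4) ℝ) := by
      simp only [Units.val_mul, Matrix.transpose_mul, Matrix.mul_assoc]
    rw [this, hx, Matrix.mul_smul, Matrix.smul_mul, hy, smul_smul]
  one_mem' := ⟨1, one_pos, by simp⟩
  inv_mem' := by
    rintro x ⟨c, hc, hx⟩
    refine ⟨c⁻¹, inv_pos.mpr hc, ?_⟩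
    have h1 : (x : Matrix (Fin 4) (Fin 4) ℝ) * ((x⁻¹ : GL (Fin 4) ℝ) : Matrix (Fin 4) (Fin 4) ℝ)
        = 1 := x.mul_inv
    have h2 : ((x⁻¹ : GL (Fin 4) ℝ) : Matrix (Fin 4) (Fin 4) ℝ)ᵀ
        * (x : Matrix (Fin 4) (Fin 4) ℝ)ᵀ = 1 := by
      rw [← Matrix.transpose_mul, h1, Matrix.transpose_one]
    generalize ((x⁻¹ : GL (Fin 4) ℝ) : Matrix (Fin 4) (Fin 4) ℝ) = y at *
    generalize (x : Matrix (Fin 4) (Fin 4) ℝ) = z at *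
    have h3 : c • (yᵀ * splitMetric * y) = splitMetric := by
      calc c • (yᵀ * splitMetric * y) = yᵀ * (c • splitMetric) * y := by
            rw [Matrix.mul_smul, Matrix.smul_mul]
        _ = (yᵀ * zᵀ) * splitMetric * (z * y) := by
            rw [← hx]; simp only [Matrix.mul_assoc]
        _ = splitMetric := by rw [h1, h2, Matrix.one_mul, Matrix.mul_one]
    rw [← h3, smul_smul, inv_mul_cancel₀ hc.ne', one_smul, h3]

/-- The affine group `Aff(1)` of the real line, `t ↦ a t + b` being the invertible matrix
`(a b; 0 1)`. -/
def Aff1 : Subgroup (GL (Fin 2) ℝ) where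
  carrier := {m | m 1 0 = 0 ∧ m 1 1 = 1}
  mul_mem' := by
    rintro x y ⟨hx, hx'⟩ ⟨hy, hy'⟩
    constructor <;>
      simp [Matrix.mul_apply, Fin.sum_univ_two, hx, hx', hy, hy']
  one_mem' := by constructor <;> simp
  inv_mem' := by
    rintro x ⟨hx, hx'⟩
    have h := x.mul_inv
    generalize hy : ((x⁻¹ : GL (Fin 2) ℝ) : Matrix (Fin 2) (Fin 2) ℝ) = y at h
    have h0 := congrFun (congrFun h 1) 0
    have h1 := congrFun (congrFun h 1) 1
    simp [Matrix.mul_apply, Fin.sum_univ_two, hx, hx'] at h0 h1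
    exact ⟨by rw [hy]; exact h0, by rw [hy]; exact h1⟩

/-- The block diagonal matrix with blocks `m`, `m'`, `(t)`. -/
def blockMatrix (m m' : Matrix (Fin 2) (Fin 2) ℝ) (t : ℝ) :
    Matrix (Fin 2 ⊕ Fin 2 ⊕ Unit) (Fin 2 ⊕ Fin 2 ⊕ Unit) ℝ :=
  Matrix.fromBlocks m 0 0 (Matrix.fromBlocks m' 0 0 (t • (1 : Matrix Unit Unit ℝ)))

theorem blockMatrix_mul (m m' n n' : Matrix (Fin 2) (Fin 2) ℝ) (t u : ℝ) :
    blockMatrix (m * n) (m' * n') (t * u) = blockMatrix m m' t * blockMatrix n n' u := by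
  simp [blockMatrix, Matrix.fromBlocks_multiply, smul_smul, mul_comm]

theorem blockMatrix_one : blockMatrix 1 1 1 = 1 := by
  simp [blockMatrix]

/-- The block diagonal embedding of `GL(2) × GL(2) × ℝ^*` into invertible matrices. -/
def blockHom : (GL (Fin 2) ℝ × GL (Fin 2) ℝ × ℝˣ) →* GL (Fin 2 ⊕ Fin 2 ⊕ Unit) ℝ where
  toFun x :=
    { val := blockMatrix x.1 x.2.1 x.2.2
      inv := blockMatrix (x.1⁻¹ : GL (Fin 2) ℝ) (x.2.1⁻¹ : GL (Fin 2) ℝ) (x.2.2⁻¹ : ℝˣ)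
      val_inv := by
        rw [← blockMatrix_mul, ← Units.val_mul, ← Units.val_mul, ← Units.val_mul]
        simp [blockMatrix_one]
      inv_val := by
        rw [← blockMatrix_mul, ← Units.val_mul, ← Units.val_mul, ← Units.val_mul]
        simp [blockMatrix_one] }
  map_one' := by
    apply Units.ext
    simp [blockMatrix_one]
  map_mul' x y := by
    apply Units.ext
    simp [blockMatrix_mul]

/-- The group `K = Aff(1) × Aff(1) × ℝ^*`, realised by block diagonal matrices. -/
def groupK : Subgroup (GL (Fin 2 ⊕ Fin 2 ⊕ Unit) ℝ) :=
  (Aff1.prod (Aff1.prod ⊤)).map blockHom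

/-! ### Local principal bundles -/

/-- The differential `dg` of a map into matrices, entry by entry. -/
def matDiff {n : Type*} [Fintype n] [DecidableEq n]
    {E : Type*} [NormedAddCommGroup E] [NormedSpace ℝ E]
    {M : Type*} [TopologicalSpace M] [ChartedSpace E M]
    (g : M → GL n ℝ) (p : M) (v : TangentSpace 𝓘(ℝ, E) p) : Matrix n n ℝ :=
  Matrix.of fun i j => mvfderiv 𝓘(ℝ, E) (fun q => g q i j) p v

/-- `U` is locally a principal `G`-bundle over `B`, where `G` is a closed matrix group:
`π : U → B` and `g : U → G` are smooth and `p ↦ (π p, g p)` is a diffeomorphism (an injective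
immersion with open image and continuous inverse) of the open set `U` onto an open subset of the
principal bundle `B × G → B`, on which `G` acts by right multiplication of the second factor.
Moreover the fibres carry the matrix `η` of one-forms as their Maurer-Cartan form: `η = g⁻¹ dg` on
vectors tangent to the fibres. -/
structure IsLocalPrincipalBundle {n : Type*} [Fintype n] [DecidableEq n]
    {E : Type*} [NormedAddCommGroup E] [NormedSpace ℝ E]
    {M : Type*} [TopologicalSpace M] [ChartedSpace E M]
    {F : Type*} [NormedAddCommGroup F] [NormedSpace ℝ F]
    {B : Type*} [TopologicalSpace B] [ChartedSpace F B]
    (G : Subgroup (GL n ℝ)) (U : Set M) (π : M → B) (g : M → GL n ℝ)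
    (η : (p : M) → TangentSpace 𝓘(ℝ, E) p → Matrix n n ℝ) : Prop where
  isOpen : IsOpen U
  smooth_proj : ContMDiffOn 𝓘(ℝ, E) 𝓘(ℝ, F) ∞ π U
  smooth_group : ∀ i j, ContMDiffOn 𝓘(ℝ, E) 𝓘(ℝ, ℝ) ∞ (fun p => g p i j) U
  mem_group : ∀ p ∈ U, g p ∈ G
  immersion : ∀ p ∈ U, ∀ v : TangentSpace 𝓘(ℝ, E) p,
    mfderiv 𝓘(ℝ, E) 𝓘(ℝ, F) π p v = 0 → matDiff g p v = 0 → v = 0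
  openEmbedding : Topology.IsOpenEmbedding
    (fun p : U => ((π p, ⟨g p, mem_group p p.2⟩) : B × G))
  maurerCartan : ∀ p ∈ U, ∀ v : TangentSpace 𝓘(ℝ, E) p,
    mfderiv 𝓘(ℝ, E) 𝓘(ℝ, F) π p v = 0 →
      η p v = ((g p)⁻¹ : GL n ℝ).val * matDiff g p v

/-- The `co(2,2)`-valued form `Γ^i_j = g^{ik} (Γ_[kj] + ½ A g_kj)`, where `Γ_[kj]` is the skew
matrix with upper entries `Ω₁, Ω₂, Ω₄, Ω₃, Ω₅, Ω₆`; `g^{ik}` has the same matrix as `g_{ik}`. -/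
def gammaForm {E : Type*} [NormedAddCommGroup E] [NormedSpace ℝ E]
    {M : Type*} [TopologicalSpace M] [ChartedSpace E M]
    (Ω : Fin 6 → OneForm E M) (A : OneForm E M)
    (p : M) (v : TangentSpace 𝓘(ℝ, E) p) : Matrix (Fin 4) (Fin 4) ℝ :=
  splitMetric * (!![0, Ω 0 p v, Ω 1 p v, Ω 3 p v;
                    -Ω 0 p v, 0, Ω 2 p v, Ω 4 p v;
                    -Ω 1 p v, -Ω 2 p v, 0, Ω 5 p v;
                    -Ω 3 p v, -Ω 4 p v, -Ω 5 p v, 0] + (A p v / 2) • splitMetric)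

/-- The form with values in the Lie algebra of `groupK` built from `(Ω₁, Ω₄, Ω₅, Ω₆, A)`. -/
def kappaForm {E : Type*} [NormedAddCommGroup E] [NormedSpace ℝ E]
    {M : Type*} [TopologicalSpace M] [ChartedSpace E M]
    (Ω : Fin 6 → OneForm E M) (A : OneForm E M) (p : M) (v : TangentSpace 𝓘(ℝ, E) p) :
    Matrix (Fin 2 ⊕ Fin 2 ⊕ Unit) (Fin 2 ⊕ Fin 2 ⊕ Unit) ℝ :=
  blockMatrix !![Ω 0 p v - Ω 5 p v, Ω 3 p v; 0, 0]
    !![-(Ω 0 p v + Ω 5 p v), Ω 4 p v; 0, 0] (A p v)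

/-- The open set `U`, with the forms `(θ, Ω, A)`, is locally a principal `CO(2,2)`-bundle over a
4-manifold `S`. The fibres are the leaves of the distribution `θ¹ = … = θ⁴ = 0`, the matrix `Γ` is
a principal connection (it equals `h⁻¹ dh` in the trivialization), and `θ` is the equivariant
soldering form `h⁻¹ π^* e` of a coframe `e` of `S`. -/
def IsLocallyCO22Bundle {E : Type*} [NormedAddCommGroup E] [NormedSpace ℝ E]
    {M : Type*} [TopologicalSpace M] [ChartedSpace E M] (U : Set M)
    (θ : Fin 4 → OneForm E M) (Ω : Fin 6 → OneForm E M) (A : OneForm E M) : Prop :=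
  ∃ (S : Type) (_ : TopologicalSpace S) (_ : ChartedSpace (EuclideanSpace ℝ (Fin 4)) S)
    (_ : IsManifold 𝓘(ℝ, EuclideanSpace ℝ (Fin 4)) ∞ S) (_ : T2Space S)
    (_ : SecondCountableTopology S)
    (π : M → S) (h : M → GL (Fin 4) ℝ) (e : Fin 4 → OneForm (EuclideanSpace ℝ (Fin 4)) S),
    IsLocalPrincipalBundle (F := EuclideanSpace ℝ (Fin 4)) CO22 U π h (gammaForm Ω A) ∧
    (∀ i, (e i).Smooth) ∧ IsCoframe e ∧
    ∀ p ∈ U, ∀ v : TangentSpace 𝓘(ℝ, E) p,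
      (mfderiv 𝓘(ℝ, E) 𝓘(ℝ, EuclideanSpace ℝ (Fin 4)) π p v = 0 ↔ ∀ i, θ i p v = 0) ∧
      gammaForm Ω A p v = ((h p)⁻¹ : GL (Fin 4) ℝ).val * matDiff h p v ∧
      ∀ i, θ i p v = ∑ j, ((h p)⁻¹ : GL (Fin 4) ℝ).val i j
        * e j (π p) (mfderiv 𝓘(ℝ, E) 𝓘(ℝ, EuclideanSpace ℝ (Fin 4)) π p v)

/-- `U` with the forms `(θ, Ω, A)` arises from the para-CR structure `C` of type `(1,2,3)` on `B`
by Cartan's procedure along `σ : U → B`. The forms `(θ⁴, θ¹, θ², θ³, Ω₃, Ω₂)` are obtained from the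
general adapted coframe `(a λ, b λ + f ν, c λ + h μ)` of the class of `C`, the group parameters
`(a, b, c, f, h)` being functions on `U`, so that `U` is an immersed submanifold, without
self-intersections, of the bundle of all adapted coframes of `C`; and the forms
`(Ω₁, Ω₄, Ω₅, Ω₆, A)` are the only ones which supplement these six forms to a solution of the flat
structure equations. -/
structure ArisesFromParaCR {E : Type*} [NormedAddCommGroup E] [NormedSpace ℝ E]
    {M : Type*} [TopologicalSpace M] [ChartedSpace E M]
    {F : Type*} [NormedAddCommGroup F] [NormedSpace ℝ F]
    {B : Type*} [TopologicalSpace B] [ChartedSpace F B]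
    (U : Set M) (θ : Fin 4 → OneForm E M) (Ω : Fin 6 → OneForm E M) (A : OneForm E M)
    (σ : M → B) (C : ParaCRForms 1 2 3 F B) : Prop where
  exists_parameters : ∃ (a : M → ℝ) (b : Fin 3 → M → ℝ) (c : Fin 2 → M → ℝ)
      (f : Fin 3 → Fin 3 → M → ℝ) (h : Fin 2 → Fin 2 → M → ℝ),
    ContMDiffOn 𝓘(ℝ, E) 𝓘(ℝ, ℝ) ∞ a U ∧
    (∀ i, ContMDiffOn 𝓘(ℝ, E) 𝓘(ℝ, ℝ) ∞ (b i) U) ∧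
    (∀ i, ContMDiffOn 𝓘(ℝ, E) 𝓘(ℝ, ℝ) ∞ (c i) U) ∧
    (∀ i j, ContMDiffOn 𝓘(ℝ, E) 𝓘(ℝ, ℝ) ∞ (f i j) U) ∧
    (∀ i j, ContMDiffOn 𝓘(ℝ, E) 𝓘(ℝ, ℝ) ∞ (h i j) U) ∧
    (∀ p ∈ U, a p ≠ 0 ∧ (Matrix.of fun i j => f i j p).det ≠ 0 ∧
      (Matrix.of fun i j => h i j p).det ≠ 0) ∧
    (∀ p ∈ U, ∀ v : TangentSpace 𝓘(ℝ, E) p,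
      θ 3 p v = a p * C.lam 0 (σ p) (mfderiv 𝓘(ℝ, E) 𝓘(ℝ, F) σ p v) ∧
      (∀ i : Fin 3, θ i.castSucc p v =
        b i p * C.lam 0 (σ p) (mfderiv 𝓘(ℝ, E) 𝓘(ℝ, F) σ p v)
          + ∑ j, f i j p * C.nu j (σ p) (mfderiv 𝓘(ℝ, E) 𝓘(ℝ, F) σ p v)) ∧
      (∀ i : Fin 2, (![Ω 2 p v, Ω 1 p v] : Fin 2 → ℝ) i =
        c i p * C.lam 0 (σ p) (mfderiv 𝓘(ℝ, E) 𝓘(ℝ, F) σ p v)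
          + ∑ j, h i j p * C.mu j (σ p) (mfderiv 𝓘(ℝ, E) 𝓘(ℝ, F) σ p v))) ∧
    (∀ p ∈ U, ∀ q ∈ U, σ p = σ q → a p = a q → (∀ i, b i p = b i q) → (∀ i, c i p = c i q) →
      (∀ i j, f i j p = f i j q) → (∀ i j, h i j p = h i j q) → p = q) ∧
    (∀ p ∈ U, ∀ v : TangentSpace 𝓘(ℝ, E) p, mfderiv 𝓘(ℝ, E) 𝓘(ℝ, F) σ p v = 0 →
      mvfderiv 𝓘(ℝ, E) a p v = 0 → (∀ i, mvfderiv 𝓘(ℝ, E) (b i) p v = 0) →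
      (∀ i, mvfderiv 𝓘(ℝ, E) (c i) p v = 0) → (∀ i j, mvfderiv 𝓘(ℝ, E) (f i j) p v = 0) →
      (∀ i j, mvfderiv 𝓘(ℝ, E) (h i j) p v = 0) → v = 0)
  system : FlatSystemOn U θ Ω A
  unique : ∀ (Ω' : Fin 6 → OneForm E M) (A' : OneForm E M), (∀ i, (Ω' i).Smooth) → A'.Smooth →
    (∀ p ∈ U, Ω' 1 p = Ω 1 p ∧ Ω' 2 p = Ω 2 p) → FlatSystemOn U θ Ω' A' →
    ∀ p ∈ U, (∀ i, Ω' i p = Ω i p) ∧ A' p = A p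

/-- The open set `U`, with the forms `(θ, Ω, A)`, originates from a flat para-CR manifold `B` of
type `(1,2,3)`: it is locally a principal bundle over the 6-manifold `B` with group
`K = Aff(1) × Aff(1) × ℝ^*`, whose fibres are the leaves of the distribution
`θ¹ = … = θ⁴ = Ω₂ = Ω₃ = 0`, and the forms arise from the para-CR structure of `B` by Cartan's
procedure. -/
def OriginatesFromFlatParaCR {E : Type*} [NormedAddCommGroup E] [NormedSpace ℝ E]
    {M : Type*} [TopologicalSpace M] [ChartedSpace E M] (U : Set M)
    (θ : Fin 4 → OneForm E M) (Ω : Fin 6 → OneForm E M) (A : OneForm E M) : Prop :=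
  ∃ (B : Type) (_ : TopologicalSpace B) (_ : ChartedSpace (EuclideanSpace ℝ (Fin 6)) B)
    (_ : IsManifold 𝓘(ℝ, EuclideanSpace ℝ (Fin 6)) ∞ B) (_ : T2Space B)
    (_ : SecondCountableTopology B)
    (C : ParaCRForms 1 2 3 (EuclideanSpace ℝ (Fin 6)) B)
    (σ : M → B) (k : M → GL (Fin 2 ⊕ Fin 2 ⊕ Unit) ℝ),
    IsParaCR C ∧ C.IsFlat ∧
    IsLocalPrincipalBundle (F := EuclideanSpace ℝ (Fin 6)) groupK U σ k (kappaForm Ω A) ∧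
    (∀ p ∈ U, ∀ v : TangentSpace 𝓘(ℝ, E) p,
      mfderiv 𝓘(ℝ, E) 𝓘(ℝ, EuclideanSpace ℝ (Fin 6)) σ p v = 0 ↔
        (∀ i, θ i p v = 0) ∧ Ω 1 p v = 0 ∧ Ω 2 p v = 0) ∧
    ArisesFromParaCR (F := EuclideanSpace ℝ (Fin 6)) U θ Ω A σ C

end

/-! Indices start from 0 below, as in the code. The structure equations say exactly that the 5×5
matrix of one-forms ω = (Γ θ; 0 0) satisfies dω + ω∧ω = 0 (`affineConnection_flat`), so the manifold
is locally the group CO(2,2) ⋉ ℝ⁴ with its Maurer-Cartan form. Concretely, the linear total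
differential system du = uω is completely integrable. Solving it in a chart, with the first four
unit row vectors as initial values, gives functions H, X with dH = HΓ and dX = Hθ
(`exists_flatIntegral`). Since Γ is co(2,2)-valued, Q = HgHᵀ satisfies dQ = QA, so it stays a
positive multiple c of g and H takes values in CO(2,2). Everything else is read off from H and X.

The first fibration is the pair (X, H) over ℝ⁴ with e the coordinate coframe: Γ = H⁻¹dH and θ =
H⁻¹dX are the equations just integrated.

For the second fibration one keeps X and the direction of column 2 of H, which is null. Modulo the
column itself, its differential involves only `Ω 1` and `Ω 2`, so the slopes x = H₁₂/H₂₂ and y =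
H₀₂/H₂₂ are constant on the leaves in question, and nullity gives H₃₂/H₂₂ = -xy. Row 3 of H⁻¹ is the
metric dual of this column divided by c, whence `θ 3` = (H₂₂/c)(dX₃ + x dX₀ + y dX₁ - xy dX₂). With
a₀ = X₃, a₁ = X₀, a₂ = X₁, a₃ = -X₂ this is a multiple of the contact form of the flat model
(`conformalInverse_three`, `contact_eq`), so the base can be taken to be ℝ⁶ with the flat model
itself. The fibre coordinates on K are c and components of wedge products of two columns of H; the
two affine factors correspond to the two null planes through column 2, spanned with column 1 and
with column 0.

Both families of 11 functions have injective differential at the point where H = 1, so they are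
local charts by the inverse function theorem, and `isOpenEmbedding_of_coordinates` turns this into
the required open embeddings. Uniqueness of the remaining connection forms is linear algebra in the
exterior algebra (`connection_difference_eq_zero`).

The Frobenius theorem needed is proved by solving the system along rays from the base point and
comparing neighbouring rays by Gronwall (`exists_linear_frobenius_solution`); smoothness then
follows by bootstrapping. -/

noncomputable section

set_option maxSynthPendingDepth 3

/-! ### Linear total differential equations -/

section LinearFrobenius

open Set Metric

variable {E V : Type*} [NormedAddCommGroup E] [NormedSpace ℝ E]
  [NormedAddCommGroup V] [NormedSpace ℝ V]

/-- A linear differential equation with small continuous coefficient has a solution on `[0, 1]`. -/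
theorem exists_linear_ode_solution [CompleteSpace V] (f : ℝ → V →L[ℝ] V)
    (hf : ContinuousOn f (Icc 0 1)) (hb : ∀ t ∈ Icc (0 : ℝ) 1, ‖f t‖ ≤ 1 / 2) (u₀ : V) :
    ∃ u : ℝ → V, u 0 = u₀ ∧ (∀ t ∈ Icc (0 : ℝ) 1, ‖u t‖ ≤ 2 * ‖u₀‖) ∧
      ∀ t ∈ Icc (0 : ℝ) 1, HasDerivWithinAt u (f t (u t)) (Icc 0 1) t := by
  have hbd : ∀ x ∈ closedBall u₀ ‖u₀‖, ‖x‖ ≤ 2 * ‖u₀‖ := fun x hx => by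
    rw [mem_closedBall, dist_eq_norm] at hx
    have := norm_add_le (x - u₀) u₀
    simp only [sub_add_cancel] at this hx
    linarith
  -- On the ball of radius ‖u₀‖ about u₀ the speed is at most ½ · 2‖u₀‖ = ‖u₀‖, so a solution cannot
  -- leave the ball within unit time.
  have hP : IsPicardLindelof (fun t u => f t u) (tmin := 0) (tmax := 1) ⟨0, by simp⟩ u₀
      ‖u₀‖₊ 0 ‖u₀‖₊ 1 := by
    refine ⟨fun t ht => ?_, fun x _ => ?_, fun t ht x hx => ?_, by simp⟩
    · refine ((f t).lipschitz.weaken ?_).lipschitzOnWith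
      have := hb t ht
      rw [← NNReal.coe_le_coe]; push_cast; linarith
    · exact hf.clm_apply continuousOn_const
    · calc ‖f t x‖ ≤ ‖f t‖ * ‖x‖ := (f t).le_opNorm x
        _ ≤ 1 / 2 * (2 * ‖u₀‖) :=
          mul_le_mul (hb t ht) (hbd x hx) (norm_nonneg _) (by norm_num)
        _ = _ := by simp
  -- The fixed point of the Picard operator is used directly because it carries, besides the
  -- equation, the fact that its values stay in the ball.
  obtain ⟨α, hα⟩ := ODE.FunSpace.exists_isFixedPt_next hP (x := u₀) (by simp)
  have hp : ∀ t ∈ Icc (0 : ℝ) 1, α.compProj t =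
      ODE.picard (fun t u => f t u) 0 u₀ α.compProj t := fun t ht => by
    conv_lhs => rw [ODE.FunSpace.compProj_of_mem ht, ← hα]
    rfl
  refine ⟨α.compProj, ?_, fun t _ => hbd _ (α.compProj_mem_closedBall hP.mul_max_le),
    fun t ht => ?_⟩
  · rw [hp 0 (by simp)]; simp
  · refine (ODE.hasDerivWithinAt_picard_Icc (u := univ) (f := fun t u => f t u) (by simp) ?_
      α.continuous_compProj.continuousOn (fun _ _ => mem_univ _) u₀ ht).congr hp (hp t ht)
    exact (hf.comp continuousOn_fst fun x hx => hx.1).clm_apply continuousOn_snd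

/-- The derivative of the deviation `u' - u - t • a v u` along two neighbouring rays is
quadratically small up to a multiple of the deviation itself. -/
theorem norm_deviation_deriv_le {a a' : E →L[ℝ] V →L[ℝ] V} {D : E →L[ℝ] E →L[ℝ] V →L[ℝ] V}
    {e v : E} {u u' : V} {t C B : ℝ} (hC : 1 ≤ C) (ht : t ∈ Icc (0 : ℝ) 1)
    (hflat : D e v + (a v).comp (a e) = D v e + (a e).comp (a v))
    (he : ‖e‖ ≤ 1) (hev : ‖e + v‖ ≤ 1) (hu : ‖u‖ ≤ B) (ha : ‖a‖ ≤ C) (ha' : ‖a'‖ ≤ C)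
    (hD : ‖D‖ ≤ C) (hL : ‖a' - a‖ ≤ C * ‖v‖) (hR : ‖a' - a - t • D v‖ ≤ C * ‖v‖ ^ 2) :
    ‖a' (e + v) u' - a e u - (t • (D e v u + a v (a e u)) + a v u)‖ ≤
      C * ‖u' - u - t • a v u‖ + 4 * C ^ 2 * B * ‖v‖ ^ 2 := by
  have hC0 : 0 ≤ C := by linarith
  have hB : 0 ≤ B := (norm_nonneg u).trans hu
  have hv := norm_nonneg v
  have hf : D e v u + a v (a e u) = D v e u + a e (a v u) := by
    simpa using congrArg (fun T : V →L[ℝ] V => T u) hflat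
  -- Flatness exchanges e and v in D e v + a v ∘ a e. After the exchange the first-order terms
  -- cancel, leaving the deviation itself and terms of second order in v.
  have hdec : a' (e + v) u' - a e u - (t • (D e v u + a v (a e u)) + a v u) =
      a' (e + v) (u' - u - t • a v u) + ((a' - a - t • D v) (e + v) u + t • D v v u
        + t • ((a' - a) e (a v u) + a' v (a v u))) := by
    rw [hf]
    simp only [map_add, map_sub, map_smul, sub_apply, add_apply, smul_apply, smul_add, smul_sub]
    abel
  have hav : ‖a v u‖ ≤ C * ‖v‖ * B :=
    ((a v).le_of_opNorm_le ((a.le_of_opNorm_le ha v)) u).trans (by gcongr)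
  have h1 : ‖a' (e + v) (u' - u - t • a v u)‖ ≤ C * ‖u' - u - t • a v u‖ := by
    refine (a' (e + v)).le_of_opNorm_le ((a'.le_of_opNorm_le ha' _).trans ?_) _
    exact mul_le_of_le_one_right hC0 hev
  have h2 : ‖(a' - a - t • D v) (e + v) u‖ ≤ C * ‖v‖ ^ 2 * B := by
    refine (ContinuousLinearMap.le_of_opNorm_le _
      ((ContinuousLinearMap.le_of_opNorm_le _ hR _).trans
        (mul_le_of_le_one_right (by positivity) hev)) u).trans (by gcongr)
  have h3 : ‖t • D v v u‖ ≤ C * ‖v‖ ^ 2 * B := by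
    rw [norm_smul, Real.norm_eq_abs, abs_of_nonneg ht.1]
    refine (mul_le_of_le_one_left (norm_nonneg _) ht.2).trans ?_
    refine ((D v v).le_of_opNorm_le ((D v).le_of_opNorm_le (D.le_of_opNorm_le hD v) v) u).trans ?_
    rw [pow_two, ← mul_assoc]
    gcongr
  have h4 : ‖t • ((a' - a) e (a v u) + a' v (a v u))‖ ≤ 2 * C ^ 2 * ‖v‖ ^ 2 * B := by
    rw [norm_smul, Real.norm_eq_abs, abs_of_nonneg ht.1]
    refine (mul_le_of_le_one_left (norm_nonneg _) ht.2).trans ((norm_add_le _ _).trans ?_)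
    have h5 : ‖(a' - a) e (a v u)‖ ≤ C * ‖v‖ * (C * ‖v‖ * B) :=
      (ContinuousLinearMap.le_of_opNorm_le _
        ((ContinuousLinearMap.le_of_opNorm_le _ hL _).trans
          (mul_le_of_le_one_right (by positivity) he)) _).trans (by gcongr)
    have h6 : ‖a' v (a v u)‖ ≤ C * ‖v‖ * (C * ‖v‖ * B) :=
      ((a' v).le_of_opNorm_le (a'.le_of_opNorm_le ha' v) _).trans (by gcongr)
    linarith
  rw [hdec]
  refine (norm_add_le _ _).trans (add_le_add h1 ?_)
  refine (norm_add_le _ _).trans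
    ((add_le_add ((norm_add_le _ _).trans (add_le_add h2 h3)) h4).trans ?_)
  -- Two of the error terms are CB‖v‖² and one is 2C²B‖v‖²; since C ≥ 1 they add up to at most
  -- 4C²B‖v‖².
  have : 0 ≤ ‖v‖ ^ 2 * B * C := by positivity
  nlinarith

/-- Comparison of the solutions of a flat linear system along two neighbouring rays. -/
theorem norm_radial_solution_sub_le {η : E → E →L[ℝ] V →L[ℝ] V} {x₀ e v : E} {u u' : ℝ → V}
    {C B : ℝ} (hC : 1 ≤ C) (he : ‖e‖ ≤ 1) (hev : ‖e + v‖ ≤ 1)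
    (hd : ∀ t ∈ Icc (0 : ℝ) 1, HasFDerivAt η (fderiv ℝ η (x₀ + t • e)) (x₀ + t • e))
    (hflat : ∀ t ∈ Icc (0 : ℝ) 1, fderiv ℝ η (x₀ + t • e) e v +
      (η (x₀ + t • e) v).comp (η (x₀ + t • e) e) = fderiv ℝ η (x₀ + t • e) v e +
      (η (x₀ + t • e) e).comp (η (x₀ + t • e) v))
    (bη : ∀ t ∈ Icc (0 : ℝ) 1, ‖η (x₀ + t • e)‖ ≤ C)
    (bη' : ∀ t ∈ Icc (0 : ℝ) 1, ‖η (x₀ + t • (e + v))‖ ≤ C)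
    (bD : ∀ t ∈ Icc (0 : ℝ) 1, ‖fderiv ℝ η (x₀ + t • e)‖ ≤ C)
    (bL : ∀ t ∈ Icc (0 : ℝ) 1, ‖η (x₀ + t • (e + v)) - η (x₀ + t • e)‖ ≤ C * ‖t • v‖)
    (bR : ∀ t ∈ Icc (0 : ℝ) 1, ‖η (x₀ + t • (e + v)) - η (x₀ + t • e)
      - fderiv ℝ η (x₀ + t • e) (t • v)‖ ≤ C * ‖t • v‖ * ‖t • v‖)
    (hB : ∀ t ∈ Icc (0 : ℝ) 1, ‖u t‖ ≤ B) (h0 : u' 0 = u 0)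
    (hu : ∀ t ∈ Icc (0 : ℝ) 1, HasDerivWithinAt u (η (x₀ + t • e) e (u t)) (Icc 0 1) t)
    (hu' : ∀ t ∈ Icc (0 : ℝ) 1,
      HasDerivWithinAt u' (η (x₀ + t • (e + v)) (e + v) (u' t)) (Icc 0 1) t) :
    ‖u' 1 - u 1 - η (x₀ + e) v (u 1)‖ ≤ 4 * C * B * Real.exp C * ‖v‖ ^ 2 := by
  have hC0 : 0 < C := by linarith
  have hB0 : 0 ≤ B := (norm_nonneg _).trans (hB 0 (by simp))
  have hseg : ∀ t ∈ Icc (0 : ℝ) 1, ‖t • v‖ ≤ ‖v‖ := fun t ht => by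
    rw [norm_smul, Real.norm_eq_abs, abs_of_nonneg ht.1]
    exact mul_le_of_le_one_left (norm_nonneg _) ht.2
  have hderiv : ∀ t ∈ Icc (0 : ℝ) 1, HasDerivWithinAt
      (fun t => u' t - u t - t • η (x₀ + t • e) v (u t))
      (η (x₀ + t • (e + v)) (e + v) (u' t) - η (x₀ + t • e) e (u t) -
        (t • (fderiv ℝ η (x₀ + t • e) e v (u t) + η (x₀ + t • e) v
          (η (x₀ + t • e) e (u t))) + η (x₀ + t • e) v (u t))) (Icc 0 1) t := by
    intro t ht
    have hline : HasDerivWithinAt (fun t : ℝ => x₀ + t • e) e (Icc 0 1) t := by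
      simpa using (((hasDerivAt_id t).smul_const e).const_add x₀).hasDerivWithinAt
    have h1 : HasDerivWithinAt (fun t : ℝ => η (x₀ + t • e))
        (fderiv ℝ η (x₀ + t • e) e) (Icc 0 1) t := (hd t ht).comp_hasDerivWithinAt t hline
    have h2 : HasDerivWithinAt (fun t : ℝ => η (x₀ + t • e) v)
        (fderiv ℝ η (x₀ + t • e) e v) (Icc 0 1) t := by
      simpa using h1.clm_apply (hasDerivWithinAt_const t _ v)
    have h3 : HasDerivWithinAt (fun t : ℝ => η (x₀ + t • e) v (u t))
        (fderiv ℝ η (x₀ + t • e) e v (u t) + η (x₀ + t • e) v (η (x₀ + t • e) e (u t)))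
        (Icc 0 1) t := h2.clm_apply (hu t ht)
    have h4 : HasDerivWithinAt (fun t : ℝ => t • η (x₀ + t • e) v (u t))
        (t • (fderiv ℝ η (x₀ + t • e) e v (u t) + η (x₀ + t • e) v (η (x₀ + t • e) e (u t)))
          + (1 : ℝ) • η (x₀ + t • e) v (u t)) (Icc 0 1) t :=
      (hasDerivWithinAt_id t (Icc (0 : ℝ) 1)).smul h3
    rw [one_smul] at h4
    exact ((hu' t ht).sub (hu t ht)).sub h4
  have hbound := fun t (ht : t ∈ Icc (0 : ℝ) 1) =>
    norm_deviation_deriv_le (u' := u' t) hC ht (hflat t ht) he hev (hB t ht) (bη t ht)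
    (bη' t ht) (bD t ht) ((bL t ht).trans (mul_le_mul_of_nonneg_left (hseg t ht) hC0.le)) (by
      have h1 := bR t ht
      rw [map_smul] at h1
      refine h1.trans ?_
      rw [mul_assoc, pow_two]
      have := hseg t ht
      gcongr)
  -- The deviation vanishes at t = 0, so Gronwall leaves only the inhomogeneous part, which is of
  -- order ‖v‖².
  have hgr := norm_le_gronwallBound_of_norm_deriv_right_le (δ := 0)
    (fun t ht => (hderiv t ht).continuousWithinAt)
    (fun t ht => (hderiv t ⟨ht.1, ht.2.le⟩).mono_of_mem_nhdsWithin (Icc_mem_nhdsGE_of_mem ht))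
    (by simp [h0]) (fun t ht => hbound t ⟨ht.1, ht.2.le⟩) 1 (by simp)
  rw [gronwallBound_of_K_ne_0 hC0.ne'] at hgr
  simp only [one_smul, zero_mul, zero_add, sub_zero, mul_one] at hgr
  refine hgr.trans ?_
  have h2 : 4 * C ^ 2 * B * ‖v‖ ^ 2 / C = 4 * C * B * ‖v‖ ^ 2 := by field_simp
  rw [h2]
  have : 0 ≤ 4 * C * B * ‖v‖ ^ 2 := by positivity
  linarith

/-- **Frobenius theorem for linear systems.** If `du = η u` satisfies the integrability condition
`d(η u) = 0` formally, then it has a local solution with any initial value. -/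
theorem exists_linear_frobenius_solution [CompleteSpace V] {η : E → E →L[ℝ] V →L[ℝ] V} {x₀ : E}
    (hη : ContDiffAt ℝ 2 η x₀) (hflat : ∀ᶠ x in nhds x₀, ∀ v w,
      fderiv ℝ η x v w + (η x w).comp (η x v) = fderiv ℝ η x w v + (η x v).comp (η x w))
    (u₀ : V) :
    ∃ u : E → V, u x₀ = u₀ ∧ ∀ᶠ x in nhds x₀, HasFDerivAt u ((η x).flip (u x)) x := by
  have hη1 : ContDiffAt ℝ 1 (fderiv ℝ η) x₀ := hη.fderiv_right (by norm_num)
  obtain ⟨K, s, hs, hK⟩ := hη1.exists_lipschitzOnWith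
  have h1 : ∀ᶠ x in nhds x₀, ‖η x‖ < ‖η x₀‖ + 1 :=
    hη.continuousAt.norm.eventually_lt continuousAt_const (by simp)
  have h2 : ∀ᶠ x in nhds x₀, ‖fderiv ℝ η x‖ < ‖fderiv ℝ η x₀‖ + 1 :=
    hη1.continuousAt.norm.eventually_lt continuousAt_const (by simp)
  have h3 : ∀ᶠ x in nhds x₀, ContDiffAt ℝ 2 η x := hη.eventually (by simp)
  obtain ⟨δ, hδ, hball⟩ := Metric.eventually_nhds_iff_ball.1
    (h1.and (h2.and (h3.and (hflat.and hs))))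
  -- One constant bounds η, its derivative and the Lipschitz constant of the derivative near x₀.
  set C : ℝ := ‖η x₀‖ + ‖fderiv ℝ η x₀‖ + K + 1 with hC
  have hC1 : 1 ≤ C := by
    have := norm_nonneg (η x₀); have := norm_nonneg (fderiv ℝ η x₀); have := K.2
    simp only [hC]; linarith [K.coe_nonneg]
  have hC0 : 0 < C := by linarith
  have bη : ∀ x ∈ ball x₀ δ, ‖η x‖ ≤ C := fun x hx => by
    have := (hball x hx).1; have := norm_nonneg (fderiv ℝ η x₀)
    simp only [hC]; linarith [K.coe_nonneg]
  have bD : ∀ x ∈ ball x₀ δ, ‖fderiv ℝ η x‖ ≤ C := fun x hx => by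
    have := (hball x hx).2.1; have := norm_nonneg (η x₀)
    simp only [hC]; linarith [K.coe_nonneg]
  have hd : ∀ x ∈ ball x₀ δ, HasFDerivAt η (fderiv ℝ η x) x := fun x hx =>
    ((hball x hx).2.2.1.differentiableAt (by simp)).hasFDerivAt
  have bL : ∀ x ∈ ball x₀ δ, ∀ y ∈ ball x₀ δ, ‖η y - η x‖ ≤ C * ‖y - x‖ := fun x hx y hy =>
    (convex_ball x₀ δ).norm_image_sub_le_of_norm_hasFDerivWithin_le
      (fun z hz => (hd z hz).hasFDerivWithinAt) bD hx hy
  -- Second-order Taylor estimate: the derivative of η is Lipschitz, so on the segment it differs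
  -- from its value at x by at most C‖y - x‖.
  have bT : ∀ x ∈ ball x₀ δ, ∀ y ∈ ball x₀ δ,
      ‖η y - η x - fderiv ℝ η x (y - x)‖ ≤ C * ‖y - x‖ * ‖y - x‖ := fun x hx y hy => by
    have hsub : segment ℝ x y ⊆ ball x₀ δ := (convex_ball x₀ δ).segment_subset hx hy
    refine (convex_segment x y).norm_image_sub_le_of_norm_hasFDerivWithin_le'
      (fun z hz => (hd z (hsub hz)).hasFDerivWithinAt) (fun z hz => ?_)
      (left_mem_segment ℝ x y) (right_mem_segment ℝ x y)
    have h4 := hK.norm_sub_le (hball z (hsub hz)).2.2.2.2 (hball x hx).2.2.2.2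
    have h5 : ‖z - x‖ ≤ ‖y - x‖ := by
      obtain ⟨t, ht, rfl⟩ := (segment_eq_image' ℝ x y ▸ hz :)
      simp only [add_sub_cancel_left, norm_smul, Real.norm_eq_abs, abs_of_nonneg ht.1]
      exact mul_le_of_le_one_left (norm_nonneg _) ht.2
    have h6 : (K : ℝ) ≤ C := by
      have := norm_nonneg (η x₀); have := norm_nonneg (fderiv ℝ η x₀)
      simp only [hC]; linarith
    exact h4.trans (mul_le_mul h6 h5 (norm_nonneg _) hC0.le)
  -- The radius makes the coefficient of the equation along each ray at most C · 1/(2C) = 1/2, as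
  -- the existence lemma on [0, 1] demands.
  set r : ℝ := min δ (1 / (2 * C)) with hr
  have hr0 : 0 < r := lt_min hδ (by positivity)
  have hr2 : r ≤ 1 / (2 * C) := min_le_right _ _
  have hC2 : C * (1 / (2 * C)) = 1 / 2 := by field_simp
  have hr1 : r ≤ 1 := hr2.trans (by rw [div_le_one (by positivity)]; linarith)
  have hray : ∀ x ∈ ball x₀ r, ∀ t ∈ Icc (0 : ℝ) 1, x₀ + t • (x - x₀) ∈ ball x₀ δ := by
    intro x hx t ht
    rw [mem_ball, dist_eq_norm] at hx ⊢
    rw [add_sub_cancel_left, norm_smul, Real.norm_eq_abs, abs_of_nonneg ht.1]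
    exact (mul_le_of_le_one_left (norm_nonneg _) ht.2).trans_lt (hx.trans_le (min_le_left _ _))
  have hsol : ∀ x ∈ ball x₀ r, ∃ u : ℝ → V, u 0 = u₀ ∧
      (∀ t ∈ Icc (0 : ℝ) 1, ‖u t‖ ≤ 2 * ‖u₀‖) ∧ ∀ t ∈ Icc (0 : ℝ) 1,
        HasDerivWithinAt u (η (x₀ + t • (x - x₀)) (x - x₀) (u t)) (Icc 0 1) t := by
    intro x hx
    refine exists_linear_ode_solution (fun t => η (x₀ + t • (x - x₀)) (x - x₀)) ?_ ?_ u₀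
    · refine ContinuousOn.clm_apply (fun t ht => ?_) continuousOn_const
      refine ContinuousWithinAt.comp_of_eq (hd _ (hray x hx t ht)).continuousAt.continuousWithinAt
        (t := univ) ?_ (mapsTo_univ _ _) rfl
      exact (by fun_prop : Continuous fun t : ℝ => x₀ + t • (x - x₀)).continuousWithinAt
    · intro t ht
      refine ((η _).le_opNorm _).trans ?_
      rw [mem_ball, dist_eq_norm] at hx
      calc _ ≤ C * (1 / (2 * C)) := mul_le_mul (bη _ (hray x (by simpa [dist_eq_norm]) t ht))
            (hx.le.trans hr2) (norm_nonneg _) hC0.le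
        _ = 1 / 2 := hC2
  choose! U hU0 hUb hU using hsol
  -- The candidate solution takes at x the time-one value on the ray to x. This quadratic estimate
  -- is its differentiability with the prescribed derivative, so no theorem on dependence of
  -- solutions on parameters is needed.
  have key : ∀ x ∈ ball x₀ r, ∀ y ∈ ball x₀ r, ‖U y 1 - U x 1 - η x (y - x) (U x 1)‖ ≤
      8 * C * ‖u₀‖ * Real.exp C * ‖y - x‖ ^ 2 := by
    intro x hx y hy
    set e := x - x₀ with he
    set v := y - x with hv
    have hyv : y - x₀ = e + v := by simp [he, hv]
    have he1 : ‖e‖ ≤ 1 := by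
      rw [mem_ball, dist_eq_norm] at hx; exact hx.le.trans hr1
    have hev1 : ‖e + v‖ ≤ 1 := by
      rw [mem_ball, dist_eq_norm, hyv] at hy; exact hy.le.trans hr1
    have hseg : ∀ t : ℝ, x₀ + t • (e + v) - (x₀ + t • e) = t • v := fun t => by
      rw [smul_add]; abel
    have hy' := hray y hy
    have hUy := hU y hy
    rw [hyv] at hy' hUy
    have h7 := norm_radial_solution_sub_le hC1 he1 hev1 (fun t ht => hd _ (hray x hx t ht))
      (fun t ht => (hball _ (hray x hx t ht)).2.2.2.1 e v) (fun t ht => bη _ (hray x hx t ht))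
      (fun t ht => bη _ (hy' t ht)) (fun t ht => bD _ (hray x hx t ht))
      (fun t ht => hseg t ▸ bL _ (hray x hx t ht) _ (hy' t ht))
      (fun t ht => hseg t ▸ bT _ (hray x hx t ht) _ (hy' t ht)) (hUb x hx)
      ((hU0 y hy).trans (hU0 x hx).symm) (hU x hx) hUy
    rw [show x₀ + e = x by simp [he]] at h7
    refine h7.trans (le_of_eq (by ring))
  -- The ray to x₀ is constant, so the equation along it has zero right-hand side.
  have hx₀ : U x₀ 1 = u₀ := by
    have h0 : x₀ ∈ ball x₀ r := mem_ball_self hr0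
    rw [← hU0 x₀ h0]
    refine (constant_of_has_deriv_right_zero (fun t ht => (hU x₀ h0 t ht).continuousWithinAt)
      (fun t ht => ?_) 1 (by simp))
    simpa using (hU x₀ h0 t ⟨ht.1, ht.2.le⟩).mono_of_mem_nhdsWithin (Icc_mem_nhdsGE_of_mem ht)
  refine ⟨fun x => U x 1, hx₀, ?_⟩
  filter_upwards [ball_mem_nhds x₀ hr0] with x hx
  rw [hasFDerivAt_iff_isLittleO]
  have hO : (fun y => U y 1 - U x 1 - (η x).flip (U x 1) (y - x)) =O[nhds x]
      fun y => ‖y - x‖ ^ 2 := by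
    refine Asymptotics.IsBigO.of_bound (8 * C * ‖u₀‖ * Real.exp C) ?_
    filter_upwards [isOpen_ball.mem_nhds hx] with y hy
    simpa using key x hx y hy
  refine hO.trans_isLittleO ?_
  have : Filter.Tendsto (fun y => y - x) (nhds x) (nhds 0) := by
    exact (continuous_id.sub continuous_const).tendsto' x _ (sub_self x)
  exact ((Asymptotics.isLittleO_norm_pow_id one_lt_two).comp_tendsto this)

end LinearFrobenius

/-! ### One-forms in charts -/

section Charts

variable {E : Type*} [NormedAddCommGroup E] [NormedSpace ℝ E]
  {M : Type*} [TopologicalSpace M] [ChartedSpace E M]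

theorem extDeriv_ofSubsingleton_apply {α : E → E →L[ℝ] ℝ} {x : E} (hα : DifferentiableAt ℝ α x)
    (v w : E) :
    extDeriv (fun y => ContinuousAlternatingMap.ofSubsingleton ℝ E ℝ (0 : Fin 1) (α y)) x ![v, w]
      = fderiv ℝ α x v w - fderiv ℝ α x w v := by
  have h : DifferentiableAt ℝ
      (fun y => ContinuousAlternatingMap.ofSubsingleton ℝ E ℝ (0 : Fin 1) (α y)) x :=
    (ContinuousAlternatingMap.ofSubsingletonLIE (𝕜 := ℝ) (E := E) (F := ℝ)
      (0 : Fin 1)).differentiable.differentiableAt.comp x hα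
  rw [extDeriv_apply h]
  have h2 : ∀ u : E, fderiv ℝ (fun y => α y u) x = (fderiv ℝ α x).flip u := fun u => by
    ext z
    rw [fderiv_clm_apply hα (differentiableAt_const _)]; simp
  simp [Fin.sum_univ_two, Fin.removeNth, h2, sub_eq_add_neg]

/-- Naturality of d under a transition map τ: the second derivatives of τ drop out by symmetry. This
makes the exterior derivative independent of the chart. -/
theorem extDeriv_ofSubsingleton_pullback {α : E → E →L[ℝ] ℝ} {τ : E → E} {x : E}
    (hα : DifferentiableAt ℝ α (τ x)) (hτ : ContDiffAt ℝ 2 τ x) (v w : E) :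
    extDeriv (fun y => ContinuousAlternatingMap.ofSubsingleton ℝ E ℝ (0 : Fin 1)
        ((α (τ y)).comp (fderiv ℝ τ y))) x ![v, w] =
      fderiv ℝ α (τ x) (fderiv ℝ τ x v) (fderiv ℝ τ x w)
        - fderiv ℝ α (τ x) (fderiv ℝ τ x w) (fderiv ℝ τ x v) := by
  have h : DifferentiableAt ℝ
      (fun y => ContinuousAlternatingMap.ofSubsingleton ℝ E ℝ (0 : Fin 1) (α y)) (τ x) :=
    (ContinuousAlternatingMap.ofSubsingletonLIE (𝕜 := ℝ) (E := E) (F := ℝ)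
      (0 : Fin 1)).differentiable.differentiableAt.comp (τ x) hα
  have := extDeriv_pullback h hτ (by simp)
  rw [← extDeriv_ofSubsingleton_apply hα]
  have h2 := congrArg (fun β : E [⋀^Fin 2]→L[ℝ] ℝ => β ![v, w]) this
  refine h2.trans ?_
  rw [ContinuousAlternatingMap.compContinuousLinearMap_apply]
  congr 1
  ext i; fin_cases i <;> rfl

variable [IsManifold 𝓘(ℝ, E) ∞ M]

theorem mfderiv_symm_mfderiv_chart {φ : OpenPartialHomeomorph M E} (hφ : φ ∈ atlas E M) {p : M}
    (hp : p ∈ φ.source) (v : TangentSpace 𝓘(ℝ, E) p) :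
    mfderiv 𝓘(ℝ, E) 𝓘(ℝ, E) φ.symm (φ p) (mfderiv 𝓘(ℝ, E) 𝓘(ℝ, E) φ p v) = v := by
  have := (mdifferentiable_of_mem_atlas (I := 𝓘(ℝ, E)) (hφ)).symm_comp_deriv hp
  exact DFunLike.congr_fun this v

theorem mfderiv_chart_mfderiv_symm {φ : OpenPartialHomeomorph M E} (hφ : φ ∈ atlas E M) {y : E}
    (hy : y ∈ φ.target) (v : E) :
    mfderiv 𝓘(ℝ, E) 𝓘(ℝ, E) φ (φ.symm y) (mfderiv 𝓘(ℝ, E) 𝓘(ℝ, E) φ.symm y v) = v := by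
  have := (mdifferentiable_of_mem_atlas (I := 𝓘(ℝ, E)) (hφ)).comp_symm_deriv hy
  exact DFunLike.congr_fun this v

omit [IsManifold 𝓘(ℝ, E) ∞ M] in
theorem OneForm.apply_congr (η : OneForm E M) {p q : M} (h : p = q) :
    (show E →L[ℝ] ℝ from η p) = (show E →L[ℝ] ℝ from η q) := by
  subst h; rfl

theorem OneForm.inChart_mfderiv (η : OneForm E M) {φ : OpenPartialHomeomorph M E}
    (hφ : φ ∈ atlas E M) {p : M} (hp : p ∈ φ.source) (v : TangentSpace 𝓘(ℝ, E) p) :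
    η.inChart φ (φ p) (mfderiv 𝓘(ℝ, E) 𝓘(ℝ, E) φ p v) = η p v := by
  have h1 := mfderiv_symm_mfderiv_chart hφ hp v
  have h2 := η.apply_congr (φ.left_inv hp)
  change (show E →L[ℝ] ℝ from η (φ.symm (φ p))) _ = _
  rw [h2]
  exact congrArg (η p) h1

/-- The exterior derivative of a smooth one-form can be computed in any chart. -/
theorem OneForm.d_eq_inChart {η : OneForm E M} (hη : η.Smooth) {φ : OpenPartialHomeomorph M E}
    (hφ : φ ∈ atlas E M) {p : M} (hp : p ∈ φ.source) (v w : TangentSpace 𝓘(ℝ, E) p) :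
    η.d p v w = fderiv ℝ (η.inChart φ) (φ p) (mfderiv 𝓘(ℝ, E) 𝓘(ℝ, E) φ p v)
        (mfderiv 𝓘(ℝ, E) 𝓘(ℝ, E) φ p w)
      - fderiv ℝ (η.inChart φ) (φ p) (mfderiv 𝓘(ℝ, E) 𝓘(ℝ, E) φ p w)
        (mfderiv 𝓘(ℝ, E) 𝓘(ℝ, E) φ p v) := by
  set ψ := chartAt E p with hψ
  have hψa : ψ ∈ atlas E M := chart_mem_atlas E p
  have hpψ : p ∈ ψ.source := mem_chart_source E p
  set τ : E → E := φ ∘ ψ.symm with hτ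
  have hτp : τ (ψ p) = φ p := by simp [hτ, ψ.left_inv hpψ]
  have hnhds : ∀ᶠ y in nhds (ψ p), y ∈ ψ.target ∧ ψ.symm y ∈ φ.source := by
    have h1 : ψ.target ∈ nhds (ψ p) := ψ.open_target.mem_nhds (ψ.map_source hpψ)
    refine Filter.eventually_and.2 ⟨h1, ?_⟩
    apply (ψ.continuousAt_symm (ψ.map_source hpψ)).eventually
    rw [ψ.left_inv hpψ]
    exact φ.open_source.mem_nhds hp
  have hτs : ContDiffAt ℝ ∞ τ (ψ p) := by
    have h1 : ContMDiffAt 𝓘(ℝ, E) 𝓘(ℝ, E) ∞ ψ.symm (ψ p) :=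
      contMDiffAt_symm_of_mem_maximalAtlas (IsManifold.subset_maximalAtlas hψa)
        (ψ.map_source hpψ)
    have h2 : ContMDiffAt 𝓘(ℝ, E) 𝓘(ℝ, E) ∞ φ p :=
      contMDiffAt_of_mem_maximalAtlas (IsManifold.subset_maximalAtlas hφ) hp
    exact (h2.comp_of_eq h1 (ψ.left_inv hpψ)).contDiffAt
  have hder : ∀ y, y ∈ ψ.target → ψ.symm y ∈ φ.source → ∀ u : E, fderiv ℝ τ y u =
      mfderiv 𝓘(ℝ, E) 𝓘(ℝ, E) φ (ψ.symm y) (mfderiv 𝓘(ℝ, E) 𝓘(ℝ, E) ψ.symm y u) := by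
    intro y hy hy' u
    rw [← mfderiv_eq_fderiv, hτ, mfderiv_comp y (mdifferentiableAt_atlas hφ hy')
      (mdifferentiableAt_atlas_symm hψa hy)]
    rfl
  -- By the chain rule, the expression of η in the preferred chart is the pullback by the transition
  -- map of its expression in the chart φ.
  have hpull : η.inChart ψ =ᶠ[nhds (ψ p)] fun y => (η.inChart φ (τ y)).comp (fderiv ℝ τ y) := by
    filter_upwards [hnhds] with y hy
    ext u
    have h1 := η.inChart_mfderiv hφ hy.2 (mfderiv 𝓘(ℝ, E) 𝓘(ℝ, E) ψ.symm y u)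
    rw [← hder y hy.1 hy.2 u] at h1
    exact h1.symm
  have hm : ∀ v, mfderiv 𝓘(ℝ, E) 𝓘(ℝ, E) φ p v =
      fderiv ℝ τ (ψ p) (mfderiv 𝓘(ℝ, E) 𝓘(ℝ, E) ψ p v) := by
    intro v
    have h1 : φ =ᶠ[nhds p] τ ∘ ψ := by
      filter_upwards [ψ.open_source.mem_nhds hpψ] with q hq
      simp [hτ, ψ.left_inv hq]
    rw [h1.mfderiv_eq, mfderiv_comp p
      (hτs.differentiableAt (by simp)).mdifferentiableAt (mdifferentiableAt_atlas hψa hpψ),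
      mfderiv_eq_fderiv]
    rfl
  have hdiff : DifferentiableAt ℝ (η.inChart φ) (τ (ψ p)) := by
    rw [hτp]
    exact ((hη φ hφ).contDiffAt (φ.open_target.mem_nhds (φ.map_source hp))).differentiableAt
      (by simp)
  have h3 := extDeriv_ofSubsingleton_pullback hdiff (hτs.of_le (by norm_cast))
    (mfderiv 𝓘(ℝ, E) 𝓘(ℝ, E) ψ p v) (mfderiv 𝓘(ℝ, E) 𝓘(ℝ, E) ψ p w)
  rw [hτp] at h3
  rw [hm, hm]
  refine Eq.trans ?_ h3
  have h4 : (fun y : E => ContinuousAlternatingMap.ofSubsingleton ℝ E ℝ (0 : Fin 1)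
      (η.inChart ψ y)) =ᶠ[nhds (ψ p)] fun y =>
      ContinuousAlternatingMap.ofSubsingleton ℝ E ℝ (0 : Fin 1)
        ((η.inChart φ (τ y)).comp (fderiv ℝ τ y)) := by
    filter_upwards [hpull] with y hy
    rw [hy]
  exact congrArg (fun β : E [⋀^Fin 2]→L[ℝ] ℝ => β ![mfderiv 𝓘(ℝ, E) 𝓘(ℝ, E) ψ p v,
    mfderiv 𝓘(ℝ, E) 𝓘(ℝ, E) ψ p w]) h4.extDeriv_eq

omit [IsManifold 𝓘(ℝ, E) ∞ M] in
/-- The exterior derivative of a one-form depends only on its germ. -/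
theorem OneForm.d_congr {η η' : OneForm E M} {U : Set M} (hU : IsOpen U)
    (h : ∀ p ∈ U, η p = η' p) {p : M} (hp : p ∈ U) : η.d p = η'.d p := by
  funext v w
  have h4 : (fun y : E => ContinuousAlternatingMap.ofSubsingleton ℝ E ℝ (0 : Fin 1)
      (η.inChart (chartAt E p) y)) =ᶠ[nhds (chartAt E p p)] fun y =>
      ContinuousAlternatingMap.ofSubsingleton ℝ E ℝ (0 : Fin 1) (η'.inChart (chartAt E p) y) := by
    have h1 := (chartAt E p).continuousAt_symm ((chartAt E p).map_source (mem_chart_source E p))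
    have h2 : U ∈ nhds ((chartAt E p).symm (chartAt E p p)) := by
      rw [(chartAt E p).left_inv (mem_chart_source E p)]
      exact hU.mem_nhds hp
    filter_upwards [h1.eventually h2] with y hy
    simp only [OneForm.inChart, h _ hy]
  exact congrArg (fun β : E [⋀^Fin 2]→L[ℝ] ℝ => β ![mfderiv 𝓘(ℝ, E) 𝓘(ℝ, E) (chartAt E p) p v,
    mfderiv 𝓘(ℝ, E) 𝓘(ℝ, E) (chartAt E p) p w]) h4.extDeriv_eq

/-- The differential of a function which factors through a chart. -/
theorem hasMFDerivAt_comp_chart {F : Type*} [NormedAddCommGroup F] [NormedSpace ℝ F]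
    {φ : OpenPartialHomeomorph M E} (hφ : φ ∈ atlas E M) {p : M} (hp : p ∈ φ.source)
    {f : E → F} {f' : E →L[ℝ] F} (hf : HasFDerivAt f f' (φ p)) :
    HasMFDerivAt 𝓘(ℝ, E) 𝓘(ℝ, F) (f ∘ φ) p (f'.comp (mfderiv 𝓘(ℝ, E) 𝓘(ℝ, E) φ p)) :=
  hf.hasMFDerivAt.comp p (mdifferentiableAt_atlas hφ hp).hasMFDerivAt

theorem mfderiv_comp_chart {F : Type*} [NormedAddCommGroup F] [NormedSpace ℝ F]
    {φ : OpenPartialHomeomorph M E} (hφ : φ ∈ atlas E M) {p : M} (hp : p ∈ φ.source)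
    {f : E → F} {f' : E →L[ℝ] F} (hf : HasFDerivAt f f' (φ p)) (v : TangentSpace 𝓘(ℝ, E) p) :
    mfderiv 𝓘(ℝ, E) 𝓘(ℝ, F) (f ∘ φ) p v = f' (mfderiv 𝓘(ℝ, E) 𝓘(ℝ, E) φ p v) :=
  DFunLike.congr_fun (hasMFDerivAt_comp_chart hφ hp hf).mfderiv v

theorem mvfderiv_comp_chart {F : Type*} [NormedAddCommGroup F] [NormedSpace ℝ F]
    {φ : OpenPartialHomeomorph M E} (hφ : φ ∈ atlas E M) {p : M} (hp : p ∈ φ.source)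
    {f : E → F} {f' : E →L[ℝ] F} (hf : HasFDerivAt f f' (φ p)) (v : TangentSpace 𝓘(ℝ, E) p) :
    mvfderiv 𝓘(ℝ, E) (f ∘ φ) p v = f' (mfderiv 𝓘(ℝ, E) 𝓘(ℝ, E) φ p v) :=
  mfderiv_comp_chart hφ hp hf v

theorem contMDiffOn_comp_chart {F : Type*} [NormedAddCommGroup F] [NormedSpace ℝ F]
    {φ : OpenPartialHomeomorph M E} (hφ : φ ∈ atlas E M) {U : Set E} {f : E → F}
    (hf : ContDiffOn ℝ ∞ f U) :
    ContMDiffOn 𝓘(ℝ, E) 𝓘(ℝ, F) ∞ (f ∘ φ) (φ.source ∩ φ ⁻¹' U) :=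
  hf.contMDiffOn.comp ((contMDiffOn_of_mem_maximalAtlas
    (IsManifold.subset_maximalAtlas hφ)).mono Set.inter_subset_left) Set.inter_subset_right

end Charts

/-! ### One-forms on the model space -/

section ModelSpace

variable {E : Type*} [NormedAddCommGroup E] [NormedSpace ℝ E]

theorem mfderiv_refl_apply (p v : E) :
    mfderiv 𝓘(ℝ, E) 𝓘(ℝ, E) (OpenPartialHomeomorph.refl E) p v = v :=
  DFunLike.congr_fun (mfderiv_id (I := 𝓘(ℝ, E)) (x := p)) v

theorem OneForm.inChart_refl (η : OneForm E E) :
    η.inChart (OpenPartialHomeomorph.refl E) = (show E → E →L[ℝ] ℝ from η) := by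
  funext y
  ext v
  exact congrArg (η y) (mfderiv_refl_apply y v)

theorem OneForm.smooth_of_contDiff {η : OneForm E E}
    (hη : ContDiff ℝ ∞ (show E → E →L[ℝ] ℝ from η)) : η.Smooth := by
  intro φ hφ
  rw [chartedSpaceSelf_atlas] at hφ
  subst hφ
  rw [OneForm.inChart_refl]
  exact hη.contDiffOn

theorem OneForm.d_modelSpace {η : OneForm E E}
    (hη : ContDiff ℝ ∞ (show E → E →L[ℝ] ℝ from η)) (p v w : E) :
    η.d p v w = fderiv ℝ (show E → E →L[ℝ] ℝ from η) p v w
      - fderiv ℝ (show E → E →L[ℝ] ℝ from η) p w v := by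
  have := OneForm.d_eq_inChart (OneForm.smooth_of_contDiff hη) (φ := OpenPartialHomeomorph.refl E)
    (by simp) (p := p) (by simp) v w
  rw [OneForm.inChart_refl] at this
  exact this.trans (by
    erw [mfderiv_refl_apply, mfderiv_refl_apply]
    rfl)

end ModelSpace

/-! ### Linear systems in coordinates -/

section MatrixFrobenius

variable {E : Type*} [NormedAddCommGroup E] [NormedSpace ℝ E] {n : ℕ}

/-- The elementary endomorphism `u ↦ u i • e j` of `ℝⁿ`. -/
def elementaryCLM (i j : Fin n) : (Fin n → ℝ) →L[ℝ] (Fin n → ℝ) :=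
  (ContinuousLinearMap.proj (R := ℝ) (φ := fun _ : Fin n => ℝ) i).smulRight (Pi.single j 1)

/-- A matrix of covectors as a covector with values in the endomorphisms of `ℝⁿ`. -/
def matrixCovector (m : Fin n → Fin n → E →L[ℝ] ℝ) :
    E →L[ℝ] (Fin n → ℝ) →L[ℝ] (Fin n → ℝ) :=
  ∑ i, ∑ j, (ContinuousLinearMap.smulRightL ℝ E _).flip (elementaryCLM i j) (m i j)

theorem matrixCovector_apply (m : Fin n → Fin n → E →L[ℝ] ℝ) (v : E) (u : Fin n → ℝ) (k : Fin n) :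
    matrixCovector m v u k = ∑ i, m i k v * u i := by
  simp [matrixCovector, elementaryCLM, Pi.single_apply, Finset.sum_apply]

/-- The integrability condition is dm + m∧m = 0. The unknown is a row vector multiplied by m on the
right, so composition of the associated endomorphisms reverses the order of the matrix product. -/
theorem exists_matrix_frobenius_solution {m : Fin n → Fin n → E → E →L[ℝ] ℝ} {x₀ : E}
    (hm : ∀ i j, ContDiffAt ℝ ∞ (m i j) x₀)
    (hflat : ∀ᶠ x in nhds x₀, ∀ v w i j,
      fderiv ℝ (m i j) x v w - fderiv ℝ (m i j) x w v =
        ∑ k, (m i k x w * m k j x v - m i k x v * m k j x w))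
    (u₀ : Fin n → ℝ) :
    ∃ u : Fin n → E → ℝ, (∀ j, u j x₀ = u₀ j) ∧
      ∀ᶠ x in nhds x₀, ∀ j, HasFDerivAt (u j) (∑ i, u i x • m i j x) x := by
  have hsmooth : ContDiffAt ℝ 2 (fun x => matrixCovector fun i j => m i j x) x₀ := by
    refine ContDiffAt.sum fun i _ => ContDiffAt.sum fun j _ => ?_
    exact (ContinuousLinearMap.contDiff _).contDiffAt.comp x₀ ((hm i j).of_le (by norm_cast))
  have hdiff : ∀ᶠ x in nhds x₀, ∀ i j, DifferentiableAt ℝ (m i j) x := by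
    simp only [Filter.eventually_all]
    intro i j
    filter_upwards [((hm i j).of_le (m := 1) (by norm_cast)).eventually (by simp)] with x hx
    exact hx.differentiableAt (by simp)
  have hflat' : ∀ᶠ x in nhds x₀, ∀ v w,
      fderiv ℝ (fun x => matrixCovector fun i j => m i j x) x v w +
        (matrixCovector (fun i j => m i j x) w).comp (matrixCovector (fun i j => m i j x) v) =
      fderiv ℝ (fun x => matrixCovector fun i j => m i j x) x w v +
        (matrixCovector (fun i j => m i j x) v).comp (matrixCovector (fun i j => m i j x) w) := by
    filter_upwards [hflat, hdiff] with x hx hdx v w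
    have hD : ∀ v, fderiv ℝ (fun x => matrixCovector fun i j => m i j x) x v =
        matrixCovector fun i j => fderiv ℝ (m i j) x v := by
      intro v
      have : HasFDerivAt (fun x => matrixCovector fun i j => m i j x)
          (∑ i, ∑ j, ((ContinuousLinearMap.smulRightL ℝ E _).flip (elementaryCLM i j)).comp
            (fderiv ℝ (m i j) x)) x :=
        HasFDerivAt.fun_sum fun i _ => HasFDerivAt.fun_sum fun j _ =>
          (ContinuousLinearMap.hasFDerivAt _).comp x (hdx i j).hasFDerivAt
      rw [this.fderiv]
      simp [matrixCovector]
    rw [hD, hD]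
    ext u k
    simp only [add_apply, ContinuousLinearMap.comp_apply, Pi.add_apply,
      matrixCovector_apply]
    have h1 : ∀ v w, ∑ i, m i k x w * ∑ l, m l i x v * u l =
        ∑ l, (∑ i, m l i x v * m i k x w) * u l := fun v w => by
      simp only [Finset.mul_sum, Finset.sum_mul]
      rw [Finset.sum_comm]
      exact Finset.sum_congr rfl fun _ _ => Finset.sum_congr rfl fun _ _ => by ring
    rw [h1, h1, ← Finset.sum_add_distrib, ← Finset.sum_add_distrib]
    refine Finset.sum_congr rfl fun i _ => ?_
    have h2 := hx v w i k
    rw [Finset.sum_sub_distrib] at h2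
    rw [← add_mul, ← add_mul]
    congr 1
    linarith
  obtain ⟨u, hu0, hu⟩ := exists_linear_frobenius_solution hsmooth hflat' u₀
  refine ⟨fun j x => u x j, fun j => congrFun hu0 j, ?_⟩
  filter_upwards [hu] with x hx j
  have h3 := (hasFDerivAt_pi'.1 hx) j
  refine h3.congr_fderiv ?_
  ext v
  simp [matrixCovector_apply, mul_comm]

/-- Bootstrapping: if u is of class Cᴺ, so is its derivative Σ uᵢ mᵢⱼ, hence u is of class Cᴺ⁺¹. -/
theorem contDiffOn_of_linear_system {m : Fin n → Fin n → E → E →L[ℝ] ℝ} {u : Fin n → E → ℝ}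
    {O : Set E} (hO : IsOpen O) (hm : ∀ i j, ContDiffOn ℝ ∞ (m i j) O)
    (hu : ∀ x ∈ O, ∀ j, HasFDerivAt (u j) (∑ i, u i x • m i j x) x) (j : Fin n) :
    ContDiffOn ℝ ∞ (u j) O := by
  have key : ∀ N : ℕ, ∀ j, ContDiffOn ℝ N (u j) O := by
    intro N
    induction N with
    | zero =>
      intro j
      exact contDiffOn_zero.2 fun x hx => (hu x hx j).continuousAt.continuousWithinAt
    | succ N ih =>
      intro j
      push_cast
      rw [contDiffOn_succ_iff_fderiv_of_isOpen hO]
      refine ⟨fun x hx => (hu x hx j).differentiableAt.differentiableWithinAt, by simp, ?_⟩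
      refine ContDiffOn.congr (f := fun x => ∑ i, u i x • m i j x) ?_
        fun x hx => (hu x hx j).fderiv
      exact ContDiffOn.sum fun i _ => (ih i).smul ((hm i j).of_le (by norm_cast; exact le_top))
  exact contDiffOn_infty.2 fun N => key N j

end MatrixFrobenius

/-! ### The flat structure equations in a chart -/

section FlatFrame

variable {E : Type*} [NormedAddCommGroup E] [NormedSpace ℝ E]

/-- The value at `y` of the exterior derivative of a one-form on a vector space. -/
def extd (α : E → E →L[ℝ] ℝ) (y v w : E) : ℝ := fderiv ℝ α y v w - fderiv ℝ α y w v

/-- The wedge product of two covectors. -/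
def wedgeCov (α β : E →L[ℝ] ℝ) (v w : E) : ℝ := α v * β w - α w * β v

/-- The flat structure equations at a point of a vector space. -/
structure FlatSystemAt (θ : Fin 4 → E → E →L[ℝ] ℝ) (Ω : Fin 6 → E → E →L[ℝ] ℝ)
    (A : E → E →L[ℝ] ℝ) (y v w : E) : Prop where
  dθ1 : extd (θ 0) y v w = wedgeCov (Ω 0 y - (1 / 2 : ℝ) • A y) (θ 0 y) v w
    - wedgeCov (Ω 2 y) (θ 2 y) v w - wedgeCov (Ω 4 y) (θ 3 y) v w
  dθ2 : extd (θ 1) y v w = wedgeCov (-Ω 0 y - (1 / 2 : ℝ) • A y) (θ 1 y) v w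
    - wedgeCov (Ω 1 y) (θ 2 y) v w - wedgeCov (Ω 3 y) (θ 3 y) v w
  dθ3 : extd (θ 2) y v w = wedgeCov (Ω 3 y) (θ 0 y) v w + wedgeCov (Ω 4 y) (θ 1 y) v w
    + wedgeCov (Ω 5 y - (1 / 2 : ℝ) • A y) (θ 2 y) v w
  dθ4 : extd (θ 3) y v w = wedgeCov (Ω 1 y) (θ 0 y) v w + wedgeCov (Ω 2 y) (θ 1 y) v w
    + wedgeCov (-Ω 5 y - (1 / 2 : ℝ) • A y) (θ 3 y) v w
  dΩ1 : extd (Ω 0) y v w = wedgeCov (Ω 1 y) (Ω 4 y) v w - wedgeCov (Ω 2 y) (Ω 3 y) v w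
  dΩ2 : extd (Ω 1) y v w = wedgeCov (Ω 1 y) (Ω 0 y + Ω 5 y) v w
  dΩ3 : extd (Ω 2) y v w = wedgeCov (Ω 0 y - Ω 5 y) (Ω 2 y) v w
  dΩ4 : extd (Ω 3) y v w = wedgeCov (Ω 3 y) (Ω 0 y - Ω 5 y) v w
  dΩ5 : extd (Ω 4) y v w = wedgeCov (Ω 0 y + Ω 5 y) (Ω 4 y) v w
  dΩ6 : extd (Ω 5) y v w = wedgeCov (Ω 1 y) (Ω 4 y) v w + wedgeCov (Ω 2 y) (Ω 3 y) v w
  dA : extd A y v w = 0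

/-- The matrix `(Γ θ; 0 0)` of one-forms. -/
def affineConnection (θ : Fin 4 → E → E →L[ℝ] ℝ) (Ω : Fin 6 → E → E →L[ℝ] ℝ)
    (A : E → E →L[ℝ] ℝ) : Fin 5 → Fin 5 → E → E →L[ℝ] ℝ :=
  ![![-Ω 0 + (1 / 2 : ℝ) • A, 0, Ω 2, Ω 4, θ 0],
    ![0, Ω 0 + (1 / 2 : ℝ) • A, Ω 1, Ω 3, θ 1],
    ![-Ω 3, -Ω 4, -Ω 5 + (1 / 2 : ℝ) • A, 0, θ 2],
    ![-Ω 1, -Ω 2, 0, Ω 5 + (1 / 2 : ℝ) • A, θ 3],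
    ![0, 0, 0, 0, 0]]

variable {θ : Fin 4 → E → E →L[ℝ] ℝ} {Ω : Fin 6 → E → E →L[ℝ] ℝ} {A : E → E →L[ℝ] ℝ}

theorem affineConnection_contDiffOn {O : Set E} (hθ : ∀ i, ContDiffOn ℝ ∞ (θ i) O)
    (hΩ : ∀ i, ContDiffOn ℝ ∞ (Ω i) O) (hA : ContDiffOn ℝ ∞ A O) (i j : Fin 5) :
    ContDiffOn ℝ ∞ (affineConnection θ Ω A i j) O := by
  have hA' : ContDiffOn ℝ ∞ ((1 / 2 : ℝ) • A) O := hA.const_smul (1 / 2 : ℝ)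
  have h0 : ContDiffOn ℝ ∞ (0 : E → E →L[ℝ] ℝ) O := contDiffOn_const
  fin_cases i <;> fin_cases j <;>
    first
    | exact h0 | exact hθ _ | exact hΩ _ | exact (hΩ _).neg | exact (hΩ _).add hA'
    | exact (hΩ _).neg.add hA'

theorem affineConnection_hasFDerivAt {y : E} (hθ : ∀ i, DifferentiableAt ℝ (θ i) y)
    (hΩ : ∀ i, DifferentiableAt ℝ (Ω i) y) (hA : DifferentiableAt ℝ A y) (i j : Fin 5) :
    HasFDerivAt (affineConnection θ Ω A i j)
      ((![![-fderiv ℝ (Ω 0) y + (1 / 2 : ℝ) • fderiv ℝ A y, 0, fderiv ℝ (Ω 2) y,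
            fderiv ℝ (Ω 4) y, fderiv ℝ (θ 0) y],
          ![0, fderiv ℝ (Ω 0) y + (1 / 2 : ℝ) • fderiv ℝ A y, fderiv ℝ (Ω 1) y,
            fderiv ℝ (Ω 3) y, fderiv ℝ (θ 1) y],
          ![-fderiv ℝ (Ω 3) y, -fderiv ℝ (Ω 4) y,
            -fderiv ℝ (Ω 5) y + (1 / 2 : ℝ) • fderiv ℝ A y, 0, fderiv ℝ (θ 2) y],
          ![-fderiv ℝ (Ω 1) y, -fderiv ℝ (Ω 2) y, 0,
            fderiv ℝ (Ω 5) y + (1 / 2 : ℝ) • fderiv ℝ A y, fderiv ℝ (θ 3) y],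
          ![0, 0, 0, 0, 0]] : Fin 5 → Fin 5 → E →L[ℝ] E →L[ℝ] ℝ) i j) y := by
  have hA' : HasFDerivAt ((1 / 2 : ℝ) • A) ((1 / 2 : ℝ) • fderiv ℝ A y) y :=
    HasFDerivAt.const_smul hA.hasFDerivAt (1 / 2 : ℝ)
  have h0 : HasFDerivAt (0 : E → E →L[ℝ] ℝ) 0 y :=
    hasFDerivAt_const (𝕜 := ℝ) (0 : E →L[ℝ] ℝ) y
  have hΩ' := fun i => (hΩ i).hasFDerivAt
  fin_cases i <;> fin_cases j <;>
    first
    | exact h0 | exact (hθ _).hasFDerivAt | exact hΩ' _ | exact (hΩ' _).neg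
    | exact (hΩ' _).add hA' | exact (hΩ' _).neg.add hA'

/-- The entries in the last column are the torsion equations for θ, and the 4×4 block is the
vanishing of the curvature of Γ. The two diagonal blocks combine the equations for `Ω 0` or `Ω 5`
with half of dA = 0. -/
theorem affineConnection_flat {y : E} (hθ : ∀ i, DifferentiableAt ℝ (θ i) y)
    (hΩ : ∀ i, DifferentiableAt ℝ (Ω i) y) (hA : DifferentiableAt ℝ A y) {v w : E}
    (h : FlatSystemAt θ Ω A y v w) (i j : Fin 5) :
    fderiv ℝ (affineConnection θ Ω A i j) y v w - fderiv ℝ (affineConnection θ Ω A i j) y w v =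
      ∑ k, (affineConnection θ Ω A i k y w * affineConnection θ Ω A k j y v
        - affineConnection θ Ω A i k y v * affineConnection θ Ω A k j y w) := by
  rw [(affineConnection_hasFDerivAt hθ hΩ hA i j).fderiv]
  obtain ⟨h1, h2, h3, h4, h5, h6, h7, h8, h9, h10, h11⟩ := h
  simp only [extd, wedgeCov, add_apply, sub_apply,
    neg_apply, smul_apply, smul_eq_mul]
    at h1 h2 h3 h4 h5 h6 h7 h8 h9 h10 h11
  fin_cases i <;> fin_cases j <;>
    simp only [affineConnection, Fin.sum_univ_five, Fin.zero_eta, Fin.mk_one, Fin.reduceFinMk,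
      Matrix.cons_val, Pi.add_apply, Pi.neg_apply, Pi.smul_apply, Pi.zero_apply, add_apply,
      neg_apply, smul_apply, zero_apply, smul_eq_mul]
  · linear_combination -h5 + h11 / 2
  · ring
  · linear_combination h7
  · linear_combination h9
  · linear_combination h1
  · ring
  · linear_combination h5 + h11 / 2
  · linear_combination h6
  · linear_combination h8
  · linear_combination h2
  · linear_combination -h8
  · linear_combination -h9
  · linear_combination -h10 + h11 / 2
  · ring
  · linear_combination h3
  · linear_combination -h6
  · linear_combination -h7
  · ring
  · linear_combination h10 + h11 / 2
  · linear_combination h4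
  all_goals ring

end FlatFrame

/-! ### Integration of the flat structure equations -/

section Integration

variable {E : Type*} [NormedAddCommGroup E] [NormedSpace ℝ E]

/-- The product of the rows `i` and `j` of a matrix with respect to the split metric. -/
def rowProduct (H : Fin 4 → Fin 4 → E → ℝ) (i j : Fin 4) (y : E) : ℝ :=
  H i 0 y * H j 1 y + H i 1 y * H j 0 y + H i 2 y * H j 3 y + H i 3 y * H j 2 y

/-- `H` and `X` integrate the flat structure equations on `U`: `dH = H Γ` and `dX = H θ`, and `H`
takes values in `CO(2,2)`. -/
structure FlatIntegral (U : Set E) (θ : Fin 4 → E → E →L[ℝ] ℝ) (Ω : Fin 6 → E → E →L[ℝ] ℝ)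
    (A : E → E →L[ℝ] ℝ) (H : Fin 4 → Fin 4 → E → ℝ) (X : Fin 4 → E → ℝ) : Prop where
  isOpen : IsOpen U
  smooth_H : ∀ i j, ContDiffOn ℝ ∞ (H i j) U
  smooth_X : ∀ i, ContDiffOn ℝ ∞ (X i) U
  dH0 : ∀ y ∈ U, ∀ i, HasFDerivAt (H i 0)
    (H i 0 y • (-Ω 0 y + (1 / 2 : ℝ) • A y) - H i 2 y • Ω 3 y - H i 3 y • Ω 1 y) y
  dH1 : ∀ y ∈ U, ∀ i, HasFDerivAt (H i 1)
    (H i 1 y • (Ω 0 y + (1 / 2 : ℝ) • A y) - H i 2 y • Ω 4 y - H i 3 y • Ω 2 y) y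
  dH2 : ∀ y ∈ U, ∀ i, HasFDerivAt (H i 2)
    (H i 0 y • Ω 2 y + H i 1 y • Ω 1 y + H i 2 y • (-Ω 5 y + (1 / 2 : ℝ) • A y)) y
  dH3 : ∀ y ∈ U, ∀ i, HasFDerivAt (H i 3)
    (H i 0 y • Ω 4 y + H i 1 y • Ω 3 y + H i 3 y • (Ω 5 y + (1 / 2 : ℝ) • A y)) y
  dX : ∀ y ∈ U, ∀ i, HasFDerivAt (X i) (∑ j, H i j y • θ j y) y
  metric : ∀ y ∈ U, ∀ i j, rowProduct H i j y = rowProduct H 0 1 y * splitMetric i j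
  pos : ∀ y ∈ U, 0 < rowProduct H 0 1 y

variable {θ : Fin 4 → E → E →L[ℝ] ℝ} {Ω : Fin 6 → E → E →L[ℝ] ℝ} {A : E → E →L[ℝ] ℝ}
  {H : Fin 4 → Fin 4 → E → ℝ} {X : Fin 4 → E → ℝ}

theorem FlatIntegral.mono {U U' : Set E} (h : FlatIntegral U θ Ω A H X) (hU' : IsOpen U')
    (hs : U' ⊆ U) : FlatIntegral U' θ Ω A H X where
  isOpen := hU'
  smooth_H i j := (h.smooth_H i j).mono hs
  smooth_X i := (h.smooth_X i).mono hs
  dH0 y hy := h.dH0 y (hs hy)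
  dH1 y hy := h.dH1 y (hs hy)
  dH2 y hy := h.dH2 y (hs hy)
  dH3 y hy := h.dH3 y (hs hy)
  dX y hy := h.dX y (hs hy)
  metric y hy := h.metric y (hs hy)
  pos y hy := h.pos y (hs hy)

/-- Since Γ lies in co(2,2), Γg + gΓᵀ = A g, and therefore d(HgHᵀ) = A HgHᵀ. -/
theorem hasFDerivAt_rowProduct {y : E}
    (h0 : ∀ i, HasFDerivAt (H i 0)
      (H i 0 y • (-Ω 0 y + (1 / 2 : ℝ) • A y) - H i 2 y • Ω 3 y - H i 3 y • Ω 1 y) y)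
    (h1 : ∀ i, HasFDerivAt (H i 1)
      (H i 1 y • (Ω 0 y + (1 / 2 : ℝ) • A y) - H i 2 y • Ω 4 y - H i 3 y • Ω 2 y) y)
    (h2 : ∀ i, HasFDerivAt (H i 2)
      (H i 0 y • Ω 2 y + H i 1 y • Ω 1 y + H i 2 y • (-Ω 5 y + (1 / 2 : ℝ) • A y)) y)
    (h3 : ∀ i, HasFDerivAt (H i 3)
      (H i 0 y • Ω 4 y + H i 1 y • Ω 3 y + H i 3 y • (Ω 5 y + (1 / 2 : ℝ) • A y)) y)
    (i j : Fin 4) :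
    HasFDerivAt (rowProduct H i j) (rowProduct H i j y • A y) y := by
  refine (((((h0 i).mul (h1 j)).add ((h1 i).mul (h0 j))).add
    ((h2 i).mul (h3 j))).add ((h3 i).mul (h2 j))).congr_fderiv ?_
  ext v
  simp only [rowProduct, add_apply, sub_apply, neg_apply, smul_apply, smul_eq_mul]
  ring

theorem FlatIntegral.hasFDerivAt_rowProduct {U : Set E} (h : FlatIntegral U θ Ω A H X) {y : E}
    (hy : y ∈ U) (i j : Fin 4) :
    HasFDerivAt (rowProduct H i j) (rowProduct H i j y • A y) y :=
  _root_.hasFDerivAt_rowProduct (h.dH0 y hy) (h.dH1 y hy) (h.dH2 y hy) (h.dH3 y hy) i j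

theorem one_rowProduct (i j : Fin 4) :
    (1 : Matrix (Fin 4) (Fin 4) ℝ) i 0 * (1 : Matrix (Fin 4) (Fin 4) ℝ) j 1
    + (1 : Matrix (Fin 4) (Fin 4) ℝ) i 1 * (1 : Matrix (Fin 4) (Fin 4) ℝ) j 0
    + (1 : Matrix (Fin 4) (Fin 4) ℝ) i 2 * (1 : Matrix (Fin 4) (Fin 4) ℝ) j 3
    + (1 : Matrix (Fin 4) (Fin 4) ℝ) i 3 * (1 : Matrix (Fin 4) (Fin 4) ℝ) j 2
    = splitMetric i j := by
  fin_cases i <;> fin_cases j <;> simp [splitMetric, Matrix.one_apply]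

/-- Row i of (H X) is the solution of du = uω that starts at the unit vector eᵢ, so H begins at the
identity and X at 0. The fifth row carries no information and is omitted. -/
theorem exists_flatIntegral {O : Set E} (hO : IsOpen O) (hθ : ∀ i, ContDiffOn ℝ ∞ (θ i) O)
    (hΩ : ∀ i, ContDiffOn ℝ ∞ (Ω i) O) (hA : ContDiffOn ℝ ∞ A O)
    (hsys : ∀ y ∈ O, ∀ v w, FlatSystemAt θ Ω A y v w) {y₀ : E} (hy₀ : y₀ ∈ O) :
    ∃ (U : Set E) (H : Fin 4 → Fin 4 → E → ℝ) (X : Fin 4 → E → ℝ), U ⊆ O ∧ y₀ ∈ U ∧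
      FlatIntegral U θ Ω A H X ∧ (∀ i j, H i j y₀ = (1 : Matrix (Fin 4) (Fin 4) ℝ) i j) := by
  have hdiff : ∀ {f : E → E →L[ℝ] ℝ}, ContDiffOn ℝ ∞ f O → ∀ y ∈ O, DifferentiableAt ℝ f y :=
    fun hf y hy => (hf.contDiffAt (hO.mem_nhds hy)).differentiableAt (by simp)
  have hm := affineConnection_contDiffOn hθ hΩ hA
  have hsol := fun i : Fin 4 => exists_matrix_frobenius_solution
    (m := affineConnection θ Ω A) (x₀ := y₀)
    (fun i j => (hm i j).contDiffAt (hO.mem_nhds hy₀)) (by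
      filter_upwards [hO.mem_nhds hy₀] with y hy v w i j
      exact affineConnection_flat (fun i => hdiff (hθ i) y hy) (fun i => hdiff (hΩ i) y hy)
        (hdiff hA y hy) (hsys y hy v w) i j) (Pi.single i.castSucc 1)
  choose u hu0 hu using hsol
  set H : Fin 4 → Fin 4 → E → ℝ := fun i j => u i j.castSucc with hH
  set X : Fin 4 → E → ℝ := fun i => u i 4 with hX
  have hH0 : ∀ i j, H i j y₀ = (1 : Matrix (Fin 4) (Fin 4) ℝ) i j := fun i j => by
    simp only [hH, hu0, Matrix.one_apply, Pi.single_apply, Fin.castSucc_inj, eq_comm]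
  have hQ0 : rowProduct H 0 1 y₀ = 1 := by
    simp [rowProduct, hH0]
  have hcont : ContinuousAt (rowProduct H 0 1) y₀ := by
    have : ∀ i j, ContinuousAt (H i j) y₀ := fun i j =>
      ((hu i).self_of_nhds j.castSucc).continuousAt
    unfold rowProduct
    fun_prop
  have hpos : ∀ᶠ y in nhds y₀, 0 < rowProduct H 0 1 y :=
    continuousAt_const.eventually_lt hcont (by rw [hQ0]; norm_num)
  have hOev : ∀ᶠ y in nhds y₀, y ∈ O := hO.mem_nhds hy₀
  obtain ⟨r, hr, hball⟩ := Metric.eventually_nhds_iff_ball.1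
    (hOev.and ((Filter.eventually_all.2 hu).and hpos))
  have hsub : Metric.ball y₀ r ⊆ O := fun y hy => (hball y hy).1
  have hsm : ∀ i j, ContDiffOn ℝ ∞ (u i j) (Metric.ball y₀ r) := fun i =>
    contDiffOn_of_linear_system Metric.isOpen_ball (fun k l => (hm k l).mono hsub)
      fun y hy => (hball y hy).2.1 i
  have d0 : ∀ y ∈ Metric.ball y₀ r, ∀ i, HasFDerivAt (H i 0)
      (H i 0 y • (-Ω 0 y + (1 / 2 : ℝ) • A y) - H i 2 y • Ω 3 y - H i 3 y • Ω 1 y) y :=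
    fun y hy i => ((hball y hy).2.1 i 0).congr_fderiv (by
      ext v; simp [affineConnection, Fin.sum_univ_five, hH]; ring)
  have d1 : ∀ y ∈ Metric.ball y₀ r, ∀ i, HasFDerivAt (H i 1)
      (H i 1 y • (Ω 0 y + (1 / 2 : ℝ) • A y) - H i 2 y • Ω 4 y - H i 3 y • Ω 2 y) y :=
    fun y hy i => ((hball y hy).2.1 i 1).congr_fderiv (by
      ext v; simp [affineConnection, Fin.sum_univ_five, hH]; ring)
  have d2 : ∀ y ∈ Metric.ball y₀ r, ∀ i, HasFDerivAt (H i 2)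
      (H i 0 y • Ω 2 y + H i 1 y • Ω 1 y + H i 2 y • (-Ω 5 y + (1 / 2 : ℝ) • A y)) y :=
    fun y hy i => ((hball y hy).2.1 i 2).congr_fderiv (by
      ext v; simp [affineConnection, Fin.sum_univ_five, hH])
  have d3 : ∀ y ∈ Metric.ball y₀ r, ∀ i, HasFDerivAt (H i 3)
      (H i 0 y • Ω 4 y + H i 1 y • Ω 3 y + H i 3 y • (Ω 5 y + (1 / 2 : ℝ) • A y)) y :=
    fun y hy i => ((hball y hy).2.1 i 3).congr_fderiv (by
      ext v; simp [affineConnection, Fin.sum_univ_five, hH])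
  refine ⟨Metric.ball y₀ r, H, X, hsub, Metric.mem_ball_self hr,
    ⟨Metric.isOpen_ball, fun i j => hsm i _, fun i => hsm i 4, d0, d1, d2, d3, fun y hy i => ?_,
      fun y hy i j => ?_, fun y hy => (hball y hy).2.2⟩, hH0⟩
  · exact ((hball y hy).2.1 i 4).congr_fderiv (by
      ext v; simp [affineConnection, Fin.sum_univ_five, Fin.sum_univ_four, hH])
  · have hQ := fun z (hz : z ∈ Metric.ball y₀ r) =>
      _root_.hasFDerivAt_rowProduct (d0 z hz) (d1 z hz) (d2 z hz) (d3 z hz)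
    -- All row products satisfy dQ = QA, so a quotient of two of them is constant on the ball, which
    -- is convex; its value is known at the centre, where H = 1.
    have hconst : ∀ z ∈ Metric.ball y₀ r,
        HasFDerivAt (fun z => rowProduct H i j z * (rowProduct H 0 1 z)⁻¹) (0 : E →L[ℝ] ℝ) z := by
      intro z hz
      have hne := (hball z hz).2.2.ne'
      have hinv := (hasDerivAt_inv hne).comp_hasFDerivAt z (hQ z hz 0 1)
      refine ((hQ z hz i j).mul hinv).congr_fderiv ?_
      ext v
      simp
      field_simp
      ring
    have heq := (convex_ball y₀ r).is_const_of_fderivWithin_eq_zero (𝕜 := ℝ)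
      (fun z hz => (hconst z hz).differentiableAt.differentiableWithinAt)
      (fun z hz => by
        rw [fderivWithin_of_isOpen Metric.isOpen_ball hz, (hconst z hz).fderiv])
      hy (Metric.mem_ball_self hr)
    have hne := (hball y hy).2.2.ne'
    simp only [hQ0, inv_one, mul_one] at heq
    rw [mul_inv_eq_iff_eq_mul₀ hne] at heq
    rw [heq, mul_comm]
    congr 1
    simp only [rowProduct, hH0]
    exact one_rowProduct i j

end Integration

/-! ### Coordinates on the structure groups -/

section Groups

theorem splitMetric_mul_self : splitMetric * splitMetric = 1 := by
  ext i j
  fin_cases i <;> fin_cases j <;> simp [splitMetric, Matrix.mul_apply, Fin.sum_univ_four]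

/-- The hypothesis exhibits c⁻¹ g mᵀ g as a left inverse of m. For square matrices it is also a
right inverse, which is the transposed relation. -/
theorem conformal_row_of_column {m : Matrix (Fin 4) (Fin 4) ℝ} {c : ℝ} (hc : c ≠ 0)
    (h : mᵀ * splitMetric * m = c • splitMetric) : m * splitMetric * mᵀ = c • splitMetric := by
  have h1 : (c⁻¹ • (splitMetric * mᵀ * splitMetric)) * m = 1 := by
    rw [Matrix.smul_mul, Matrix.mul_assoc, Matrix.mul_assoc, ← Matrix.mul_assoc mᵀ, h,
      Matrix.mul_smul, smul_smul, inv_mul_cancel₀ hc, one_smul, splitMetric_mul_self]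
  have h2 := mul_eq_one_comm.1 h1
  calc m * splitMetric * mᵀ
      = c • (m * (c⁻¹ • (splitMetric * mᵀ * splitMetric)) * splitMetric) := by
        rw [Matrix.mul_smul, Matrix.smul_mul, smul_smul, mul_inv_cancel₀ hc, one_smul]
        simp only [Matrix.mul_assoc, splitMetric_mul_self, Matrix.mul_one]
    _ = c • splitMetric := by rw [h2, Matrix.one_mul]

theorem conformal_column_of_row {m : Matrix (Fin 4) (Fin 4) ℝ} {c : ℝ} (hc : c ≠ 0)
    (h : m * splitMetric * mᵀ = c • splitMetric) : mᵀ * splitMetric * m = c • splitMetric := by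
  have := conformal_row_of_column (m := mᵀ) hc (by rwa [Matrix.transpose_transpose])
  rwa [Matrix.transpose_transpose] at this

theorem rowEntry (m : Matrix (Fin 4) (Fin 4) ℝ) (i j : Fin 4) : (m * splitMetric * mᵀ) i j =
    m i 0 * m j 1 + m i 1 * m j 0 + m i 2 * m j 3 + m i 3 * m j 2 := by
  simp [Matrix.mul_apply, Fin.sum_univ_four, splitMetric]
  ring

theorem columnEntry (m : Matrix (Fin 4) (Fin 4) ℝ) (i j : Fin 4) : (mᵀ * splitMetric * m) i j =
    m 0 i * m 1 j + m 1 i * m 0 j + m 2 i * m 3 j + m 3 i * m 2 j := by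
  simp [Matrix.mul_apply, Fin.sum_univ_four, splitMetric]
  ring

theorem eq_zero_of_det_ne_zero {a b c d x y : ℝ} (hdet : a * d - b * c ≠ 0)
    (h1 : a * x + b * y = 0) (h2 : c * x + d * y = 0) : x = 0 ∧ y = 0 :=
  ⟨(mul_eq_zero.1 (by linear_combination d * h1 - b * h2 :
    (a * d - b * c) * x = 0)).resolve_left hdet,
  (mul_eq_zero.1 (by linear_combination a * h2 - c * h1 :
    (a * d - b * c) * y = 0)).resolve_left hdet⟩

/-- Seven entries are local coordinates on the conformal group of the split metric. -/
theorem conformal_eq_of_coordinates {m m' : Matrix (Fin 4) (Fin 4) ℝ} {c c' : ℝ} (hc : c ≠ 0)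
    (hc' : c' ≠ 0) (hm : mᵀ * splitMetric * m = c • splitMetric)
    (hm' : m'ᵀ * splitMetric * m' = c' • splitMetric)
    (h11 : m 1 1 = m' 1 1) (h12 : m 1 2 = m' 1 2) (h13 : m 1 3 = m' 1 3) (h21 : m 2 1 = m' 2 1)
    (h22 : m 2 2 = m' 2 2) (h31 : m 3 1 = m' 3 1) (h33 : m 3 3 = m' 3 3) (n1 : m 1 1 ≠ 0)
    (n2 : m 1 1 * m 2 2 - m 1 2 * m 2 1 ≠ 0) (n3 : m 1 1 * m 3 3 - m 1 3 * m 3 1 ≠ 0) :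
    m = m' := by
  have R := fun i j => congrFun (congrFun (conformal_row_of_column hc hm) i) j
  have R' := fun i j => congrFun (congrFun (conformal_row_of_column hc' hm') i) j
  have C := fun i j => congrFun (congrFun hm i) j
  have C' := fun i j => congrFun (congrFun hm' i) j
  simp only [rowEntry, columnEntry, Matrix.smul_apply, smul_eq_mul] at R R' C C'
  have r11 := R 1 1
  have r12 := R 1 2
  have r22 := R 2 2
  have r13 := R 1 3
  have r33 := R 3 3
  have r11' := R' 1 1
  have r12' := R' 1 2
  have r22' := R' 2 2
  have r13' := R' 1 3
  have r33' := R' 3 3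
  have c11 := C 1 1
  have c12 := C 1 2
  have c13 := C 1 3
  have c23 := C 2 3
  have c01 := C 0 1
  have c11' := C' 1 1
  have c12' := C' 1 2
  have c13' := C' 1 3
  have c23' := C' 2 3
  have c01' := C' 0 1
  have s11 : splitMetric 1 1 = 0 := by simp [splitMetric]
  have s12 : splitMetric 1 2 = 0 := by simp [splitMetric]
  have s22 : splitMetric 2 2 = 0 := by simp [splitMetric]
  have s13 : splitMetric 1 3 = 0 := by simp [splitMetric]
  have s33 : splitMetric 3 3 = 0 := by simp [splitMetric]
  have s23 : splitMetric 2 3 = 1 := by simp [splitMetric]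
  have s01 : splitMetric 0 1 = 1 := by simp [splitMetric]
  simp only [s11, s12, s22, s13, s33, mul_zero, ← h11, ← h12, ← h13, ← h21,
    ← h22, ← h31, ← h33] at r11 r12 r22 r13 r33 r11' r12' r22' r13' r33'
  simp only [s11, s12, s13, s23, s01, mul_zero, mul_one, ← h11, ← h12, ← h13, ← h21, ← h22, ← h31,
    ← h33] at c11 c12 c13 c23 c01 c11' c12' c13' c23' c01'
  clear R R' C C' hm hm'
  -- Row 1 and column 1 are null, and their given entries together with m₁₁ ≠ 0 determine the entry
  -- opposite to m₁₁.
  have h10 : m 1 0 = m' 1 0 := mul_left_cancel₀ n1 (by linear_combination (r11 - r11') / 2)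
  have h01 : m 0 1 = m' 0 1 := mul_left_cancel₀ n1 (by linear_combination (c11 - c11') / 2)
  rw [← h10] at r12' r13' c01'
  rw [← h01] at c12' c13' c01'
  -- Orthogonality to row 1 and nullity of row 2 are two equations, with the first nonzero minor as
  -- determinant, for its missing entries 0 and 3. Row 3 is treated likewise with the second minor.
  have h2 := eq_zero_of_det_ne_zero (x := m 2 0 - m' 2 0) (y := m 2 3 - m' 2 3) n2
    (by linear_combination r12 - r12') (by linear_combination (r22 - r22') / 2)
  have h3 := eq_zero_of_det_ne_zero (x := m 3 0 - m' 3 0) (y := m 3 2 - m' 3 2) n3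
    (by linear_combination r13 - r13') (by linear_combination (r33 - r33') / 2)
  have h20 : m 2 0 = m' 2 0 := sub_eq_zero.1 h2.1
  have h23 : m 2 3 = m' 2 3 := sub_eq_zero.1 h2.2
  have h30 : m 3 0 = m' 3 0 := sub_eq_zero.1 h3.1
  have h32 : m 3 2 = m' 3 2 := sub_eq_zero.1 h3.2
  rw [← h32] at c12' c23'
  rw [← h23] at c13' c23'
  rw [← h20, ← h30] at c01'
  have h02 : m 0 2 = m' 0 2 := mul_left_cancel₀ n1 (by linear_combination c12 - c12')
  have h03 : m 0 3 = m' 0 3 := mul_left_cancel₀ n1 (by linear_combination c13 - c13')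
  rw [← h02, ← h03] at c23'
  -- The factors c and c' are not known to agree. They are eliminated by subtracting the product of
  -- columns 2 and 3 from that of columns 0 and 1, both of which equal the factor.
  have h00 : m 0 0 = m' 0 0 := mul_left_cancel₀ n1 (by
    linear_combination c01 - c01' - c23 + c23')
  ext i j
  fin_cases i <;> fin_cases j <;> assumption

theorem mem_CO22_iff {g : GL (Fin 4) ℝ} : g ∈ CO22 ↔ ∃ c : ℝ, 0 < c ∧
    (g : Matrix (Fin 4) (Fin 4) ℝ)ᵀ * splitMetric * (g : Matrix (Fin 4) (Fin 4) ℝ)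
      = c • splitMetric := Iff.rfl

/-- The invertible matrix with a given value (the identity if the value is not invertible). -/
def toGL {n : Type*} [Fintype n] [DecidableEq n] (m : Matrix n n ℝ) : GL n ℝ :=
  open Classical in if h : IsUnit m then h.unit else 1

theorem toGL_val {n : Type*} [Fintype n] [DecidableEq n] {m : Matrix n n ℝ} (h : IsUnit m) :
    (toGL m).val = m := by
  rw [toGL, dif_pos h]; rfl

/-- The element of `groupK` with given coordinates. -/
def coordK (p q p' q' t : ℝ) : GL (Fin 2 ⊕ Fin 2 ⊕ Unit) ℝ :=
  toGL (blockMatrix !![p, q; 0, 1] !![p', q'; 0, 1] t)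

theorem affine_mul_inv {p q : ℝ} (hp : p ≠ 0) :
    !![p, q; 0, 1] * !![p⁻¹, -q / p; 0, 1] = (1 : Matrix (Fin 2) (Fin 2) ℝ) := by
  ext i j
  fin_cases i <;> fin_cases j <;> simp [Matrix.mul_apply, Fin.sum_univ_two, hp]
  field_simp
  ring

theorem isUnit_blockMatrix_affine {p q p' q' t : ℝ} (hp : p ≠ 0) (hp' : p' ≠ 0) (ht : t ≠ 0) :
    IsUnit (blockMatrix !![p, q; 0, 1] !![p', q'; 0, 1] t) := by
  refine IsUnit.of_mul_eq_one (blockMatrix !![p⁻¹, -q / p; 0, 1] !![p'⁻¹, -q' / p'; 0, 1] t⁻¹) ?_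
  rw [← blockMatrix_mul, affine_mul_inv hp, affine_mul_inv hp', mul_inv_cancel₀ ht,
    blockMatrix_one]

theorem coordK_val {p q p' q' t : ℝ} (hp : p ≠ 0) (hp' : p' ≠ 0) (ht : t ≠ 0) :
    (coordK p q p' q' t).val = blockMatrix !![p, q; 0, 1] !![p', q'; 0, 1] t :=
  toGL_val (isUnit_blockMatrix_affine hp hp' ht)

theorem coordK_mem {p q p' q' t : ℝ} (hp : p ≠ 0) (hp' : p' ≠ 0) (ht : t ≠ 0) :
    coordK p q p' q' t ∈ groupK := by
  have hu : ∀ {p q : ℝ}, p ≠ 0 → IsUnit !![p, q; 0, 1] := fun hp =>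
    IsUnit.of_mul_eq_one _ (affine_mul_inv hp)
  refine ⟨(toGL !![p, q; 0, 1], toGL !![p', q'; 0, 1], Units.mk0 t ht), ⟨?_, ?_, trivial⟩, ?_⟩
  · change (toGL _).val 1 0 = 0 ∧ (toGL _).val 1 1 = 1
    rw [toGL_val (hu hp)]; simp
  · change (toGL _).val 1 0 = 0 ∧ (toGL _).val 1 1 = 1
    rw [toGL_val (hu hp')]; simp
  · apply Units.ext
    change blockMatrix (toGL _).val (toGL _).val t = _
    rw [coordK_val hp hp' ht, toGL_val (hu hp), toGL_val (hu hp')]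

theorem exists_blockMatrix_of_mem_groupK {g : GL (Fin 2 ⊕ Fin 2 ⊕ Unit) ℝ} (hg : g ∈ groupK) :
    g.val = blockMatrix
      !![g (.inl 0) (.inl 0), g (.inl 0) (.inl 1); 0, 1]
      !![g (.inr (.inl 0)) (.inr (.inl 0)), g (.inr (.inl 0)) (.inr (.inl 1)); 0, 1]
      (g (.inr (.inr ())) (.inr (.inr ()))) := by
  obtain ⟨⟨k, k', t⟩, ⟨⟨h1, h2⟩, ⟨h3, h4⟩, -⟩, rfl⟩ := hg
  change blockMatrix k.val k'.val t = _
  have e : (blockHom (k, k', t)).val = blockMatrix k.val k'.val t := rfl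
  have hk : k.val = !![k 0 0, k 0 1; 0, 1] := by
    ext i j; fin_cases i <;> fin_cases j; exacts [rfl, rfl, h1, h2]
  have hk' : k'.val = !![k' 0 0, k' 0 1; 0, 1] := by
    ext i j; fin_cases i <;> fin_cases j; exacts [rfl, rfl, h3, h4]
  rw [e, hk, hk']
  simp [blockMatrix]

end Groups

/-! ### Open embeddings -/

section OpenEmbedding

/-- A continuous map on an open set which becomes a local chart after composition with an
injective continuous map is an open embedding. -/
theorem isOpenEmbedding_of_coordinates {M Y Z : Type*} [TopologicalSpace M] [TopologicalSpace Y]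
    [TopologicalSpace Z] {U : Set M} (hU : IsOpen U) (e : OpenPartialHomeomorph M Z)
    (he : U ⊆ e.source) {F : U → Y} (hF : Continuous F) {ρ : Y → Z} {W : Set Y} (hW : IsOpen W)
    (hρ : ContinuousOn ρ W) (hinj : Set.InjOn ρ W) (hFW : ∀ p, F p ∈ W)
    (hρF : ∀ p, ρ (F p) = e p) : Topology.IsOpenEmbedding F := by
  refine Topology.IsOpenEmbedding.of_continuous_injective_isOpenMap hF (fun p q hpq => ?_)
    fun V hV => ?_
  · apply Subtype.ext
    apply e.injOn (he p.2) (he q.2)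
    rw [← hρF, ← hρF, hpq]
  · have hV' : IsOpen (e '' (Subtype.val '' V)) :=
      e.isOpen_image_of_subset_source (hU.isOpenMap_subtype_val V hV) (by
        rintro _ ⟨p, -, rfl⟩; exact he p.2)
    -- Injectivity of ρ on W identifies the image F(V) with W ∩ ρ⁻¹(e(V)), so no manifold structure
    -- on Y is needed.
    convert hρ.isOpen_inter_preimage hW hV' using 1
    ext y
    constructor
    · rintro ⟨p, hp, rfl⟩
      exact ⟨hFW p, p, ⟨p, hp, rfl⟩, (hρF p).symm⟩
    · rintro ⟨hy, _, ⟨p, hp, rfl⟩, h⟩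
      exact ⟨p, hp, hinj (hFW p) hy ((hρF p).trans h)⟩

/-- The inverse function theorem: between spaces of equal finite dimension an injective derivative
is invertible. -/
theorem exists_chart_of_injective_fderiv {E F : Type*} [NormedAddCommGroup E] [NormedSpace ℝ E]
    [FiniteDimensional ℝ E] [NormedAddCommGroup F] [NormedSpace ℝ F] [FiniteDimensional ℝ F]
    (hdim : Module.finrank ℝ E = Module.finrank ℝ F) {f : E → F} {f' : E →L[ℝ] F} {y : E}
    (hf : ContDiffAt ℝ ∞ f y) (hf' : HasFDerivAt f f' y) (hinj : ∀ v, f' v = 0 → v = 0) :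
    ∃ e : OpenPartialHomeomorph E F, y ∈ e.source ∧ ⇑e = f := by
  have := FiniteDimensional.complete ℝ E
  let L : E ≃L[ℝ] F := (LinearMap.linearEquivOfInjective f'.toLinearMap
    ((injective_iff_map_eq_zero _).2 hinj) hdim).toContinuousLinearEquiv
  have hL : HasFDerivAt f (L : E →L[ℝ] F) y := hf'.congr_fderiv (by ext v; rfl)
  exact ⟨hf.toOpenPartialHomeomorph f hL (by simp),
    hf.mem_toOpenPartialHomeomorph_source hL (by simp), rfl⟩

end OpenEmbedding

/-! ### Functions built from an integral of the flat structure equations -/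

section IntegralFunctions

variable {E : Type*} [NormedAddCommGroup E] [NormedSpace ℝ E]
  {θ : Fin 4 → E → E →L[ℝ] ℝ} {Ω : Fin 6 → E → E →L[ℝ] ℝ} {A : E → E →L[ℝ] ℝ}
  {H : Fin 4 → Fin 4 → E → ℝ} {X : Fin 4 → E → ℝ} {U : Set E}

theorem hasFDerivAt_div {f g : E → ℝ} {f' g' : E →L[ℝ] ℝ} {y : E} (hf : HasFDerivAt f f' y)
    (hg : HasFDerivAt g g' y) (h0 : g y ≠ 0) :
    HasFDerivAt (fun z => f z / g z) ((g y ^ 2)⁻¹ • (g y • f' - f y • g')) y := by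
  refine (hf.mul ((hasDerivAt_inv h0).comp_hasFDerivAt y hg)).congr_fderiv ?_
  ext v
  simp
  field_simp
  ring

/-- The matrix of values of a matrix of functions. -/
def valueMatrix (H : Fin 4 → Fin 4 → E → ℝ) (y : E) : Matrix (Fin 4) (Fin 4) ℝ :=
  Matrix.of fun i j => H i j y

omit [NormedAddCommGroup E] [NormedSpace ℝ E] in
@[simp] theorem valueMatrix_apply (y : E) (i j : Fin 4) : valueMatrix H y i j = H i j y := rfl

/-- The permutation of the indices given by the split metric. -/
def dualIndex : Fin 4 → Fin 4 := ![1, 0, 3, 2]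

/-- The inverse matrix of a conformal matrix. -/
def conformalInverse (H : Fin 4 → Fin 4 → E → ℝ) (i j : Fin 4) (y : E) : ℝ :=
  H (dualIndex j) (dualIndex i) y / rowProduct H 0 1 y

theorem FlatIntegral.row_metric (h : FlatIntegral U θ Ω A H X) {y : E} (hy : y ∈ U) :
    valueMatrix H y * splitMetric * (valueMatrix H y)ᵀ = rowProduct H 0 1 y • splitMetric := by
  ext i j
  rw [rowEntry, Matrix.smul_apply, smul_eq_mul, ← h.metric y hy i j]
  rfl

theorem FlatIntegral.column_metric (h : FlatIntegral U θ Ω A H X) {y : E} (hy : y ∈ U) :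
    (valueMatrix H y)ᵀ * splitMetric * valueMatrix H y = rowProduct H 0 1 y • splitMetric :=
  conformal_column_of_row (h.pos y hy).ne' (h.row_metric hy)

theorem FlatIntegral.column_product (h : FlatIntegral U θ Ω A H X) {y : E} (hy : y ∈ U)
    (i j : Fin 4) : H 0 i y * H 1 j y + H 1 i y * H 0 j y + H 2 i y * H 3 j y + H 3 i y * H 2 j y
      = rowProduct H 0 1 y * splitMetric i j := by
  have := congrFun (congrFun (h.column_metric hy) i) j
  rwa [columnEntry, Matrix.smul_apply, smul_eq_mul] at this

/-- From HᵀgH = c g and g² = 1 the inverse of H is c⁻¹ gHᵀg. Multiplication by g only permutes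
indices, which is what `dualIndex` records. -/
theorem FlatIntegral.conformalInverse_mul (h : FlatIntegral U θ Ω A H X) {y : E} (hy : y ∈ U)
    (i k : Fin 4) : ∑ j, conformalInverse H i j y * H j k y
      = (1 : Matrix (Fin 4) (Fin 4) ℝ) i k := by
  have h1 := h.column_product hy (dualIndex i) k
  have h2 : splitMetric (dualIndex i) k = (1 : Matrix (Fin 4) (Fin 4) ℝ) i k := by
    fin_cases i <;> fin_cases k <;> simp [splitMetric, dualIndex]
  rw [h2] at h1
  have h0 := (h.pos y hy).ne'
  rw [Fin.sum_univ_four]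
  simp only [conformalInverse]
  have e0 : dualIndex 0 = 1 := rfl
  have e1 : dualIndex 1 = 0 := rfl
  have e2 : dualIndex 2 = 3 := rfl
  have e3 : dualIndex 3 = 2 := rfl
  rw [e0, e1, e2, e3]
  field_simp
  linear_combination h1

theorem FlatIntegral.mul_conformalInverse (h : FlatIntegral U θ Ω A H X) {y : E} (hy : y ∈ U) :
    valueMatrix H y * Matrix.of (fun i j => conformalInverse H i j y) = 1 := by
  refine mul_eq_one_comm.1 ?_
  ext i k
  rw [← h.conformalInverse_mul hy, Matrix.mul_apply]
  rfl

theorem FlatIntegral.isUnit (h : FlatIntegral U θ Ω A H X) {y : E} (hy : y ∈ U) :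
    IsUnit (valueMatrix H y) :=
  IsUnit.of_mul_eq_one _ (h.mul_conformalInverse hy)

theorem FlatIntegral.inv_toGL (h : FlatIntegral U θ Ω A H X) {y : E} (hy : y ∈ U) (i j : Fin 4) :
    ((toGL (valueMatrix H y))⁻¹ : GL (Fin 4) ℝ).val i j = conformalInverse H i j y := by
  have h1 : (toGL (valueMatrix H y)).val * ((toGL (valueMatrix H y))⁻¹ : GL (Fin 4) ℝ).val = 1 :=
    (toGL (valueMatrix H y)).mul_inv
  rw [toGL_val (h.isUnit hy)] at h1
  have h2 := left_inv_eq_right_inv (mul_eq_one_comm.1 h1) (h.mul_conformalInverse hy)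
  rw [h2]; rfl

theorem FlatIntegral.eq_conformalInverse (h : FlatIntegral U θ Ω A H X) {y : E} (hy : y ∈ U)
    (t : Fin 4 → ℝ) (i : Fin 4) :
    t i = ∑ j, conformalInverse H i j y * ∑ k, H j k y * t k := by
  simp only [Finset.mul_sum]
  rw [Finset.sum_comm]
  simp only [← mul_assoc, ← Finset.sum_mul, h.conformalInverse_mul hy, Matrix.one_apply]
  simp

/-- The coordinates `x` and `y` of the base of the second fibration. -/
def baseSlope (H : Fin 4 → Fin 4 → E → ℝ) (i : Fin 2) (z : E) : ℝ :=
  H (![1, 0] i) 2 z / H 2 2 z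

/-- The dilation coordinate of the first factor of `K`. -/
def fibreP (H : Fin 4 → Fin 4 → E → ℝ) (z : E) : ℝ :=
  (H 1 1 z * H 2 2 z - H 1 2 z * H 2 1 z) / rowProduct H 0 1 z

/-- The translation coordinate of the first factor of `K`. -/
def fibreQ (H : Fin 4 → Fin 4 → E → ℝ) (z : E) : ℝ :=
  (H 1 3 z * H 2 2 z - H 1 2 z * H 2 3 z - (H 1 1 z * H 2 0 z - H 1 0 z * H 2 1 z)) * (1 / 2)
    / rowProduct H 0 1 z

/-- The dilation coordinate of the second factor of `K`. -/
def fibreP' (H : Fin 4 → Fin 4 → E → ℝ) (z : E) : ℝ :=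
  (H 2 2 z * H 0 0 z - H 2 0 z * H 0 2 z) / rowProduct H 0 1 z

/-- The translation coordinate of the second factor of `K`. -/
def fibreQ' (H : Fin 4 → Fin 4 → E → ℝ) (z : E) : ℝ :=
  (H 2 2 z * H 0 3 z - H 2 3 z * H 0 2 z + (H 2 0 z * H 0 1 z - H 2 1 z * H 0 0 z)) * (1 / 2)
    / rowProduct H 0 1 z

/-- The coefficients of `Ω₃, Ω₂` in the differentials of the slopes. -/
def slopeCoeff (H : Fin 4 → Fin 4 → E → ℝ) (i j : Fin 2) (z : E) : ℝ :=
  H 2 2 z * H (![1, 0] i) (![0, 1] j) z - H (![1, 0] i) 2 z * H 2 (![0, 1] j) z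

/-! ### Differentials of the base slopes and of the fibre coordinates -/

/-- The part of the differential of column 2 proportional to the column cancels in a quotient of its
entries, leaving `Ω 1` and `Ω 2` only. -/
theorem FlatIntegral.hasFDerivAt_slope (h : FlatIntegral U θ Ω A H X) {y : E} (hy : y ∈ U)
    (h0 : H 2 2 y ≠ 0) (i : Fin 2) : HasFDerivAt (baseSlope H i)
      ((H 2 2 y ^ 2)⁻¹ • (slopeCoeff H i 0 y • Ω 2 y + slopeCoeff H i 1 y • Ω 1 y)) y := by
  refine (hasFDerivAt_div (h.dH2 y hy _) (h.dH2 y hy _) h0).congr_fderiv ?_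
  ext v
  fin_cases i <;> simp [slopeCoeff] <;> field_simp <;> ring

/-- Where `Ω 1` and `Ω 2` vanish, columns 1 and 2 change only by multiples of themselves and of
column 2, so their wedge product scales by `Ω 0 - Ω 5 + A`. Division by c removes A. Columns 0 and 2
behave in the same way in `fibreP'`. -/
theorem FlatIntegral.hasFDerivAt_fibreP (h : FlatIntegral U θ Ω A H X) {y : E} (hy : y ∈ U) :
    ∃ f' : E →L[ℝ] ℝ, HasFDerivAt (fibreP H) f' y ∧ ∀ v, Ω 1 y v = 0 → Ω 2 y v = 0 →
      f' v = fibreP H y * (Ω 0 y v - Ω 5 y v) := by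
  have h0 := (h.pos y hy).ne'
  have hN := ((h.dH1 y hy 1).mul (h.dH2 y hy 2)).sub
    ((h.dH2 y hy 1).mul (h.dH1 y hy 2))
  refine ⟨_, hasFDerivAt_div hN (h.hasFDerivAt_rowProduct hy 0 1) h0, fun v h1 h2 => ?_⟩
  simp [fibreP, h1, h2]
  field_simp
  ring

/-- Along the fibre col₃∧col₂ and col₁∧col₀ both acquire col₀∧col₂ `Ω 4`, but opposite multiples of
col₁∧col₂ `Ω 3`. Half their difference keeps the `Ω 3` term alone; in `fibreQ'` half the sum of
col₂∧col₃ and col₀∧col₁ keeps the `Ω 4` term alone. -/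
theorem FlatIntegral.hasFDerivAt_fibreQ (h : FlatIntegral U θ Ω A H X) {y : E} (hy : y ∈ U) :
    ∃ f' : E →L[ℝ] ℝ, HasFDerivAt (fibreQ H) f' y ∧ ∀ v, Ω 1 y v = 0 → Ω 2 y v = 0 →
      f' v = fibreP H y * Ω 3 y v := by
  have h0 := (h.pos y hy).ne'
  have hN := ((((h.dH3 y hy 1).mul (h.dH2 y hy 2)).sub
    ((h.dH2 y hy 1).mul (h.dH3 y hy 2))).sub (((h.dH1 y hy 1).mul (h.dH0 y hy 2)).sub
    ((h.dH0 y hy 1).mul (h.dH1 y hy 2)))).mul_const (1 / 2)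
  refine ⟨_, hasFDerivAt_div hN (h.hasFDerivAt_rowProduct hy 0 1) h0, fun v h1 h2 => ?_⟩
  simp [fibreP, h1, h2]
  field_simp
  ring

theorem FlatIntegral.hasFDerivAt_fibreP' (h : FlatIntegral U θ Ω A H X) {y : E} (hy : y ∈ U) :
    ∃ f' : E →L[ℝ] ℝ, HasFDerivAt (fibreP' H) f' y ∧ ∀ v, Ω 1 y v = 0 → Ω 2 y v = 0 →
      f' v = fibreP' H y * -(Ω 0 y v + Ω 5 y v) := by
  have h0 := (h.pos y hy).ne'
  have hN := ((h.dH2 y hy 2).mul (h.dH0 y hy 0)).sub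
    ((h.dH0 y hy 2).mul (h.dH2 y hy 0))
  refine ⟨_, hasFDerivAt_div hN (h.hasFDerivAt_rowProduct hy 0 1) h0, fun v h1 h2 => ?_⟩
  simp [fibreP', h1, h2]
  field_simp
  ring

theorem FlatIntegral.hasFDerivAt_fibreQ' (h : FlatIntegral U θ Ω A H X) {y : E} (hy : y ∈ U) :
    ∃ f' : E →L[ℝ] ℝ, HasFDerivAt (fibreQ' H) f' y ∧ ∀ v, Ω 1 y v = 0 → Ω 2 y v = 0 →
      f' v = fibreP' H y * Ω 4 y v := by
  have h0 := (h.pos y hy).ne'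
  have hN := ((((h.dH2 y hy 2).mul (h.dH3 y hy 0)).sub
    ((h.dH3 y hy 2).mul (h.dH2 y hy 0))).add (((h.dH0 y hy 2).mul (h.dH1 y hy 0)).sub
    ((h.dH1 y hy 2).mul (h.dH0 y hy 0)))).mul_const (1 / 2)
  refine ⟨_, hasFDerivAt_div hN (h.hasFDerivAt_rowProduct hy 0 1) h0, fun v h1 h2 => ?_⟩
  simp [fibreP', h1, h2]
  field_simp
  ring

/-! #### Smoothness -/

theorem FlatIntegral.smooth_rowProduct (h : FlatIntegral U θ Ω A H X) (i j : Fin 4) :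
    ContDiffOn ℝ ∞ (rowProduct H i j) U :=
  ((((h.smooth_H i 0).mul (h.smooth_H j 1)).add ((h.smooth_H i 1).mul (h.smooth_H j 0))).add
    ((h.smooth_H i 2).mul (h.smooth_H j 3))).add ((h.smooth_H i 3).mul (h.smooth_H j 2))

theorem FlatIntegral.smooth_minor (h : FlatIntegral U θ Ω A H X) (i j k l i' j' k' l' : Fin 4) :
    ContDiffOn ℝ ∞ (fun z => H i j z * H k l z - H i' j' z * H k' l' z) U :=
  ((h.smooth_H i j).mul (h.smooth_H k l)).sub ((h.smooth_H i' j').mul (h.smooth_H k' l'))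

theorem FlatIntegral.smooth_div (h : FlatIntegral U θ Ω A H X) {f : E → ℝ}
    (hf : ContDiffOn ℝ ∞ f U) : ContDiffOn ℝ ∞ (fun z => f z / rowProduct H 0 1 z) U :=
  hf.div (h.smooth_rowProduct 0 1) fun y hy => (h.pos y hy).ne'

theorem FlatIntegral.smooth_conformalInverse (h : FlatIntegral U θ Ω A H X) (i j : Fin 4) :
    ContDiffOn ℝ ∞ (conformalInverse H i j) U :=
  h.smooth_div (h.smooth_H _ _)

theorem FlatIntegral.smooth_fibreP (h : FlatIntegral U θ Ω A H X) :
    ContDiffOn ℝ ∞ (fibreP H) U := h.smooth_div (h.smooth_minor _ _ _ _ _ _ _ _)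

theorem FlatIntegral.smooth_fibreP' (h : FlatIntegral U θ Ω A H X) :
    ContDiffOn ℝ ∞ (fibreP' H) U := h.smooth_div (h.smooth_minor _ _ _ _ _ _ _ _)

theorem FlatIntegral.smooth_fibreQ (h : FlatIntegral U θ Ω A H X) :
    ContDiffOn ℝ ∞ (fibreQ H) U :=
  h.smooth_div (((h.smooth_minor _ _ _ _ _ _ _ _).sub
    (h.smooth_minor _ _ _ _ _ _ _ _)).mul contDiffOn_const)

theorem FlatIntegral.smooth_fibreQ' (h : FlatIntegral U θ Ω A H X) :
    ContDiffOn ℝ ∞ (fibreQ' H) U :=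
  h.smooth_div (((h.smooth_minor _ _ _ _ _ _ _ _).add
    (h.smooth_minor _ _ _ _ _ _ _ _)).mul contDiffOn_const)

theorem FlatIntegral.smooth_slope (h : FlatIntegral U θ Ω A H X) (h0 : ∀ y ∈ U, H 2 2 y ≠ 0)
    (i : Fin 2) : ContDiffOn ℝ ∞ (baseSlope H i) U :=
  (h.smooth_H _ _).div (h.smooth_H _ _) h0

theorem FlatIntegral.smooth_slopeCoeff (h : FlatIntegral U θ Ω A H X) (i j : Fin 2) :
    ContDiffOn ℝ ∞ (slopeCoeff H i j) U := h.smooth_minor _ _ _ _ _ _ _ _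

end IntegralFunctions

/-! ### Local trivializations -/

section Trivialization

variable {E : Type*} [NormedAddCommGroup E] [NormedSpace ℝ E]
  {θ : Fin 4 → E → E →L[ℝ] ℝ} {Ω : Fin 6 → E → E →L[ℝ] ℝ} {A : E → E →L[ℝ] ℝ}
  {H : Fin 4 → Fin 4 → E → ℝ} {X : Fin 4 → E → ℝ} {U : Set E}

/-- Coordinates on the bundle `ℝ⁴ × CO(2,2)`. -/
def conformalCoords (H : Fin 4 → Fin 4 → E → ℝ) (X : Fin 4 → E → ℝ) (z : E) : Fin 11 → ℝ :=
  ![X 0 z, X 1 z, X 2 z, X 3 z, H 1 1 z, H 1 2 z, H 1 3 z, H 2 1 z, H 2 2 z, H 3 1 z, H 3 3 z]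

/-- The coordinates `(x, y, a₀, a₁, a₂, a₃)` of the projection to the flat para-CR manifold. -/
def paraCRCoords (H : Fin 4 → Fin 4 → E → ℝ) (X : Fin 4 → E → ℝ) (z : E) : Fin 6 → ℝ :=
  ![baseSlope H 0 z, baseSlope H 1 z, X 3 z, X 0 z, X 1 z, -X 2 z]

/-- Coordinates on the bundle `ℝ⁶ × K`. -/
def affineCoords (H : Fin 4 → Fin 4 → E → ℝ) (X : Fin 4 → E → ℝ) (z : E) : Fin 11 → ℝ :=
  ![baseSlope H 0 z, baseSlope H 1 z, X 3 z, X 0 z, X 1 z, -X 2 z, fibreP H z, fibreQ H z,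
    fibreP' H z, fibreQ' H z, rowProduct H 0 1 z]

/-- The coefficients of `θ¹, θ², θ³` with respect to the forms `ν` of the flat model. -/
def solderCoeff (H : Fin 4 → Fin 4 → E → ℝ) (i j : Fin 3) (z : E) : ℝ :=
  ![conformalInverse H i.castSucc 0 z - baseSlope H 0 z * conformalInverse H i.castSucc 3 z,
    conformalInverse H i.castSucc 1 z - baseSlope H 1 z * conformalInverse H i.castSucc 3 z,
    -(conformalInverse H i.castSucc 2 z
      + baseSlope H 0 z * baseSlope H 1 z * conformalInverse H i.castSucc 3 z)] j

/-- A coframe satisfying the flat structure equations, integrated on an open set on which all the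
coordinates used below are defined. -/
structure FlatTrivialization (U : Set E) (θ : Fin 4 → E → E →L[ℝ] ℝ) (Ω : Fin 6 → E → E →L[ℝ] ℝ)
    (A : E → E →L[ℝ] ℝ) (H : Fin 4 → Fin 4 → E → ℝ) (X : Fin 4 → E → ℝ) : Prop
    extends FlatIntegral U θ Ω A H X where
  frame : ∀ y ∈ U, ∀ v, (∀ i, θ i y v = 0) → (∀ i, Ω i y v = 0) → A y v = 0 → v = 0
  ne11 : ∀ y ∈ U, H 1 1 y ≠ 0
  ne22 : ∀ y ∈ U, H 2 2 y ≠ 0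
  minor12 : ∀ y ∈ U, H 1 1 y * H 2 2 y - H 1 2 y * H 2 1 y ≠ 0
  minor13 : ∀ y ∈ U, H 1 1 y * H 3 3 y - H 1 3 y * H 3 1 y ≠ 0
  minor20 : ∀ y ∈ U, H 2 2 y * H 0 0 y - H 2 0 y * H 0 2 y ≠ 0
  slope_det : ∀ y ∈ U, slopeCoeff H 0 0 y * slopeCoeff H 1 1 y
    - slopeCoeff H 0 1 y * slopeCoeff H 1 0 y ≠ 0
  solder_det : ∀ y ∈ U, (Matrix.of fun i j => solderCoeff H i j y).det ≠ 0
  conformal_chart : ∃ e : OpenPartialHomeomorph E (Fin 11 → ℝ), U ⊆ e.source ∧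
    ⇑e = conformalCoords H X
  affine_chart : ∃ e : OpenPartialHomeomorph E (Fin 11 → ℝ), U ⊆ e.source ∧
    ⇑e = affineCoords H X

theorem FlatIntegral.smooth_solderCoeff (h : FlatIntegral U θ Ω A H X)
    (h0 : ∀ y ∈ U, H 2 2 y ≠ 0) (i j : Fin 3) : ContDiffOn ℝ ∞ (solderCoeff H i j) U := by
  have hi := fun j => h.smooth_conformalInverse i.castSucc j
  have hs := h.smooth_slope h0
  fin_cases j
  · exact (hi 0).sub ((hs 0).mul (hi 3))
  · exact (hi 1).sub ((hs 1).mul (hi 3))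
  · exact ((hi 2).add (((hs 0).mul (hs 1)).mul (hi 3))).neg

theorem FlatIntegral.smooth_conformalCoords (h : FlatIntegral U θ Ω A H X) :
    ContDiffOn ℝ ∞ (conformalCoords H X) U := by
  rw [contDiffOn_pi]
  intro i
  fin_cases i <;> first | exact h.smooth_X _ | exact h.smooth_H _ _

theorem FlatIntegral.smooth_paraCRCoords (h : FlatIntegral U θ Ω A H X)
    (h0 : ∀ y ∈ U, H 2 2 y ≠ 0) : ContDiffOn ℝ ∞ (paraCRCoords H X) U := by
  rw [contDiffOn_pi]
  intro i
  fin_cases i <;> first | exact h.smooth_X _ | exact (h.smooth_X _).neg | exact h.smooth_slope h0 _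

theorem FlatIntegral.smooth_affineCoords (h : FlatIntegral U θ Ω A H X)
    (h0 : ∀ y ∈ U, H 2 2 y ≠ 0) : ContDiffOn ℝ ∞ (affineCoords H X) U := by
  rw [contDiffOn_pi]
  intro i
  fin_cases i
  exacts [h.smooth_slope h0 0, h.smooth_slope h0 1, h.smooth_X 3, h.smooth_X 0, h.smooth_X 1,
    (h.smooth_X 2).neg, h.smooth_fibreP, h.smooth_fibreQ, h.smooth_fibreP', h.smooth_fibreQ',
    h.smooth_rowProduct 0 1]

theorem hasFDerivAt_pi_component {n : ℕ} {f : E → Fin n → ℝ} {f' : E →L[ℝ] Fin n → ℝ} {y : E}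
    (hf : HasFDerivAt f f' y) (i : Fin n) {g' : E →L[ℝ] ℝ}
    (hg : HasFDerivAt (fun z => f z i) g' y) (v : E) : f' v i = g' v := by
  have h1 := hasFDerivAt_pi'.1 hf i
  exact DFunLike.congr_fun (h1.unique hg) v

/-- All genericity conditions are open and hold at y₀, where H = 1, X = 0 and c = 1, so it suffices
to shrink the neighbourhood. The two charts come from the injectivity of the two differentials at
y₀. -/
theorem exists_flatTrivialization [FiniteDimensional ℝ E] (hdim : Module.finrank ℝ E = 11)
    {O : Set E} (hO : IsOpen O) (hθ : ∀ i, ContDiffOn ℝ ∞ (θ i) O)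
    (hΩ : ∀ i, ContDiffOn ℝ ∞ (Ω i) O) (hA : ContDiffOn ℝ ∞ A O)
    (hsys : ∀ y ∈ O, ∀ v w, FlatSystemAt θ Ω A y v w)
    (hframe : ∀ y ∈ O, ∀ v, (∀ i, θ i y v = 0) → (∀ i, Ω i y v = 0) → A y v = 0 → v = 0)
    {y₀ : E} (hy₀ : y₀ ∈ O) :
    ∃ (U : Set E) (H : Fin 4 → Fin 4 → E → ℝ) (X : Fin 4 → E → ℝ), U ⊆ O ∧ y₀ ∈ U ∧
      FlatTrivialization U θ Ω A H X := by
  obtain ⟨V, H, X, hVO, hyV, h, h1⟩ := exists_flatIntegral hO hθ hΩ hA hsys hy₀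
  have hdim' : Module.finrank ℝ E = Module.finrank ℝ (Fin 11 → ℝ) := by simp [hdim]
  have hne : H 2 2 y₀ ≠ 0 := by rw [h1]; simp
  have hHc : ∀ i j, ContinuousAt (H i j) y₀ := fun i j =>
    ((h.smooth_H i j).contDiffAt (h.isOpen.mem_nhds hyV)).continuousAt
  have ev22 : ∀ᶠ y in nhds y₀, H 2 2 y ≠ 0 := (hHc 2 2).eventually_ne hne
  obtain ⟨V', hV', hV'o, hyV'⟩ := eventually_nhds_iff.1 ev22
  have hW : IsOpen (V ∩ V') := h.isOpen.inter hV'o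
  have hyW : y₀ ∈ V ∩ V' := ⟨hyV, hyV'⟩
  have h' := h.mono hW Set.inter_subset_left
  have h22 : ∀ y ∈ V ∩ V', H 2 2 y ≠ 0 := fun y hy => hV' y hy.2
  have hc0 : rowProduct H 0 1 y₀ = 1 := by simp [rowProduct, h1]
  have ev : ∀ {f : E → ℝ}, ContDiffOn ℝ ∞ f (V ∩ V') → f y₀ ≠ 0 → ∀ᶠ y in nhds y₀, f y ≠ 0 :=
    fun hf hf0 => ((hf.contDiffAt (hW.mem_nhds hyW)).continuousAt).eventually_ne hf0
  have ev11 := ev (h'.smooth_H 1 1) (by rw [h1]; simp)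
  have ev12 := ev (h'.smooth_minor 1 1 2 2 1 2 2 1) (by simp [h1])
  have ev13 := ev (h'.smooth_minor 1 1 3 3 1 3 3 1) (by simp [h1])
  have ev20 := ev (h'.smooth_minor 2 2 0 0 2 0 0 2) (by simp [h1])
  have evs := ev (((h'.smooth_slopeCoeff 0 0).mul (h'.smooth_slopeCoeff 1 1)).sub
    ((h'.smooth_slopeCoeff 0 1).mul (h'.smooth_slopeCoeff 1 0))) (by simp [slopeCoeff, h1])
  have evF : ∀ᶠ y in nhds y₀, (Matrix.of fun i j => solderCoeff H i j y).det ≠ 0 := by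
    have hc : ContinuousAt (fun y => Matrix.of fun i j => solderCoeff H i j y) y₀ :=
      tendsto_pi_nhds.2 fun i => tendsto_pi_nhds.2 fun j =>
        ((h'.smooth_solderCoeff h22 i j).contDiffAt (hW.mem_nhds hyW)).continuousAt
    have hd := (continuous_id.matrix_det
      (A := fun m : Matrix (Fin 3) (Fin 3) ℝ => m)).continuousAt.comp (x := y₀) hc
    refine hd.eventually_ne ?_
    have c0 : Fin.castSucc (0 : Fin 3) = 0 := rfl
    have c1 : Fin.castSucc (1 : Fin 3) = 1 := rfl
    have c2 : Fin.castSucc (2 : Fin 3) = 2 := rfl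
    simp [Matrix.det_fin_three, solderCoeff, conformalInverse, dualIndex, baseSlope, h1, hc0, c0,
      c1, c2]
    have one : ∀ i : Fin 4, (1 : Matrix (Fin 4) (Fin 4) ℝ) i i ≠ 0 := by simp
    exact ⟨⟨one 1, one 0⟩, one 3⟩
  have hXd := h.dX y₀ hyV
  have chart1 : ∃ e : OpenPartialHomeomorph E (Fin 11 → ℝ), y₀ ∈ e.source ∧
      ⇑e = conformalCoords H X := by
    have hs := h.smooth_conformalCoords.contDiffAt (h.isOpen.mem_nhds hyV)
    have hd := (hs.differentiableAt (by simp)).hasFDerivAt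
    refine exists_chart_of_injective_fderiv hdim' hs hd fun v hv => ?_
    have hz := fun i => congrFun hv i
    have x0 := (hasFDerivAt_pi_component hd 0 (hXd 0) v).symm.trans (hz 0)
    have x1 := (hasFDerivAt_pi_component hd 1 (hXd 1) v).symm.trans (hz 1)
    have x2 := (hasFDerivAt_pi_component hd 2 (hXd 2) v).symm.trans (hz 2)
    have x3 := (hasFDerivAt_pi_component hd 3 (hXd 3) v).symm.trans (hz 3)
    have m11 := (hasFDerivAt_pi_component hd 4 (h.dH1 y₀ hyV 1) v).symm.trans (hz 4)
    have m12 := (hasFDerivAt_pi_component hd 5 (h.dH2 y₀ hyV 1) v).symm.trans (hz 5)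
    have m13 := (hasFDerivAt_pi_component hd 6 (h.dH3 y₀ hyV 1) v).symm.trans (hz 6)
    have m21 := (hasFDerivAt_pi_component hd 7 (h.dH1 y₀ hyV 2) v).symm.trans (hz 7)
    have m22 := (hasFDerivAt_pi_component hd 8 (h.dH2 y₀ hyV 2) v).symm.trans (hz 8)
    have m31 := (hasFDerivAt_pi_component hd 9 (h.dH1 y₀ hyV 3) v).symm.trans (hz 9)
    have m33 := (hasFDerivAt_pi_component hd 10 (h.dH3 y₀ hyV 3) v).symm.trans (hz 10)
    simp [h1, Fin.sum_univ_four] at x0 x1 x2 x3 m11 m12 m13 m21 m22 m31 m33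
    -- At H = 1 the entries (2,2) and (3,3) contribute `-Ω 5 + A/2` and `Ω 5 + A/2`, whose sum is A;
    -- the other entries then give the single Ω's.
    have hA0 : A y₀ v = 0 := by linarith
    refine hframe y₀ hy₀ v (fun i => ?_) (fun i => ?_) hA0
    · fin_cases i <;> assumption
    · fin_cases i <;> simp <;> linarith
  have chart2 : ∃ e : OpenPartialHomeomorph E (Fin 11 → ℝ), y₀ ∈ e.source ∧
      ⇑e = affineCoords H X := by
    have hs := (h'.smooth_affineCoords h22).contDiffAt (hW.mem_nhds hyW)
    have hd := (hs.differentiableAt (by simp)).hasFDerivAt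
    refine exists_chart_of_injective_fderiv hdim' hs hd fun v hv => ?_
    have hz := fun i => congrFun hv i
    have s0 := (hasFDerivAt_pi_component hd 0 (h.hasFDerivAt_slope hyV hne 0) v).symm.trans (hz 0)
    have s1 := (hasFDerivAt_pi_component hd 1 (h.hasFDerivAt_slope hyV hne 1) v).symm.trans (hz 1)
    have x3 := (hasFDerivAt_pi_component hd 2 (hXd 3) v).symm.trans (hz 2)
    have x0 := (hasFDerivAt_pi_component hd 3 (hXd 0) v).symm.trans (hz 3)
    have x1 := (hasFDerivAt_pi_component hd 4 (hXd 1) v).symm.trans (hz 4)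
    have x2 := (hasFDerivAt_pi_component hd 5 (hXd 2).neg v).symm.trans (hz 5)
    simp [h1, Fin.sum_univ_four, slopeCoeff] at s0 s1 x0 x1 x2 x3
    obtain ⟨p', hp, hpv⟩ := h.hasFDerivAt_fibreP hyV
    obtain ⟨q', hq, hqv⟩ := h.hasFDerivAt_fibreQ hyV
    obtain ⟨r', hr, hrv⟩ := h.hasFDerivAt_fibreP' hyV
    obtain ⟨t', ht, htv⟩ := h.hasFDerivAt_fibreQ' hyV
    have k0 := (hasFDerivAt_pi_component hd 6 hp v).symm.trans (hz 6)
    have k1 := (hasFDerivAt_pi_component hd 7 hq v).symm.trans (hz 7)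
    have k2 := (hasFDerivAt_pi_component hd 8 hr v).symm.trans (hz 8)
    have k3 := (hasFDerivAt_pi_component hd 9 ht v).symm.trans (hz 9)
    have k4 := (hasFDerivAt_pi_component hd 10 (h.hasFDerivAt_rowProduct hyV 0 1) v).symm.trans
      (hz 10)
    -- The differentials of the fibre coordinates are known only on vectors killed by `Ω 1` and `Ω
    -- 2`; the two slope coordinates have just supplied this for v.
    rw [hpv v s0 s1] at k0
    rw [hqv v s0 s1] at k1
    rw [hrv v s0 s1] at k2
    rw [htv v s0 s1] at k3
    simp [h1, hc0, fibreP, fibreP'] at k0 k1 k2 k3 k4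
    refine hframe y₀ hy₀ v (fun i => ?_) (fun i => ?_) k4
    · fin_cases i <;> assumption
    · fin_cases i <;> simp <;> linarith
  obtain ⟨e₁, he₁, hc₁⟩ := chart1
  obtain ⟨e₂, he₂, hc₂⟩ := chart2
  obtain ⟨T, hT, hTo, hyT⟩ := eventually_nhds_iff.1
    (ev11.and (ev12.and (ev13.and (ev20.and (evs.and evF)))))
  have hUo : IsOpen ((V ∩ V') ∩ T ∩ (e₁.source ∩ e₂.source)) :=
    (hW.inter hTo).inter (e₁.open_source.inter e₂.open_source)
  refine ⟨(V ∩ V') ∩ T ∩ (e₁.source ∩ e₂.source), H, X, fun y hy => hVO hy.1.1.1,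
    ⟨⟨hyW, hyT⟩, he₁, he₂⟩, { h'.mono hUo (fun y hy => hy.1.1) with
      frame := fun y hy => hframe y (hVO hy.1.1.1)
      ne11 := fun y hy => (hT y hy.1.2).1
      ne22 := fun y hy => h22 y hy.1.1
      minor12 := fun y hy => (hT y hy.1.2).2.1
      minor13 := fun y hy => (hT y hy.1.2).2.2.1
      minor20 := fun y hy => (hT y hy.1.2).2.2.2.1
      slope_det := fun y hy => (hT y hy.1.2).2.2.2.2.1
      solder_det := fun y hy => (hT y hy.1.2).2.2.2.2.2
      conformal_chart := ⟨e₁, fun y hy => hy.2.1, hc₁⟩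
      affine_chart := ⟨e₂, fun y hy => hy.2.2, hc₂⟩ }⟩

end Trivialization

/-! ### Coframes and common kernels -/

section Coframes

variable {E : Type*} [NormedAddCommGroup E] [NormedSpace ℝ E]

/-- The joint evaluation map is injective between spaces of equal dimension, hence surjective. -/
theorem exists_eq_of_kernel [FiniteDimensional ℝ E] {ι : Type*} [Fintype ι] {η : ι → E →L[ℝ] ℝ}
    (hcard : Fintype.card ι = Module.finrank ℝ E) (hη : ∀ v, (∀ i, η i v = 0) → v = 0)
    (c : ι → ℝ) : ∃ v, ∀ i, η i v = c i := by
  have hinj : Function.Injective (LinearMap.pi fun i => (η i).toLinearMap) :=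
    (injective_iff_map_eq_zero _).2 fun v hv => hη v fun i => congrFun hv i
  obtain ⟨v, hv⟩ := (LinearMap.injective_iff_surjective_of_finrank_eq_finrank
    (by simp [hcard])).1 hinj c
  exact ⟨v, fun i => congrFun hv i⟩

theorem basis_of_kernel [FiniteDimensional ℝ E] {ι : Type*} [Fintype ι] {η : ι → E →L[ℝ] ℝ}
    (hcard : Fintype.card ι = Module.finrank ℝ E) (hη : ∀ v, (∀ i, η i v = 0) → v = 0) :
    LinearIndependent ℝ η ∧ Submodule.span ℝ (Set.range η) = ⊤ := by
  classical
  have hli : LinearIndependent ℝ η := by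
    rw [Fintype.linearIndependent_iff]
    intro c hc i
    obtain ⟨v, hv⟩ := exists_eq_of_kernel hcard hη (Pi.single i 1)
    have := DFunLike.congr_fun hc v
    simpa [hv, sum_apply, Pi.single_apply] using this
  refine ⟨hli, hli.span_eq_top_of_card_eq_finrank' ?_⟩
  rw [hcard, ← Subspace.dual_finrank_eq]
  exact (LinearMap.toContinuousLinearMap (𝕜 := ℝ) (E := E) (F' := ℝ)).finrank_eq

/-- A norming functional of v (Hahn–Banach) lies in the span of covectors that vanish at v, so the
norm of v is 0. -/
theorem eq_zero_of_span_eq_top {ι : Type*} {η : ι → E →L[ℝ] ℝ}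
    (h : Submodule.span ℝ (Set.range η) = ⊤) {v : E} (hv : ∀ i, η i v = 0) : v = 0 := by
  by_contra h0
  obtain ⟨f, -, hf⟩ := exists_dual_vector ℝ v (norm_ne_zero_iff.2 h0)
  have hmem : f ∈ Submodule.span ℝ (Set.range η) := h ▸ Submodule.mem_top
  have hz : f v = 0 := by
    refine Submodule.span_induction (p := fun g _ => g v = 0) ?_ (by simp) ?_ ?_ hmem
    · rintro _ ⟨i, rfl⟩; exact hv i
    · intro a b _ _ ha hb; simp [ha, hb]
    · intro a b _ hb; simp [hb]
  rw [hz] at hf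
  exact h0 (norm_eq_zero.1 (by exact_mod_cast hf.symm))

theorem IsCoframe.eq_zero {M : Type*} [TopologicalSpace M] [ChartedSpace E M] {ι : Type*}
    {η : ι → OneForm E M} (h : IsCoframe η) {p : M} {v : TangentSpace 𝓘(ℝ, E) p}
    (hv : ∀ i, η i p v = 0) : v = 0 :=
  eq_zero_of_span_eq_top (E := E) (η := fun i => η i p) (h p).2 hv

end Coframes

/-! ### The flat para-CR structure -/

section FlatModel

theorem coordForm_smooth {n : ℕ} (i : Fin n) : (coordForm i).Smooth :=
  OneForm.smooth_of_contDiff contDiff_const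

theorem OneForm.d_of_hasFDerivAt {E : Type*} [NormedAddCommGroup E] [NormedSpace ℝ E]
    {η : OneForm E E} {α : E → E →L[ℝ] ℝ} (hα : ContDiff ℝ ∞ α) (hη : η = α) {p : E}
    {α' : E →L[ℝ] E →L[ℝ] ℝ} (h : HasFDerivAt α α' p) (v w : E) :
    η.d p v w = α' v w - α' w v := by
  subst hη
  rw [← h.fderiv]
  exact OneForm.d_modelSpace hα p v w

theorem coordForm_d {n : ℕ} (i : Fin n) (p v w : EuclideanSpace ℝ (Fin n)) :
    (coordForm i).d p v w = 0 :=
  (OneForm.d_of_hasFDerivAt contDiff_const rfl (hasFDerivAt_const _ p) v w).trans (by simp)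

theorem isCoframe_coordForm {n : ℕ} : IsCoframe (coordForm (n := n)) := fun p =>
  basis_of_kernel (E := EuclideanSpace ℝ (Fin n)) (η := fun i => coordForm i p) (by simp)
    fun v hv => by ext i; exact hv i

theorem flatModel_mu (i : Fin 2) : flatModel.mu i = coordForm (![0, 1] i) := by
  fin_cases i <;> rfl

theorem flatModel_nu (i : Fin 3) : flatModel.nu i = coordForm (![3, 4, 5] i) := by
  fin_cases i <;> rfl

theorem flatModel_lam_contDiff (i : Fin 1) :
    ContDiff ℝ ∞ (show EuclideanSpace ℝ (Fin 6) → EuclideanSpace ℝ (Fin 6) →L[ℝ] ℝ from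
      flatModel.lam i) := by
  have hp := fun j : Fin 6 => (EuclideanSpace.proj j : EuclideanSpace ℝ (Fin 6) →L[ℝ] ℝ).contDiff
    (n := ∞)
  exact ((contDiff_const.add ((hp 0).smul contDiff_const)).add ((hp 1).smul contDiff_const)).add
    (((hp 0).mul (hp 1)).smul contDiff_const)

/-- This is dλ = dx∧da₁ + dy∧da₂ + (x dy + y dx)∧da₃. Every term pairs one of dx, dy with one of the
daᵢ, which makes both distributions integrable. -/
theorem flatModel_lam_d (i : Fin 1) (q v w : EuclideanSpace ℝ (Fin 6)) :
    (flatModel.lam i).d q v w =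
      (v 0 * w 3 + v 1 * w 4 + (q 0 * v 1 + q 1 * v 0) * w 5)
      - (w 0 * v 3 + w 1 * v 4 + (q 0 * w 1 + q 1 * w 0) * v 5) := by
  set π := fun j : Fin 6 => (EuclideanSpace.proj j : EuclideanSpace ℝ (Fin 6) →L[ℝ] ℝ) with hπ
  have hp := fun j : Fin 6 => (π j).hasFDerivAt (x := q)
  have h := ((((hasFDerivAt_const (π 2) q).add ((hp 0).smul (hasFDerivAt_const (π 3) q))).add
    ((hp 1).smul (hasFDerivAt_const (π 4) q))).add
    (((hp 0).mul (hp 1)).smul (hasFDerivAt_const (π 5) q)))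
  refine (OneForm.d_of_hasFDerivAt (flatModel_lam_contDiff i) rfl h v w).trans ?_
  simp [hπ]

theorem flatModel_lam_d_minus (i : Fin 1) (q v w : EuclideanSpace ℝ (Fin 6)) (v0 : v 0 = 0)
    (w0 : w 0 = 0) (v1 : v 1 = 0) (w1 : w 1 = 0) : (flatModel.lam i).d q v w = 0 := by
  refine (flatModel_lam_d i q v w).trans ?_
  rw [v0, w0, v1, w1]
  ring

theorem flatModel_lam_d_plus (i : Fin 1) (q v w : EuclideanSpace ℝ (Fin 6)) (v3 : v 3 = 0)
    (w3 : w 3 = 0) (v4 : v 4 = 0) (w4 : w 4 = 0) (v5 : v 5 = 0) (w5 : w 5 = 0) :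
    (flatModel.lam i).d q v w = 0 := by
  refine (flatModel_lam_d i q v w).trans ?_
  rw [v3, w3, v4, w4, v5, w5]
  ring

theorem flatModel_isParaCR : IsParaCR flatModel where
  smooth_lam i := OneForm.smooth_of_contDiff (flatModel_lam_contDiff i)
  smooth_mu i := by rw [flatModel_mu]; exact coordForm_smooth _
  smooth_nu i := by rw [flatModel_nu]; exact coordForm_smooth _
  coframe := fun p => basis_of_kernel (E := EuclideanSpace ℝ (Fin 6))
    (η := fun i => (Sum.elim flatModel.lam (Sum.elim flatModel.mu flatModel.nu) i) p)
    (by simp) fun v hv => by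
      have h0 : v 0 = 0 := hv (.inr (.inl 0))
      have h1 : v 1 = 0 := hv (.inr (.inl 1))
      have h3 : v 3 = 0 := hv (.inr (.inr 0))
      have h4 : v 4 = 0 := hv (.inr (.inr 1))
      have h5 : v 5 = 0 := hv (.inr (.inr 2))
      have h2 : v 2 + p 0 * v 3 + p 1 * v 4 + p 0 * p 1 * v 5 = 0 := hv (.inl 0)
      simp only [h3, h4, h5, mul_zero, add_zero] at h2
      ext i
      fin_cases i <;> assumption
  integrable_minus p v w _ hm := ⟨fun i => flatModel_lam_d_minus i p v w (hm 0).1 (hm 0).2 (hm 1).1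
    (hm 1).2, fun i => by rw [flatModel_mu]; exact coordForm_d _ _ _ _⟩
  integrable_plus p v w _ hn := ⟨fun i => flatModel_lam_d_plus i p v w (hn 0).1 (hn 0).2 (hn 1).1
    (hn 1).2 (hn 2).1 (hn 2).2, fun i => by rw [flatModel_nu]; exact coordForm_d _ _ _ _⟩

theorem flatModel_isFlat : flatModel.IsFlat := by
  intro q
  refine ⟨OpenPartialHomeomorph.refl _, trivial, contMDiffOn_id, contMDiffOn_id, fun _ => 1,
    fun _ => 0, fun _ => 0, fun _ => 1, fun _ => 1, fun p _ => ⟨by simp, fun v => ?_⟩⟩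
  have hv := mfderiv_refl_apply p v
  refine ⟨fun i => ?_, fun i => ?_, fun i => ?_⟩
  · simp only [Matrix.one_apply, ite_mul, one_mul, zero_mul, Finset.sum_ite_eq,
      Finset.mem_univ, if_true]
    exact congrArg (flatModel.lam i p) hv
  · simp only [Matrix.one_apply, ite_mul, one_mul, zero_mul, Finset.sum_ite_eq,
      Finset.mem_univ, if_true, Matrix.zero_apply, Finset.sum_const_zero, add_zero]
    exact congrArg (flatModel.mu i p) hv
  · simp only [Matrix.one_apply, ite_mul, one_mul, zero_mul, Finset.sum_ite_eq,
      Finset.mem_univ, if_true, Matrix.zero_apply, Finset.sum_const_zero, add_zero]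
    exact congrArg (flatModel.nu i p) hv

end FlatModel

/-! ### Uniqueness of the connection forms -/

section Uniqueness

variable {E : Type*} [NormedAddCommGroup E] [NormedSpace ℝ E]

/-- The algebraic part of the uniqueness of the connection forms: `δ₁, δ₄, δ₅, δ₆, δA` are the
differences of two solutions, and `η` is the coframe `(θ¹, …, θ⁴, Ω₂, Ω₃)`. -/
theorem connection_difference_eq_zero {η : Fin 6 → E →L[ℝ] ℝ} {δ₁ δ₄ δ₅ δ₆ δA : E →L[ℝ] ℝ}
    {u : Fin 6 → E} (hu : ∀ i j, η i (u j) = (1 : Matrix (Fin 6) (Fin 6) ℝ) i j)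
    (h1 : ∀ v w, wedgeCov (δ₁ - (1 / 2 : ℝ) • δA) (η 0) v w - wedgeCov δ₅ (η 3) v w = 0)
    (h2 : ∀ v w, wedgeCov (-δ₁ - (1 / 2 : ℝ) • δA) (η 1) v w - wedgeCov δ₄ (η 3) v w = 0)
    (h3 : ∀ v w, wedgeCov δ₄ (η 0) v w + wedgeCov δ₅ (η 1) v w
      + wedgeCov (δ₆ - (1 / 2 : ℝ) • δA) (η 2) v w = 0)
    (h4 : ∀ v w, wedgeCov (-δ₆ - (1 / 2 : ℝ) • δA) (η 3) v w = 0)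
    (h5 : ∀ v w, wedgeCov (η 4) (δ₁ + δ₆) v w = 0)
    (h6 : ∀ v w, wedgeCov (δ₁ - δ₆) (η 5) v w = 0) :
    δ₁ = 0 ∧ δ₄ = 0 ∧ δ₅ = 0 ∧ δ₆ = 0 ∧ δA = 0 := by
  simp only [wedgeCov, add_apply, sub_apply, neg_apply, smul_apply, smul_eq_mul]
    at h1 h2 h3 h4 h5 h6
  -- Cartan's lemma for one form: α∧η = 0 with η ≠ 0 forces α to be a multiple of η. The factor is
  -- read off by inserting the dual vector.
  obtain ⟨s, hs⟩ : ∃ s, ∀ v, δ₆ v + δA v / 2 = s * η 3 v := by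
    refine ⟨δ₆ (u 3) + δA (u 3) / 2, fun v => ?_⟩
    have := h4 v (u 3)
    simp [hu] at this
    linear_combination -this
  obtain ⟨t, ht⟩ : ∃ t, ∀ v, δ₁ v + δ₆ v = t * η 4 v := by
    refine ⟨δ₁ (u 4) + δ₆ (u 4), fun v => ?_⟩
    have := h5 (u 4) v
    simp [hu] at this
    linear_combination this
  obtain ⟨r, hr⟩ : ∃ r, ∀ v, δ₁ v - δ₆ v = r * η 5 v := by
    refine ⟨δ₁ (u 5) - δ₆ (u 5), fun v => ?_⟩
    have := h6 v (u 5)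
    simp [hu] at this
    linear_combination this
  -- The η₄∧η₀ component of the first equation gives δ₁ = δA/2 on u₄, while δ₆ = -δA/2 there. So δ₁
  -- + δ₆ vanishes on u₄, where it equals t.
  have t0 : t = 0 := by
    have e := h1 (u 4) (u 0)
    have f1 := hs (u 4)
    have f2 := ht (u 4)
    simp [hu] at e f1 f2
    linarith
  have r0 : r = 0 := by
    have e := h2 (u 5) (u 1)
    have f1 := hs (u 5)
    have f2 := hr (u 5)
    simp [hu] at e f1 f2
    linarith
  subst t0 r0
  have d1 : ∀ v, δ₁ v = 0 := fun v => by linarith [ht v, hr v]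
  have d6 : ∀ v, δ₆ v = 0 := fun v => by linarith [ht v, hr v]
  simp only [d1, d6] at h1 h2 h3 hs
  have hA : ∀ v, δA v = 2 * s * η 3 v := fun v => by linarith [hs v]
  have d5 : ∀ v, δ₅ v = s * η 0 v + δ₅ (u 3) * η 3 v := fun v => by
    have e := h1 v (u 3)
    simp [hu, hA] at e
    linear_combination -e
  have d4 : ∀ v, δ₄ v = s * η 1 v + δ₄ (u 3) * η 3 v := fun v => by
    have e := h2 v (u 3)
    simp [hu, hA] at e
    linear_combination -e
  -- In the third equation the two terms ± s η₀∧η₁ cancel; what remains is independent and consists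
  -- of s η₂∧η₃ and the coefficients of η₃∧η₀ and η₃∧η₁.
  have s0 : s = 0 := by
    have e := h3 (u 3) (u 2)
    rw [d4 (u 2), d5 (u 2), hA, hA] at e
    simpa [hu] using e
  subst s0
  have e4 : δ₄ (u 3) = 0 := by
    have e := h3 (u 3) (u 0)
    rw [d4 (u 0), d5 (u 0), hA, hA] at e
    simpa [hu] using e
  have e5 : δ₅ (u 3) = 0 := by
    have e := h3 (u 3) (u 1)
    rw [d4 (u 1), d5 (u 1), hA, hA] at e
    simpa [hu] using e
  refine ⟨?_, ?_, ?_, ?_, ?_⟩ <;> ext v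
  · exact d1 v
  · simp [d4 v, e4]
  · simp [d5 v, e5]
  · exact d6 v
  · simp [hA v]

/-- Two connections with the same values of the six differentials coincide. -/
theorem connection_eq {t : Fin 4 → E →L[ℝ] ℝ} {o o' : Fin 6 → E →L[ℝ] ℝ} {a a' : E →L[ℝ] ℝ}
    {u : Fin 6 → E} (hu : ∀ i j, ![t 0, t 1, t 2, t 3, o 1, o 2] i (u j)
      = (1 : Matrix (Fin 6) (Fin 6) ℝ) i j) (e1 : o' 1 = o 1) (e2 : o' 2 = o 2)
    (h1 : ∀ v w, wedgeCov (o 0 - (1 / 2 : ℝ) • a) (t 0) v w - wedgeCov (o 2) (t 2) v w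
        - wedgeCov (o 4) (t 3) v w
      = wedgeCov (o' 0 - (1 / 2 : ℝ) • a') (t 0) v w - wedgeCov (o' 2) (t 2) v w
        - wedgeCov (o' 4) (t 3) v w)
    (h2 : ∀ v w, wedgeCov (-o 0 - (1 / 2 : ℝ) • a) (t 1) v w - wedgeCov (o 1) (t 2) v w
        - wedgeCov (o 3) (t 3) v w
      = wedgeCov (-o' 0 - (1 / 2 : ℝ) • a') (t 1) v w - wedgeCov (o' 1) (t 2) v w
        - wedgeCov (o' 3) (t 3) v w)
    (h3 : ∀ v w, wedgeCov (o 3) (t 0) v w + wedgeCov (o 4) (t 1) v w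
        + wedgeCov (o 5 - (1 / 2 : ℝ) • a) (t 2) v w
      = wedgeCov (o' 3) (t 0) v w + wedgeCov (o' 4) (t 1) v w
        + wedgeCov (o' 5 - (1 / 2 : ℝ) • a') (t 2) v w)
    (h4 : ∀ v w, wedgeCov (o 1) (t 0) v w + wedgeCov (o 2) (t 1) v w
        + wedgeCov (-o 5 - (1 / 2 : ℝ) • a) (t 3) v w
      = wedgeCov (o' 1) (t 0) v w + wedgeCov (o' 2) (t 1) v w
        + wedgeCov (-o' 5 - (1 / 2 : ℝ) • a') (t 3) v w)
    (h5 : ∀ v w, wedgeCov (o 1) (o 0 + o 5) v w = wedgeCov (o' 1) (o' 0 + o' 5) v w)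
    (h6 : ∀ v w, wedgeCov (o 0 - o 5) (o 2) v w = wedgeCov (o' 0 - o' 5) (o' 2) v w) :
    (∀ i, o' i = o i) ∧ a' = a := by
  simp only [e1, e2, wedgeCov, add_apply, sub_apply, neg_apply, smul_apply, smul_eq_mul]
    at h1 h2 h3 h4 h5 h6
  have key := connection_difference_eq_zero (δ₁ := o' 0 - o 0) (δ₄ := o' 3 - o 3)
    (δ₅ := o' 4 - o 4) (δ₆ := o' 5 - o 5) (δA := a' - a) hu
    (fun v w => by simp [wedgeCov]; linear_combination -h1 v w)
    (fun v w => by simp [wedgeCov]; linear_combination -h2 v w)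
    (fun v w => by simp [wedgeCov]; linear_combination -h3 v w)
    (fun v w => by simp [wedgeCov]; linear_combination -h4 v w)
    (fun v w => by simp [wedgeCov]; linear_combination -h5 v w)
    (fun v w => by simp [wedgeCov]; linear_combination -h6 v w)
  simp only [sub_eq_zero] at key
  obtain ⟨k0, k3, k4, k5, kA⟩ := key
  refine ⟨fun i => ?_, kA⟩
  fin_cases i <;> assumption

variable {M : Type*} [TopologicalSpace M] [ChartedSpace E M]

/-- The connection forms are determined by the six forms of the base. -/
theorem FlatSystemOn.connection_unique [FiniteDimensional ℝ E] (hdim : Module.finrank ℝ E = 11)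
    {U : Set M} (hU : IsOpen U)
    {θ : Fin 4 → OneForm E M} {Ω Ω' : Fin 6 → OneForm E M} {A A' : OneForm E M}
    (hcoframe : IsCoframe (Sum.elim θ (Sum.elim Ω fun _ : Unit => A)))
    (hs : FlatSystemOn U θ Ω A) (hs' : FlatSystemOn U θ Ω' A')
    (heq : ∀ p ∈ U, Ω' 1 p = Ω 1 p ∧ Ω' 2 p = Ω 2 p) {p : M} (hp : p ∈ U) :
    (∀ i, Ω' i p = Ω i p) ∧ A' p = A p := by
  have hex := exists_eq_of_kernel (E := E)
    (η := fun i => Sum.elim θ (Sum.elim Ω fun _ : Unit => A) i p) (by simp [hdim])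
    (fun v hv => hcoframe.eq_zero (v := v) hv)
  choose w hw using hex
  let ι : Fin 6 → Fin 4 ⊕ Fin 6 ⊕ Unit :=
    ![.inl 0, .inl 1, .inl 2, .inl 3, .inr (.inl 1), .inr (.inl 2)]
  have hι : Function.Injective ι := by decide
  -- The two systems share the differentials of θ literally; those of `Ω 1` and `Ω 2` agree because
  -- the forms agree on the whole open set U.
  have hd1 : (Ω' 1).d p = (Ω 1).d p := OneForm.d_congr hU (fun q hq => (heq q hq).1) hp
  have hd2 : (Ω' 2).d p = (Ω 2).d p := OneForm.d_congr hU (fun q hq => (heq q hq).2) hp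
  have happ : ∀ {f g : TangentSpace 𝓘(ℝ, E) p → TangentSpace 𝓘(ℝ, E) p → ℝ}, f = g →
    ∀ v w, f v w = g v w := fun h v w => by rw [h]
  refine connection_eq (E := E) (t := fun i => θ i p) (o := fun i => Ω i p) (o' := fun i => Ω' i p)
    (a := A p) (a' := A' p) (u := fun j => w (Pi.single (ι j) 1)) (fun i j => ?_) (heq p hp).1
    (heq p hp).2 (happ ((hs.dθ1 p hp).symm.trans (hs'.dθ1 p hp)))
    (happ ((hs.dθ2 p hp).symm.trans (hs'.dθ2 p hp)))
    (happ ((hs.dθ3 p hp).symm.trans (hs'.dθ3 p hp)))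
    (happ ((hs.dθ4 p hp).symm.trans (hs'.dθ4 p hp)))
    (happ (((hs.dΩ2 p hp).symm.trans hd1.symm).trans (hs'.dΩ2 p hp)))
    (happ (((hs.dΩ3 p hp).symm.trans hd2.symm).trans (hs'.dΩ3 p hp)))
  have h1 := hw (Pi.single (ι j) 1) (ι i)
  have h2 : (Pi.single (ι j) 1 : Fin 4 ⊕ Fin 6 ⊕ Unit → ℝ) (ι i)
      = (1 : Matrix (Fin 6) (Fin 6) ℝ) i j := by
    simp [Pi.single_apply, Matrix.one_apply, hι.eq_iff]
  rw [h2] at h1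
  rw [← h1]
  fin_cases i <;> rfl

end Uniqueness

/-! ### Principal bundles in a chart -/

section Bundles

/-- The topology on the units also requires continuity of the inverse, which Cramer's rule provides.
-/
theorem continuous_generalLinear {Y : Type*} [TopologicalSpace Y] {n : Type*} [Fintype n]
    [DecidableEq n] {f : Y → GL n ℝ} (hf : ∀ i j, Continuous fun y => f y i j) :
    Continuous f := by
  have hv : Continuous fun y => (f y).val :=
    continuous_pi fun i => continuous_pi fun j => hf i j
  refine Units.continuous_iff.2 ⟨hv, ?_⟩
  have h1 : (fun y => ((f y)⁻¹ : GL n ℝ).val) = fun y => (f y).val.det⁻¹ • (f y).val.adjugate := by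
    funext y
    rw [Matrix.coe_units_inv, Matrix.inv_def, Ring.inverse_eq_inv']
  rw [h1]
  refine (hv.matrix_det.inv₀ fun y => ?_).smul hv.matrix_adjugate
  exact ((Matrix.isUnit_iff_isUnit_det _).1 (f y).isUnit).ne_zero

variable {E : Type*} [NormedAddCommGroup E] [NormedSpace ℝ E]
  {M : Type*} [TopologicalSpace M] [ChartedSpace E M]

theorem continuous_bundleMap {F : Type*} [NormedAddCommGroup F] [NormedSpace ℝ F]
    {n : Type*} [Fintype n] [DecidableEq n] {G : Subgroup (GL n ℝ)} {U : Set M} {π : M → F}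
    {g : M → GL n ℝ} (hπ : ContMDiffOn 𝓘(ℝ, E) 𝓘(ℝ, F) ∞ π U)
    (hg : ∀ i j, ContMDiffOn 𝓘(ℝ, E) 𝓘(ℝ, ℝ) ∞ (fun p => g p i j) U) (hm : ∀ p ∈ U, g p ∈ G) :
    Continuous (fun p : U => ((π p, ⟨g p, hm p p.2⟩) : F × G)) := by
  refine (continuousOn_iff_continuous_domRestrict.1 hπ.continuousOn).prodMk
    (Continuous.subtype_mk ?_ _)
  exact continuous_generalLinear fun i j =>
    continuousOn_iff_continuous_domRestrict.1 (hg i j).continuousOn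

theorem hasFDerivAt_toLp_pi {n : ℕ} {f : Fin n → E → ℝ} {f' : Fin n → E →L[ℝ] ℝ} {y : E}
    (h : ∀ i, HasFDerivAt (f i) (f' i) y) :
    HasFDerivAt (fun z => WithLp.toLp 2 (fun i => f i z) : E → EuclideanSpace ℝ (Fin n))
      ((EuclideanSpace.equiv (Fin n) ℝ).symm.toContinuousLinearMap.comp
        (ContinuousLinearMap.pi f')) y :=
  (EuclideanSpace.equiv (Fin n) ℝ).symm.toContinuousLinearMap.hasFDerivAt.comp y
    (hasFDerivAt_pi.2 h)

theorem contDiffOn_toLp_pi {n : ℕ} {f : Fin n → E → ℝ} {U : Set E}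
    (h : ∀ i, ContDiffOn ℝ ∞ (f i) U) : ContDiffOn ℝ ∞
      (fun z => WithLp.toLp 2 (fun i => f i z) : E → EuclideanSpace ℝ (Fin n)) U :=
  (EuclideanSpace.equiv (Fin n) ℝ).symm.toContinuousLinearMap.contDiff.comp_contDiffOn
    (contDiffOn_pi.2 h)

variable [IsManifold 𝓘(ℝ, E) ∞ M]

theorem mfderiv_toLp_chart {n : ℕ} {φ : OpenPartialHomeomorph M E} (hφ : φ ∈ atlas E M) {p : M}
    (hp : p ∈ φ.source) {f : Fin n → E → ℝ} {f' : Fin n → E →L[ℝ] ℝ}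
    (h : ∀ i, HasFDerivAt (f i) (f' i) (φ p)) (v : TangentSpace 𝓘(ℝ, E) p) :
    (mfderiv 𝓘(ℝ, E) 𝓘(ℝ, EuclideanSpace ℝ (Fin n))
      ((fun z => WithLp.toLp 2 (fun i => f i z) : E → EuclideanSpace ℝ (Fin n)) ∘ φ) p v)
      = WithLp.toLp 2 fun i => f' i (mfderiv 𝓘(ℝ, E) 𝓘(ℝ, E) φ p v) :=
  mfderiv_comp_chart hφ hp (hasFDerivAt_toLp_pi h) v

/-- Entries of maps built with `toGL` agree with smooth functions of the chart only on an open set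
where the matrix is invertible, so they are differentiated as germs. -/
theorem mvfderiv_of_eqOn {φ : OpenPartialHomeomorph M E} (hφ : φ ∈ atlas E M) {U : Set M}
    (hU : IsOpen U) {f : M → ℝ} {F : E → ℝ} (hf : ∀ q ∈ U, f q = F (φ q)) {p : M} (hpU : p ∈ U)
    (hp : p ∈ φ.source) {F' : E →L[ℝ] ℝ} (hF : HasFDerivAt F F' (φ p))
    (v : TangentSpace 𝓘(ℝ, E) p) :
    mvfderiv 𝓘(ℝ, E) f p v = F' (mfderiv 𝓘(ℝ, E) 𝓘(ℝ, E) φ p v) := by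
  have h1 : f =ᶠ[nhds p] F ∘ φ := by
    filter_upwards [hU.mem_nhds hpU] with q hq using hf q hq
  have h2 : HasMFDerivAt 𝓘(ℝ, E) 𝓘(ℝ, ℝ) f p _ :=
    (hasMFDerivAt_comp_chart hφ hp hF).congr_of_eventuallyEq h1
  exact DFunLike.congr_fun h2.mfderiv v

theorem contMDiffOn_of_eqOn {φ : OpenPartialHomeomorph M E} (hφ : φ ∈ atlas E M) {U : Set E}
    {f : M → ℝ} {F : E → ℝ} (hf : ∀ q ∈ φ.source ∩ φ ⁻¹' U, f q = F (φ q))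
    (hF : ContDiffOn ℝ ∞ F U) : ContMDiffOn 𝓘(ℝ, E) 𝓘(ℝ, ℝ) ∞ f (φ.source ∩ φ ⁻¹' U) :=
  (contMDiffOn_comp_chart hφ hF).congr hf

theorem eq_zero_of_chart {φ : OpenPartialHomeomorph M E} (hφ : φ ∈ atlas E M) {p : M}
    (hp : p ∈ φ.source) {v : TangentSpace 𝓘(ℝ, E) p}
    (hv : (mfderiv 𝓘(ℝ, E) 𝓘(ℝ, E) φ p v : E) = 0) : v = 0 := by
  rw [← mfderiv_symm_mfderiv_chart hφ hp v]
  exact (congrArg (mfderiv 𝓘(ℝ, E) 𝓘(ℝ, E) φ.symm (φ p)) hv).trans (map_zero _)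

variable {θ : Fin 4 → OneForm E M} {Ω : Fin 6 → OneForm E M} {A : OneForm E M}

theorem FlatSystemOn.flatSystemAt_inChart (hθ : ∀ i, (θ i).Smooth) (hΩ : ∀ i, (Ω i).Smooth)
    (hA : A.Smooth) (hs : FlatSystemOn Set.univ θ Ω A) {φ : OpenPartialHomeomorph M E}
    (hφ : φ ∈ atlas E M) {y : E} (hy : y ∈ φ.target) (v w : E) :
    FlatSystemAt (fun i => (θ i).inChart φ) (fun i => (Ω i).inChart φ) (A.inChart φ) y v w := by
  have hd : ∀ {η : OneForm E M}, η.Smooth → ∀ {f}, η.d (φ.symm y) = f →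
      extd (η.inChart φ) y v w = f (mfderiv 𝓘(ℝ, E) 𝓘(ℝ, E) φ.symm y v)
        (mfderiv 𝓘(ℝ, E) 𝓘(ℝ, E) φ.symm y w) := by
    intro η hη f hf
    rw [← hf, OneForm.d_eq_inChart hη hφ (φ.map_target hy), mfderiv_chart_mfderiv_symm hφ hy,
      mfderiv_chart_mfderiv_symm hφ hy, φ.right_inv hy]
    rfl
  exact {
    dθ1 := hd (hθ 0) (hs.dθ1 _ trivial)
    dθ2 := hd (hθ 1) (hs.dθ2 _ trivial)
    dθ3 := hd (hθ 2) (hs.dθ3 _ trivial)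
    dθ4 := hd (hθ 3) (hs.dθ4 _ trivial)
    dΩ1 := hd (hΩ 0) (hs.dΩ1 _ trivial)
    dΩ2 := hd (hΩ 1) (hs.dΩ2 _ trivial)
    dΩ3 := hd (hΩ 2) (hs.dΩ3 _ trivial)
    dΩ4 := hd (hΩ 3) (hs.dΩ4 _ trivial)
    dΩ5 := hd (hΩ 4) (hs.dΩ5 _ trivial)
    dΩ6 := hd (hΩ 5) (hs.dΩ6 _ trivial)
    dA := hd hA (hs.dA _ trivial) }

/-- Every point has a chart in which the flat structure equations are integrated. -/
theorem FlatSystemOn.exists_flatTrivialization [FiniteDimensional ℝ E]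
    (hdim : Module.finrank ℝ E = 11) (hθ : ∀ i, (θ i).Smooth) (hΩ : ∀ i, (Ω i).Smooth)
    (hA : A.Smooth) (hcoframe : IsCoframe (Sum.elim θ (Sum.elim Ω fun _ : Unit => A)))
    (hs : FlatSystemOn Set.univ θ Ω A) (p₀ : M) :
    ∃ (φ : OpenPartialHomeomorph M E) (U : Set E) (H : Fin 4 → Fin 4 → E → ℝ) (X : Fin 4 → E → ℝ),
      φ ∈ atlas E M ∧ p₀ ∈ φ.source ∩ φ ⁻¹' U ∧
      FlatTrivialization U (fun i => (θ i).inChart φ) (fun i => (Ω i).inChart φ) (A.inChart φ)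
        H X := by
  have hφ := chart_mem_atlas E p₀
  obtain ⟨U, H, X, -, hy, h⟩ := _root_.exists_flatTrivialization hdim (chartAt E p₀).open_target
    (fun i => hθ i _ hφ) (fun i => hΩ i _ hφ) (hA _ hφ)
    (fun y hy => hs.flatSystemAt_inChart hθ hΩ hA hφ hy)
    (fun y hy v h1 h2 h3 => by
      have h0 : mfderiv 𝓘(ℝ, E) 𝓘(ℝ, E) (chartAt E p₀).symm y v = 0 := by
        refine hcoframe.eq_zero fun i => ?_
        rcases i with i | i | i
        exacts [h1 i, h2 i, h3]
      rw [← mfderiv_chart_mfderiv_symm hφ hy v]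
      exact (congrArg (mfderiv 𝓘(ℝ, E) 𝓘(ℝ, E) (chartAt E p₀) ((chartAt E p₀).symm y)) h0).trans
        (map_zero _))
    ((chartAt E p₀).map_source (mem_chart_source E p₀))
  exact ⟨chartAt E p₀, U, H, X, hφ, ⟨mem_chart_source E p₀, hy⟩, h⟩

end Bundles

/-! ### The conformal bundle -/

section ConformalBundle

variable {E : Type*} [NormedAddCommGroup E] [NormedSpace ℝ E]
  {M : Type*} [TopologicalSpace M] [ChartedSpace E M] [IsManifold 𝓘(ℝ, E) ∞ M]
  {θ : Fin 4 → OneForm E M} {Ω : Fin 6 → OneForm E M} {A : OneForm E M}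
  {φ : OpenPartialHomeomorph M E} {U : Set E} {H : Fin 4 → Fin 4 → E → ℝ} {X : Fin 4 → E → ℝ}

/-- Replaces a tangent vector by a plain vector w of E on which the chart expressions of all
one-forms take the original values. -/
theorem exists_chartVector (hφ : φ ∈ atlas E M) {p : M} (hp : p ∈ φ.source)
    (v : TangentSpace 𝓘(ℝ, E) p) : ∃ w : E, mfderiv 𝓘(ℝ, E) 𝓘(ℝ, E) φ p v = w ∧
      ∀ η : OneForm E M, η.inChart φ (φ p) w = η p v :=
  ⟨_, rfl, fun η => η.inChart_mfderiv hφ hp v⟩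

theorem FlatTrivialization.eq_zero (h : FlatTrivialization U (fun i => (θ i).inChart φ)
    (fun i => (Ω i).inChart φ) (A.inChart φ) H X) (hφ : φ ∈ atlas E M) {p : M}
    (hp : p ∈ φ.source ∩ φ ⁻¹' U) {v : TangentSpace 𝓘(ℝ, E) p} (h1 : ∀ i, θ i p v = 0)
    (h2 : ∀ i, Ω i p v = 0) (h3 : A p v = 0) : v = 0 := by
  refine eq_zero_of_chart hφ hp.1 (h.frame _ hp.2 _ (fun i => ?_) (fun i => ?_) ?_)
  · exact ((θ i).inChart_mfderiv hφ hp.1 v).trans (h1 i)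
  · exact ((Ω i).inChart_mfderiv hφ hp.1 v).trans (h2 i)
  · exact (A.inChart_mfderiv hφ hp.1 v).trans h3

/-- This is dH = HΓ carried from the chart to the manifold, column by column. -/
theorem FlatIntegral.matDiff_eq (h : FlatIntegral U (fun i => (θ i).inChart φ)
    (fun i => (Ω i).inChart φ) (A.inChart φ) H X) (hφ : φ ∈ atlas E M) {p : M}
    (hp : p ∈ φ.source ∩ φ ⁻¹' U) (v : TangentSpace 𝓘(ℝ, E) p) :
    matDiff (fun q => toGL (valueMatrix H (φ q))) p v
      = valueMatrix H (φ p) * gammaForm Ω A p v := by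
  have hU := φ.isOpen_inter_preimage h.isOpen
  have hval : ∀ i j, ∀ q ∈ φ.source ∩ φ ⁻¹' U,
      (toGL (valueMatrix H (φ q))) i j = H i j (φ q) := fun i j q hq => by
    rw [toGL_val (h.isUnit hq.2)]; rfl
  obtain ⟨w, hw, hη⟩ := exists_chartVector hφ hp.1 v
  have hd := fun i j {F' : E →L[ℝ] ℝ} (hF : HasFDerivAt (H i j) F' (φ p)) =>
    (mvfderiv_of_eqOn hφ hU (hval i j) hp hp.1 hF v).trans (congrArg F' hw)
  have d0 := fun i => hd i 0 (h.dH0 _ hp.2 i)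
  have d1 := fun i => hd i 1 (h.dH1 _ hp.2 i)
  have d2 := fun i => hd i 2 (h.dH2 _ hp.2 i)
  have d3 := fun i => hd i 3 (h.dH3 _ hp.2 i)
  simp only [add_apply, sub_apply, neg_apply, smul_apply, smul_eq_mul, hη] at d0 d1 d2 d3
  ext i j
  simp only [matDiff, Matrix.of_apply]
  fin_cases j
  · refine (d0 i).trans ?_
    simp [Matrix.mul_apply, Fin.sum_univ_four, gammaForm, splitMetric]; ring
  · refine (d1 i).trans ?_
    simp [Matrix.mul_apply, Fin.sum_univ_four, gammaForm, splitMetric]; ring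
  · refine (d2 i).trans ?_
    simp [Matrix.mul_apply, Fin.sum_univ_four, gammaForm, splitMetric]; left; ring
  · refine (d3 i).trans ?_
    simp [Matrix.mul_apply, Fin.sum_univ_four, gammaForm, splitMetric]; left; ring

theorem FlatIntegral.gammaForm_eq (h : FlatIntegral U (fun i => (θ i).inChart φ)
    (fun i => (Ω i).inChart φ) (A.inChart φ) H X) (hφ : φ ∈ atlas E M) {p : M}
    (hp : p ∈ φ.source ∩ φ ⁻¹' U) (v : TangentSpace 𝓘(ℝ, E) p) :
    gammaForm Ω A p v = ((toGL (valueMatrix H (φ p)))⁻¹ : GL (Fin 4) ℝ).val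
      * matDiff (fun q => toGL (valueMatrix H (φ q))) p v := by
  have h1 : ((toGL (valueMatrix H (φ p)))⁻¹ : GL (Fin 4) ℝ).val * (toGL (valueMatrix H (φ p))).val
    = 1 := (toGL (valueMatrix H (φ p))).inv_mul
  rw [h.matDiff_eq hφ hp, ← Matrix.mul_assoc]
  rw [toGL_val (h.isUnit hp.2)] at h1
  rw [h1, Matrix.one_mul]

omit [IsManifold 𝓘(ℝ, E) ∞ M] in
theorem gammaForm_eq_zero {p : M} {v : TangentSpace 𝓘(ℝ, E) p} (h : gammaForm Ω A p v = 0) :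
    (∀ i, Ω i p v = 0) ∧ A p v = 0 := by
  have e := fun i j => congrFun (congrFun h i) j
  have e00 := e 0 0
  have e11 := e 1 1
  have e22 := e 2 2
  have e31 := e 3 1
  have e30 := e 3 0
  have e20 := e 2 0
  have e21 := e 2 1
  simp [gammaForm, splitMetric, Matrix.mul_apply, Fin.sum_univ_four] at e00 e11 e22 e31 e30 e20 e21
  refine ⟨fun i => ?_, by linarith⟩
  fin_cases i <;> simp <;> linarith

/-- The projection of the conformal bundle, with coordinates `X`. -/
def conformalProj (X : Fin 4 → E → ℝ) (z : E) : EuclideanSpace ℝ (Fin 4) :=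
  WithLp.toLp 2 fun i => X i z

theorem FlatIntegral.mfderiv_conformalProj (h : FlatIntegral U (fun i => (θ i).inChart φ)
    (fun i => (Ω i).inChart φ) (A.inChart φ) H X) (hφ : φ ∈ atlas E M) {p : M}
    (hp : p ∈ φ.source ∩ φ ⁻¹' U) (v : TangentSpace 𝓘(ℝ, E) p) :
    mfderiv 𝓘(ℝ, E) 𝓘(ℝ, EuclideanSpace ℝ (Fin 4)) (conformalProj X ∘ φ) p v
      = (WithLp.toLp 2 fun i => ∑ j, H i j (φ p) * θ j p v : EuclideanSpace ℝ (Fin 4)) := by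
  obtain ⟨w, hw, hη⟩ := exists_chartVector hφ hp.1 v
  refine (mfderiv_toLp_chart hφ hp.1 (fun i => h.dX _ hp.2 i) v).trans ?_
  rw [hw]
  simp only [← hη]
  refine congrArg (WithLp.toLp 2) (funext fun i => ?_)
  simp

/-- Coordinates on the product of the base and the conformal group. -/
def conformalGroupCoords (z : EuclideanSpace ℝ (Fin 4) × CO22) : Fin 11 → ℝ :=
  ![z.1 0, z.1 1, z.1 2, z.1 3, z.2.val 1 1, z.2.val 1 2, z.2.val 1 3, z.2.val 2 1, z.2.val 2 2,
    z.2.val 3 1, z.2.val 3 3]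

theorem continuous_entry {n : Type*} [Fintype n] [DecidableEq n] {Y : Type*} [TopologicalSpace Y]
    {G : Subgroup (GL n ℝ)} (i j : n) : Continuous fun z : Y × G => z.2.val i j :=
  Continuous.matrix_elem (A := fun z : Y × G => z.2.val.val)
    (Units.continuous_val.comp (continuous_subtype_val.comp continuous_snd)) i j

theorem continuous_conformalGroupCoords : Continuous conformalGroupCoords := by
  have hb : ∀ i : Fin 4, Continuous fun z : EuclideanSpace ℝ (Fin 4) × CO22 => z.1 i :=
    fun i => (EuclideanSpace.proj (𝕜 := ℝ) i).continuous.comp continuous_fst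
  refine continuous_pi fun i => ?_
  fin_cases i
  exacts [hb 0, hb 1, hb 2, hb 3, continuous_entry 1 1, continuous_entry 1 2, continuous_entry 1 3,
    continuous_entry 2 1, continuous_entry 2 2, continuous_entry 3 1, continuous_entry 3 3]

/-- The domain of the coordinates on the product of the base and the conformal group. -/
def conformalGroupDomain : Set (EuclideanSpace ℝ (Fin 4) × CO22) :=
  {z | z.2.val 1 1 ≠ 0 ∧ z.2.val 1 1 * z.2.val 2 2 - z.2.val 1 2 * z.2.val 2 1 ≠ 0 ∧
    z.2.val 1 1 * z.2.val 3 3 - z.2.val 1 3 * z.2.val 3 1 ≠ 0}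

theorem isOpen_conformalGroupDomain : IsOpen conformalGroupDomain := by
  have hc := fun i j => continuous_entry (Y := EuclideanSpace ℝ (Fin 4)) (G := CO22) i j
  exact (isOpen_ne_fun (hc 1 1) continuous_const).inter
    ((isOpen_ne_fun (((hc 1 1).mul (hc 2 2)).sub ((hc 1 2).mul (hc 2 1))) continuous_const).inter
    (isOpen_ne_fun (((hc 1 1).mul (hc 3 3)).sub ((hc 1 3).mul (hc 3 1))) continuous_const))

/-- Seven entries suffice, in accordance with dim CO(2,2) = 7; the three conditions defining the
domain are those under which the other entries can be recovered. -/
theorem injOn_conformalGroupCoords : Set.InjOn conformalGroupCoords conformalGroupDomain := by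
  rintro ⟨z, g, hg⟩ ⟨n1, n2, n3⟩ ⟨z', g', hg'⟩ - heq
  have e := fun i => congrFun heq i
  obtain ⟨c, hc, hm⟩ := mem_CO22_iff.1 hg
  obtain ⟨c', hc', hm'⟩ := mem_CO22_iff.1 hg'
  have hgg : g = g' := Units.ext (conformal_eq_of_coordinates hc.ne' hc'.ne' hm hm' (e 4) (e 5)
    (e 6) (e 7) (e 8) (e 9) (e 10) n1 n2 n3)
  have hz : z = z' := by
    ext i
    fin_cases i
    exacts [e 0, e 1, e 2, e 3]
  subst hgg hz
  rfl

/-- The base is ℝ⁴ with its coordinate coframe, the projection is X and the group component is H. As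
H is invertible, dX = Hθ and θ have the same kernel, and θ = H⁻¹dX is the soldering form. -/
theorem FlatTrivialization.isLocallyCO22Bundle (h : FlatTrivialization U
    (fun i => (θ i).inChart φ) (fun i => (Ω i).inChart φ) (A.inChart φ) H X)
    (hφ : φ ∈ atlas E M) : IsLocallyCO22Bundle (φ.source ∩ φ ⁻¹' U) θ Ω A := by
  have hU := φ.isOpen_inter_preimage h.isOpen
  have hval : ∀ i j, ∀ q ∈ φ.source ∩ φ ⁻¹' U,
      (toGL (valueMatrix H (φ q))) i j = H i j (φ q) := fun i j q hq => by
    rw [toGL_val (h.isUnit hq.2)]; rfl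
  have hzero : ∀ p ∈ φ.source ∩ φ ⁻¹' U, ∀ v : TangentSpace 𝓘(ℝ, E) p,
      mfderiv 𝓘(ℝ, E) 𝓘(ℝ, EuclideanSpace ℝ (Fin 4)) (conformalProj X ∘ φ) p v = 0 ↔
        ∀ i, θ i p v = 0 := by
    intro p hp v
    rw [h.mfderiv_conformalProj hφ hp]
    constructor
    · intro hv i
      have h0 : ∀ j, ∑ k, H j k (φ p) * θ k p v = 0 := fun j =>
        congrArg (fun z : EuclideanSpace ℝ (Fin 4) => z j) hv
      rw [h.eq_conformalInverse hp.2 (fun j => θ j p v) i]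
      simp [h0]
    · intro hv
      simp only [hv, mul_zero, Finset.sum_const_zero]
      rfl
  have smooth_proj := contMDiffOn_comp_chart hφ (contDiffOn_toLp_pi h.smooth_X)
  have smooth_group := fun i j => contMDiffOn_of_eqOn hφ (hval i j) (h.smooth_H i j)
  have mem : ∀ p ∈ φ.source ∩ φ ⁻¹' U, toGL (valueMatrix H (φ p)) ∈ CO22 := fun p hp =>
    mem_CO22_iff.2 ⟨_, h.pos _ hp.2, by
      rw [toGL_val (h.isUnit hp.2)]; exact h.column_metric hp.2⟩
  obtain ⟨e, he, hec⟩ := h.conformal_chart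
  refine ⟨EuclideanSpace ℝ (Fin 4), inferInstance, inferInstance, inferInstance, inferInstance,
    inferInstance, conformalProj X ∘ φ, fun p => toGL (valueMatrix H (φ p)), coordForm, ?_,
    coordForm_smooth, isCoframe_coordForm, fun p hp v => ⟨hzero p hp v, h.gammaForm_eq hφ hp v, ?_⟩⟩
  · refine ⟨hU, smooth_proj, smooth_group, mem, fun p hp v hv hv' => ?_, ?_, fun p hp v _ =>
      h.gammaForm_eq hφ hp v⟩
    · have h1 := h.gammaForm_eq hφ hp v
      rw [hv', Matrix.mul_zero] at h1
      have h2 := gammaForm_eq_zero h1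
      exact h.eq_zero hφ hp ((hzero p hp v).1 hv) h2.1 h2.2
    · refine isOpenEmbedding_of_coordinates hU (φ.trans e) (fun p hp => ?_)
        (continuous_bundleMap smooth_proj smooth_group mem) isOpen_conformalGroupDomain
        continuous_conformalGroupCoords.continuousOn injOn_conformalGroupCoords (fun p => ?_)
        fun p => ?_
      · rw [OpenPartialHomeomorph.trans_source]
        exact ⟨hp.1, he hp.2⟩
      · have hv := fun i j => hval i j p p.2
        simp only [conformalGroupDomain, Set.mem_ofPred_eq, hv]
        exact ⟨h.ne11 _ p.2.2, h.minor12 _ p.2.2, h.minor13 _ p.2.2⟩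
      · have hv := fun i j => hval i j p p.2
        rw [OpenPartialHomeomorph.coe_trans, hec]
        simp only [conformalGroupCoords, hv]
        rfl
  · intro i
    rw [h.eq_conformalInverse hp.2 (fun j => θ j p v) i]
    simp only [h.inv_toGL hp.2]
    rw [h.mfderiv_conformalProj hφ hp]
    rfl

end ConformalBundle

/-! ### The projection to the flat para-CR manifold in coordinates -/

section ParaCRProjection

variable {E : Type*} [NormedAddCommGroup E] [NormedSpace ℝ E]
  {θ : Fin 4 → E → E →L[ℝ] ℝ} {Ω : Fin 6 → E → E →L[ℝ] ℝ} {A : E → E →L[ℝ] ℝ}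
  {H : Fin 4 → Fin 4 → E → ℝ} {X : Fin 4 → E → ℝ} {U : Set E}

/-- The derivative of `paraCRCoords` on a vector on which `θ` takes the values `t` and `Ω₂, Ω₃` the
values `α, β`. -/
def paraCRVelocity (H : Fin 4 → Fin 4 → E → ℝ) (y : E) (t : Fin 4 → ℝ) (α β : ℝ) : Fin 6 → ℝ :=
  ![(H 2 2 y ^ 2)⁻¹ * (slopeCoeff H 0 0 y * β + slopeCoeff H 0 1 y * α),
    (H 2 2 y ^ 2)⁻¹ * (slopeCoeff H 1 0 y * β + slopeCoeff H 1 1 y * α),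
    ∑ j, H 3 j y * t j, ∑ j, H 0 j y * t j, ∑ j, H 1 j y * t j, -∑ j, H 2 j y * t j]

theorem FlatTrivialization.hasFDerivAt_paraCRCoords (h : FlatTrivialization U θ Ω A H X) {y : E}
    (hy : y ∈ U) (i : Fin 6) : ∃ f' : E →L[ℝ] ℝ, HasFDerivAt (fun z => paraCRCoords H X z i) f' y ∧
      ∀ w, f' w = paraCRVelocity H y (fun j => θ j y w) (Ω 1 y w) (Ω 2 y w) i := by
  have hs := h.hasFDerivAt_slope hy (h.ne22 y hy)
  have hX := h.dX y hy
  fin_cases i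
  · exact ⟨_, hs 0, fun w => by simp [paraCRVelocity]; ring⟩
  · exact ⟨_, hs 1, fun w => by simp [paraCRVelocity]; ring⟩
  · exact ⟨_, hX 3, fun w => by simp [paraCRVelocity]⟩
  · exact ⟨_, hX 0, fun w => by simp [paraCRVelocity]⟩
  · exact ⟨_, hX 1, fun w => by simp [paraCRVelocity]⟩
  · exact ⟨_, (hX 2).neg, fun w => by simp [paraCRVelocity]⟩

theorem FlatIntegral.eq_zero_of_mul_eq_zero (h : FlatIntegral U θ Ω A H X) {y : E} (hy : y ∈ U)
    {t : Fin 4 → ℝ} (ht : ∀ j, ∑ k, H j k y * t k = 0) (i : Fin 4) : t i = 0 := by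
  rw [h.eq_conformalInverse hy t i]
  simp [ht]

/-- The velocity consists of Ht, with entries permuted and one sign changed, and of (β, α)
multiplied by the matrix `slopeCoeff` and a nonzero factor. Both linear maps are invertible. -/
theorem FlatTrivialization.paraCRVelocity_eq_zero_iff (h : FlatTrivialization U θ Ω A H X) {y : E}
    (hy : y ∈ U) (t : Fin 4 → ℝ) (α β : ℝ) :
    paraCRVelocity H y t α β = 0 ↔ (∀ i, t i = 0) ∧ α = 0 ∧ β = 0 := by
  constructor
  · intro hv
    have e := fun i => congrFun hv i
    have h2 : (H 2 2 y ^ 2)⁻¹ ≠ 0 := inv_ne_zero (pow_ne_zero _ (h.ne22 y hy))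
    have e0 := (mul_eq_zero.1 (e 0)).resolve_left h2
    have e1 := (mul_eq_zero.1 (e 1)).resolve_left h2
    have hαβ := eq_zero_of_det_ne_zero (h.slope_det y hy) e0 e1
    refine ⟨h.eq_zero_of_mul_eq_zero hy fun j => ?_, hαβ.2, hαβ.1⟩
    fin_cases j
    exacts [e 3, e 4, neg_eq_zero.1 (e 5), e 2]
  · rintro ⟨ht, rfl, rfl⟩
    ext i
    fin_cases i <;> simp [paraCRVelocity, ht]

/-- The last row of H⁻¹ is the dual of column 2 divided by c. The first two relations define the
slopes; the third, with its quadratic coefficient xy, is the nullity of that column and is the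
source of the term xy da₃ in the flat model. -/
theorem FlatTrivialization.conformalInverse_three (h : FlatTrivialization U θ Ω A H X) {y : E}
    (hy : y ∈ U) :
    conformalInverse H 3 0 y = baseSlope H 0 y * conformalInverse H 3 3 y ∧
    conformalInverse H 3 1 y = baseSlope H 1 y * conformalInverse H 3 3 y ∧
    conformalInverse H 3 2 y = -(baseSlope H 0 y * baseSlope H 1 y * conformalInverse H 3 3 y) := by
  have h0 := (h.pos y hy).ne'
  have h2 := h.ne22 y hy
  have hc := h.column_product hy 2 2
  have hs : splitMetric 2 2 = 0 := by simp [splitMetric]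
  rw [hs, mul_zero] at hc
  simp only [conformalInverse, baseSlope, dualIndex]
  refine ⟨?_, ?_, ?_⟩ <;> simp <;> field_simp
  linear_combination hc / 2

/-- The value of the form `λ` of the flat model. -/
theorem FlatTrivialization.contact_eq (h : FlatTrivialization U θ Ω A H X) {y : E}
    (hy : y ∈ U) (t : Fin 4 → ℝ) (α β : ℝ) {V : Fin 6 → ℝ} (hV : V = paraCRVelocity H y t α β) :
    t 3 = conformalInverse H 3 3 y * (V 2 + baseSlope H 0 y * V 3 + baseSlope H 1 y * V 4
      + baseSlope H 0 y * baseSlope H 1 y * V 5) := by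
  obtain ⟨h0, h1, h2⟩ := h.conformalInverse_three hy
  rw [h.eq_conformalInverse hy t 3, Fin.sum_univ_four, h0, h1, h2, hV]
  simp only [paraCRVelocity]
  simp
  ring

/-- Rows 0, 1, 2 of θ = H⁻¹dX, with dX₃ replaced by λ minus its other terms. This substitution
produces the slope corrections in `solderCoeff`. -/
theorem FlatTrivialization.solder_eq (h : FlatTrivialization U θ Ω A H X) {y : E}
    (hy : y ∈ U) (t : Fin 4 → ℝ) (α β : ℝ) {V : Fin 6 → ℝ} (hV : V = paraCRVelocity H y t α β)
    (i : Fin 3) :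
    t i.castSucc = conformalInverse H i.castSucc 3 y * (V 2 + baseSlope H 0 y * V 3
      + baseSlope H 1 y * V 4 + baseSlope H 0 y * baseSlope H 1 y * V 5)
      + ∑ j, solderCoeff H i j y * ![V 3, V 4, V 5] j := by
  rw [h.eq_conformalInverse hy t i.castSucc, Fin.sum_univ_four, Fin.sum_univ_three, hV]
  simp only [paraCRVelocity, solderCoeff]
  simp
  ring

/-- The coefficients of `Ω₃, Ω₂` with respect to the forms `μ` of the flat model. -/
def slopeInverse (H : Fin 4 → Fin 4 → E → ℝ) (i j : Fin 2) (z : E) : ℝ :=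
  H 2 2 z ^ 2 * (![![slopeCoeff H 1 1 z, -slopeCoeff H 0 1 z],
    ![-slopeCoeff H 1 0 z, slopeCoeff H 0 0 z]] i j
    / (slopeCoeff H 0 0 z * slopeCoeff H 1 1 z - slopeCoeff H 0 1 z * slopeCoeff H 1 0 z))

theorem FlatTrivialization.slope_eq (h : FlatTrivialization U θ Ω A H X) {y : E}
    (hy : y ∈ U) (t : Fin 4 → ℝ) (α β : ℝ) {V : Fin 6 → ℝ} (hV : V = paraCRVelocity H y t α β)
    (i : Fin 2) : ![β, α] i = ∑ j, slopeInverse H i j y * ![V 0, V 1] j := by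
  have h2 := h.ne22 y hy
  have hd := h.slope_det y hy
  rw [Fin.sum_univ_two, hV]
  obtain ⟨D, hD⟩ : ∃ D, D = slopeCoeff H 0 0 y * slopeCoeff H 1 1 y
    - slopeCoeff H 0 1 y * slopeCoeff H 1 0 y := ⟨_, rfl⟩
  simp only [paraCRVelocity, slopeInverse, ← hD] at hd ⊢
  fin_cases i <;> simp <;> field_simp <;> rw [hD] <;> ring

theorem FlatTrivialization.slopeInverse_det (h : FlatTrivialization U θ Ω A H X) {y : E}
    (hy : y ∈ U) : (Matrix.of fun i j => slopeInverse H i j y).det ≠ 0 := by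
  have h2 := h.ne22 y hy
  have hd := h.slope_det y hy
  have : (Matrix.of fun i j => slopeInverse H i j y).det = H 2 2 y ^ 4
      / (slopeCoeff H 0 0 y * slopeCoeff H 1 1 y - slopeCoeff H 0 1 y * slopeCoeff H 1 0 y) := by
    rw [Matrix.det_fin_two]
    simp only [Matrix.of_apply, slopeInverse]
    simp
    field_simp
  rw [this]
  exact div_ne_zero (pow_ne_zero _ h2) hd

theorem FlatTrivialization.smooth_slopeInverse (h : FlatTrivialization U θ Ω A H X)
    (i j : Fin 2) : ContDiffOn ℝ ∞ (slopeInverse H i j) U := by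
  have hs := h.smooth_slopeCoeff
  refine ((h.smooth_H 2 2).pow 2).mul (ContDiffOn.div ?_
    (((hs 0 0).mul (hs 1 1)).sub ((hs 0 1).mul (hs 1 0))) h.slope_det)
  fin_cases i <;> fin_cases j
  exacts [hs 1 1, (hs 0 1).neg, (hs 1 0).neg, hs 0 0]

/-- The slopes and the coefficients b, f give rows 0, 1, 2 of H⁻¹, and a with the slopes gives row
3. Up to a permutation of entries H⁻¹ is H/c, so c is recovered first, then H, and the chart (X, H)
is injective. -/
theorem FlatTrivialization.eq_of_parameters (h : FlatTrivialization U θ Ω A H X) {y z : E}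
    (hy : y ∈ U) (hz : z ∈ U) (hc : ∀ i, paraCRCoords H X y i = paraCRCoords H X z i)
    (ha : conformalInverse H 3 3 y = conformalInverse H 3 3 z)
    (hb : ∀ i : Fin 3, conformalInverse H i.castSucc 3 y = conformalInverse H i.castSucc 3 z)
    (hf : ∀ i j, solderCoeff H i j y = solderCoeff H i j z) : y = z := by
  have s0 : baseSlope H 0 y = baseSlope H 0 z := hc 0
  have s1 : baseSlope H 1 y = baseSlope H 1 z := hc 1
  have hX : ∀ i, X i y = X i z := by
    intro i
    fin_cases i
    exacts [hc 3, hc 4, neg_injective (hc 5), hc 2]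
  have hi : ∀ (i : Fin 3) (j : Fin 4),
      conformalInverse H i.castSucc j y = conformalInverse H i.castSucc j z := by
    intro i j
    have f0 := hf i 0
    have f1 := hf i 1
    have f2 := hf i 2
    have b := hb i
    simp [solderCoeff, s0, s1, b] at f0 f1 f2
    fin_cases j
    exacts [f0, f1, f2, b]
  have hinv : ∀ i j, conformalInverse H i j y = conformalInverse H i j z := by
    intro i j
    obtain ⟨y0, y1, y2⟩ := h.conformalInverse_three hy
    obtain ⟨z0, z1, z2⟩ := h.conformalInverse_three hz
    fin_cases i
    · exact hi 0 j
    · exact hi 1 j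
    · exact hi 2 j
    · fin_cases j
      · exact (y0.trans (congrArg₂ (· * ·) s0 ha)).trans z0.symm
      · exact (y1.trans (congrArg₂ (· * ·) s1 ha)).trans z1.symm
      · exact (y2.trans
          (congrArg Neg.neg (congrArg₂ (· * ·) (congrArg₂ (· * ·) s0 s1) ha))).trans z2.symm
      · exact ha
  have hq : ∀ i j, H i j y / rowProduct H 0 1 y = H i j z / rowProduct H 0 1 z := by
    intro i j
    have := hinv (dualIndex j) (dualIndex i)
    have hd : ∀ k, dualIndex (dualIndex k) = k := by decide
    simpa [conformalInverse, hd] using this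
  -- The row product is quadratic, so on H/c it equals c/c² = 1/c.
  have hcc : ∀ {x : E}, x ∈ U → (rowProduct H 0 1 x)⁻¹ =
      rowProduct (fun i j x => H i j x / rowProduct H 0 1 x) 0 1 x := by
    intro x hx
    have h0 := (h.pos x hx).ne'
    have h1 : ∀ r, H 0 0 x / r * (H 1 1 x / r) + H 0 1 x / r * (H 1 0 x / r)
        + H 0 2 x / r * (H 1 3 x / r) + H 0 3 x / r * (H 1 2 x / r)
        = rowProduct H 0 1 x / r ^ 2 := by
      intro r
      simp only [rowProduct]
      ring
    refine Eq.trans ?_ (h1 _).symm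
    field_simp
  have hce : rowProduct H 0 1 y = rowProduct H 0 1 z := by
    refine inv_injective ?_
    rw [hcc hy, hcc hz]
    simp only [rowProduct] at hq ⊢
    simp only [hq]
  have hH : ∀ i j, H i j y = H i j z := by
    intro i j
    have h0 := (h.pos z hz).ne'
    have := hq i j
    rw [hce] at this
    field_simp at this
    exact this
  obtain ⟨e, he, hec⟩ := h.conformal_chart
  refine e.injOn (he hy) (he hz) ?_
  rw [hec]
  simp only [conformalCoords, hX, hH]

theorem FlatIntegral.hasFDerivAt_conformalInverse (h : FlatIntegral U θ Ω A H X) {y : E}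
    (hy : y ∈ U) {i j : Fin 4} {F' : E →L[ℝ] ℝ}
    (hF : HasFDerivAt (H (dualIndex j) (dualIndex i)) F' y) :
    HasFDerivAt (conformalInverse H i j)
      ((rowProduct H 0 1 y)⁻¹ • (F' - H (dualIndex j) (dualIndex i) y • A y)) y := by
  have h0 := (h.pos y hy).ne'
  refine (hasFDerivAt_div hF (h.hasFDerivAt_rowProduct hy 0 1) h0).congr_fderiv ?_
  ext v
  simp
  field_simp

/-- The slopes are stationary along w, so differentiating the formulas for `solderCoeff` isolates
the derivatives of the entries of H⁻¹. -/
theorem FlatTrivialization.fderiv_conformalInverse (h : FlatTrivialization U θ Ω A H X) {y : E}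
    (hy : y ∈ U) {w : E} (h1 : Ω 1 y w = 0) (h2 : Ω 2 y w = 0) (i : Fin 3)
    (hb : fderiv ℝ (conformalInverse H i.castSucc 3) y w = 0)
    (hf : ∀ j, fderiv ℝ (solderCoeff H i j) y w = 0) (j : Fin 4) :
    fderiv ℝ (conformalInverse H i.castSucc j) y w = 0 := by
  have hd := fun j => (((h.smooth_conformalInverse i.castSucc j).contDiffAt
    (h.isOpen.mem_nhds hy)).differentiableAt (by simp)).hasFDerivAt
  have hs := h.hasFDerivAt_slope hy (h.ne22 y hy)
  have e0 := DFunLike.congr_fun ((hd 0).sub ((hs 0).mul (hd 3))).fderiv w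
  have e1 := DFunLike.congr_fun ((hd 1).sub ((hs 1).mul (hd 3))).fderiv w
  have e2 := DFunLike.congr_fun ((hd 2).add (((hs 0).mul (hs 1)).mul (hd 3))).neg.fderiv w
  have f0 := e0.symm.trans (hf 0)
  have f1 := e1.symm.trans (hf 1)
  have f2 := e2.symm.trans (hf 2)
  simp [h1, h2, hb] at f0 f1 f2
  fin_cases j
  exacts [f0, f1, f2, hb]

/-- The group parameters of the adapted coframes immerse the bundle. -/
theorem FlatTrivialization.eq_zero_of_parameters (h : FlatTrivialization U θ Ω A H X) {y : E}
    (hy : y ∈ U) {w : E} (h0 : ∀ i, θ i y w = 0) (h1 : Ω 1 y w = 0) (h2 : Ω 2 y w = 0)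
    (hb : ∀ i : Fin 3, fderiv ℝ (conformalInverse H i.castSucc 3) y w = 0)
    (hf : ∀ i j, fderiv ℝ (solderCoeff H i j) y w = 0) : w = 0 := by
  have hz := fun i => h.fderiv_conformalInverse hy h1 h2 i (hb i) (hf i)
  have hc := inv_ne_zero (h.pos y hy).ne'
  -- Row i of H⁻¹ is a column of H divided by c; it is stationary along w exactly when that column
  -- grows at the rate A of c.
  have hH : ∀ (i : Fin 3) (m : Fin 4) {F' : E →L[ℝ] ℝ},
      HasFDerivAt (H m (dualIndex i.castSucc)) F' y →
      F' w = H m (dualIndex i.castSucc) y * A y w := by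
    intro i m F' hF
    have hdual : ∀ k, dualIndex (dualIndex k) = k := by decide
    have hd : dualIndex (dualIndex m) = m := hdual m
    have e := (h.hasFDerivAt_conformalInverse hy (i := i.castSucc) (j := dualIndex m)
      (F' := F') (by rwa [hd])).fderiv
    have := (DFunLike.congr_fun e w).symm.trans (hz i (dualIndex m))
    rw [hd] at this
    have := (mul_eq_zero.1 this).resolve_left hc
    exact sub_eq_zero.1 this
  have m1 := fun m => hH 0 m (h.dH1 y hy m)
  have m0 := fun m => hH 1 m (h.dH0 y hy m)
  have m3 := fun m => hH 2 m (h.dH3 y hy m)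
  -- Since dH = HΓ, the growth condition reads H(Γ - A)e₁ = 0. Cancelling H leaves a column of Γ - A
  -- to be read off, here and for e₀ and e₃.
  have z1 := h.eq_zero_of_mul_eq_zero hy
    (t := ![0, Ω 0 y w - A y w / 2, -Ω 4 y w, 0]) fun m => by
      have e : H m (dualIndex (Fin.castSucc (0 : Fin 3))) y = H m 1 y := rfl
      have := m1 m
      rw [e] at this
      simp [Fin.sum_univ_four, h2] at this ⊢
      linarith
  have z0 := h.eq_zero_of_mul_eq_zero hy
    (t := ![-Ω 0 y w - A y w / 2, 0, -Ω 3 y w, 0]) fun m => by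
      have e : H m (dualIndex (Fin.castSucc (1 : Fin 3))) y = H m 0 y := rfl
      have := m0 m
      rw [e] at this
      simp [Fin.sum_univ_four, h1] at this ⊢
      linarith
  have z3 := h.eq_zero_of_mul_eq_zero hy
    (t := ![Ω 4 y w, Ω 3 y w, 0, Ω 5 y w - A y w / 2]) fun m => by
      have e : H m (dualIndex (Fin.castSucc (2 : Fin 3))) y = H m 3 y := rfl
      have := m3 m
      rw [e] at this
      simp [Fin.sum_univ_four] at this ⊢
      linarith
  -- The first and third relations give `Ω 0` = A/2 = -`Ω 0`, hence A = 0.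
  have a1 : Ω 0 y w - A y w / 2 = 0 := z1 1
  have a2 : -Ω 4 y w = 0 := z1 2
  have a3 : -Ω 0 y w - A y w / 2 = 0 := z0 0
  have a4 : -Ω 3 y w = 0 := z0 2
  have a5 : Ω 5 y w - A y w / 2 = 0 := z3 3
  refine h.frame y hy w h0 (fun i => ?_) (by linarith)
  fin_cases i <;> simp <;> linarith

end ParaCRProjection

/-! ### The bundle over the flat para-CR manifold -/

section ParaCRBundle

variable {E : Type*} [NormedAddCommGroup E] [NormedSpace ℝ E]
  {M : Type*} [TopologicalSpace M] [ChartedSpace E M] [IsManifold 𝓘(ℝ, E) ∞ M]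
  {θ : Fin 4 → OneForm E M} {Ω : Fin 6 → OneForm E M} {A : OneForm E M}
  {φ : OpenPartialHomeomorph M E} {U : Set E} {H : Fin 4 → Fin 4 → E → ℝ} {X : Fin 4 → E → ℝ}

/-- The projection to the flat para-CR manifold. -/
def paraCRProj (H : Fin 4 → Fin 4 → E → ℝ) (X : Fin 4 → E → ℝ) (z : E) :
    EuclideanSpace ℝ (Fin 6) :=
  WithLp.toLp 2 fun i => paraCRCoords H X z i

theorem FlatTrivialization.mfderiv_paraCRProj (h : FlatTrivialization U
    (fun i => (θ i).inChart φ) (fun i => (Ω i).inChart φ) (A.inChart φ) H X)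
    (hφ : φ ∈ atlas E M) {p : M} (hp : p ∈ φ.source ∩ φ ⁻¹' U) (v : TangentSpace 𝓘(ℝ, E) p) :
    mfderiv 𝓘(ℝ, E) 𝓘(ℝ, EuclideanSpace ℝ (Fin 6)) (paraCRProj H X ∘ φ) p v
      = (WithLp.toLp 2 (paraCRVelocity H (φ p) (fun i => θ i p v) (Ω 1 p v) (Ω 2 p v)) :
        EuclideanSpace ℝ (Fin 6)) := by
  obtain ⟨w, hw, hη⟩ := exists_chartVector hφ hp.1 v
  choose f' hf' hfw using h.hasFDerivAt_paraCRCoords hp.2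
  refine (mfderiv_toLp_chart hφ hp.1 hf' v).trans ?_
  rw [hw]
  refine congrArg (WithLp.toLp 2) (funext fun i => ?_)
  rw [hfw]
  simp only [hη]

theorem FlatTrivialization.mfderiv_paraCRProj_eq_zero_iff (h : FlatTrivialization U
    (fun i => (θ i).inChart φ) (fun i => (Ω i).inChart φ) (A.inChart φ) H X)
    (hφ : φ ∈ atlas E M) {p : M} (hp : p ∈ φ.source ∩ φ ⁻¹' U) (v : TangentSpace 𝓘(ℝ, E) p) :
    mfderiv 𝓘(ℝ, E) 𝓘(ℝ, EuclideanSpace ℝ (Fin 6)) (paraCRProj H X ∘ φ) p v = 0 ↔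
      (∀ i, θ i p v = 0) ∧ Ω 1 p v = 0 ∧ Ω 2 p v = 0 := by
  rw [h.mfderiv_paraCRProj hφ hp, ← h.paraCRVelocity_eq_zero_iff hp.2]
  constructor
  · intro hv
    exact congrArg (WithLp.ofLp (p := 2) (V := Fin 6 → ℝ)) hv
  · intro hv
    rw [hv]
    rfl

/-- The matrix of the coordinates of the group `K`. -/
def affineMatrix (H : Fin 4 → Fin 4 → E → ℝ) (z : E) :
    Matrix (Fin 2 ⊕ Fin 2 ⊕ Unit) (Fin 2 ⊕ Fin 2 ⊕ Unit) ℝ :=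
  blockMatrix !![fibreP H z, fibreQ H z; 0, 1] !![fibreP' H z, fibreQ' H z; 0, 1]
    (rowProduct H 0 1 z)

/-- Each entry is an affine function of the five coordinates with constant coefficients, so
smoothness and derivatives need no case distinction. The corner r is 1 in the group and 0 in its Lie
algebra. -/
theorem blockMatrix_entry (p q r p' q' t : ℝ) (i j : Fin 2 ⊕ Fin 2 ⊕ Unit) :
    blockMatrix !![p, q; 0, r] !![p', q'; 0, r] t i j =
      p * blockMatrix !![1, 0; 0, 0] 0 0 i j + q * blockMatrix !![0, 1; 0, 0] 0 0 i j
      + p' * blockMatrix 0 !![1, 0; 0, 0] 0 i j + q' * blockMatrix 0 !![0, 1; 0, 0] 0 i j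
      + t * blockMatrix 0 0 1 i j + r * blockMatrix !![0, 0; 0, 1] !![0, 0; 0, 1] 0 i j := by
  rcases i with i | i | i <;> rcases j with j | j | j <;> simp [blockMatrix] <;>
    fin_cases i <;> fin_cases j <;> simp

theorem FlatIntegral.smooth_affineMatrix {θ : Fin 4 → E → E →L[ℝ] ℝ} {Ω : Fin 6 → E → E →L[ℝ] ℝ}
    {A : E → E →L[ℝ] ℝ} (h : FlatIntegral U θ Ω A H X) (i j : Fin 2 ⊕ Fin 2 ⊕ Unit) :
    ContDiffOn ℝ ∞ (fun z => affineMatrix H z i j) U :=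
   ((((((h.smooth_fibreP.mul contDiffOn_const).add (h.smooth_fibreQ.mul contDiffOn_const)).add
    (h.smooth_fibreP'.mul contDiffOn_const)).add (h.smooth_fibreQ'.mul contDiffOn_const)).add
    ((h.smooth_rowProduct 0 1).mul contDiffOn_const)).add contDiffOn_const).congr
    fun _ _ => blockMatrix_entry _ _ _ _ _ _ i j

/-- In each affine factor dp = pα and dq = pβ amount to dk = k(α β; 0 0). Only fibre directions are
claimed, because the differentials also involve `Ω 1` and `Ω 2`. -/
theorem FlatIntegral.hasFDerivAt_affineMatrix {θ : Fin 4 → E → E →L[ℝ] ℝ}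
    {Ω : Fin 6 → E → E →L[ℝ] ℝ} {A : E → E →L[ℝ] ℝ} (h : FlatIntegral U θ Ω A H X) {y : E}
    (hy : y ∈ U) (i j : Fin 2 ⊕ Fin 2 ⊕ Unit) :
    ∃ f' : E →L[ℝ] ℝ, HasFDerivAt (fun z => affineMatrix H z i j) f' y ∧
      ∀ w, Ω 1 y w = 0 → Ω 2 y w = 0 → f' w = (affineMatrix H y
        * blockMatrix !![Ω 0 y w - Ω 5 y w, Ω 3 y w; 0, 0]
          !![-(Ω 0 y w + Ω 5 y w), Ω 4 y w; 0, 0] (A y w)) i j := by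
  obtain ⟨p', hp, hpv⟩ := h.hasFDerivAt_fibreP hy
  obtain ⟨q', hq, hqv⟩ := h.hasFDerivAt_fibreQ hy
  obtain ⟨r', hr, hrv⟩ := h.hasFDerivAt_fibreP' hy
  obtain ⟨s', hs, hsv⟩ := h.hasFDerivAt_fibreQ' hy
  have ht := h.hasFDerivAt_rowProduct hy 0 1
  refine ⟨_, (((((hp.mul_const _).add (hq.mul_const _)).add (hr.mul_const _)).add
    (hs.mul_const _)).add (ht.mul_const _)).add_const _ |>.congr_of_eventuallyEq
    (Filter.Eventually.of_forall fun z => blockMatrix_entry _ _ _ _ _ _ i j), fun w h1 h2 => ?_⟩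
  have hm : ∀ a b c d : ℝ, !![a, b; 0, 1] * !![c, d; 0, 0] = !![a * c, a * d; 0, 0] := by
    intro a b c d
    ext i j
    fin_cases i <;> fin_cases j <;> simp [Matrix.mul_apply, Fin.sum_univ_two]
  rw [affineMatrix, ← blockMatrix_mul, hm, hm, blockMatrix_entry]
  simp [hpv w h1 h2, hqv w h1 h2, hrv w h1 h2, hsv w h1 h2]
  ring

/-- The group component of the trivialization over the flat para-CR manifold. -/
def affineGroupMap (H : Fin 4 → Fin 4 → E → ℝ) (z : E) : GL (Fin 2 ⊕ Fin 2 ⊕ Unit) ℝ :=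
  coordK (fibreP H z) (fibreQ H z) (fibreP' H z) (fibreQ' H z) (rowProduct H 0 1 z)

theorem FlatTrivialization.fibre_ne_zero {θ : Fin 4 → E → E →L[ℝ] ℝ}
    {Ω : Fin 6 → E → E →L[ℝ] ℝ} {A : E → E →L[ℝ] ℝ} (h : FlatTrivialization U θ Ω A H X) {y : E}
    (hy : y ∈ U) : fibreP H y ≠ 0 ∧ fibreP' H y ≠ 0 ∧ rowProduct H 0 1 y ≠ 0 :=
  ⟨div_ne_zero (h.minor12 y hy) (h.pos y hy).ne', div_ne_zero (h.minor20 y hy) (h.pos y hy).ne',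
    (h.pos y hy).ne'⟩

theorem FlatTrivialization.affineGroupMap_val {θ : Fin 4 → E → E →L[ℝ] ℝ}
    {Ω : Fin 6 → E → E →L[ℝ] ℝ} {A : E → E →L[ℝ] ℝ} (h : FlatTrivialization U θ Ω A H X) {y : E}
    (hy : y ∈ U) : (affineGroupMap H y).val = affineMatrix H y := by
  obtain ⟨h1, h2, h3⟩ := h.fibre_ne_zero hy
  exact coordK_val h1 h2 h3

theorem FlatTrivialization.kappaForm_eq (h : FlatTrivialization U
    (fun i => (θ i).inChart φ) (fun i => (Ω i).inChart φ) (A.inChart φ) H X)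
    (hφ : φ ∈ atlas E M) {p : M} (hp : p ∈ φ.source ∩ φ ⁻¹' U) {v : TangentSpace 𝓘(ℝ, E) p}
    (h1 : Ω 1 p v = 0) (h2 : Ω 2 p v = 0) :
    kappaForm Ω A p v = ((affineGroupMap H (φ p))⁻¹ : GL (Fin 2 ⊕ Fin 2 ⊕ Unit) ℝ).val
      * matDiff (fun q => affineGroupMap H (φ q)) p v := by
  have hU := φ.isOpen_inter_preimage h.isOpen
  obtain ⟨w, hw, hη⟩ := exists_chartVector hφ hp.1 v
  have hm : matDiff (fun q => affineGroupMap H (φ q)) p v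
      = (affineGroupMap H (φ p)).val * kappaForm Ω A p v := by
    ext i j
    obtain ⟨f', hf', hf⟩ := h.hasFDerivAt_affineMatrix hp.2 i j
    have hd := mvfderiv_of_eqOn hφ hU (f := fun q => affineGroupMap H (φ q) i j)
      (fun q hq => by rw [h.affineGroupMap_val hq.2]) hp hp.1 hf' v
    refine hd.trans ?_
    rw [h.affineGroupMap_val hp.2]
    refine (congrArg f' hw).trans ?_
    rw [hf w ((hη _).trans h1) ((hη _).trans h2)]
    simp only [hη]
    rfl
  have hi : ((affineGroupMap H (φ p))⁻¹ : GL (Fin 2 ⊕ Fin 2 ⊕ Unit) ℝ).val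
    * (affineGroupMap H (φ p)).val = 1 := (affineGroupMap H (φ p)).inv_mul
  rw [hm, ← Matrix.mul_assoc, hi, Matrix.one_mul]

omit [IsManifold 𝓘(ℝ, E) ∞ M] in
theorem kappaForm_eq_zero {p : M} {v : TangentSpace 𝓘(ℝ, E) p} (h : kappaForm Ω A p v = 0)
    (h1 : Ω 1 p v = 0) (h2 : Ω 2 p v = 0) : (∀ i, Ω i p v = 0) ∧ A p v = 0 := by
  have e := fun i j => congrFun (congrFun h i) j
  have e0 := e (.inl 0) (.inl 0)
  have e1 := e (.inl 0) (.inl 1)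
  have e2 := e (.inr (.inl 0)) (.inr (.inl 0))
  have e3 := e (.inr (.inl 0)) (.inr (.inl 1))
  have e4 := e (.inr (.inr ())) (.inr (.inr ()))
  simp [kappaForm, blockMatrix] at e0 e1 e2 e3 e4
  refine ⟨fun i => ?_, e4⟩
  fin_cases i <;> simp <;> linarith

/-- Coordinates on the product of the flat para-CR manifold and the group `K`. -/
def affineGroupCoords (z : EuclideanSpace ℝ (Fin 6) × groupK) : Fin 11 → ℝ :=
  ![z.1 0, z.1 1, z.1 2, z.1 3, z.1 4, z.1 5, z.2.val (.inl 0) (.inl 0), z.2.val (.inl 0) (.inl 1),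
    z.2.val (.inr (.inl 0)) (.inr (.inl 0)), z.2.val (.inr (.inl 0)) (.inr (.inl 1)),
    z.2.val (.inr (.inr ())) (.inr (.inr ()))]

omit [NormedAddCommGroup E] [NormedSpace ℝ E] in
theorem affineGroupCoords_eq {z : E} {g : GL (Fin 2 ⊕ Fin 2 ⊕ Unit) ℝ}
    (hg : g.val = affineMatrix H z) (hmem : g ∈ groupK) :
    affineGroupCoords (paraCRProj H X z, ⟨g, hmem⟩) = affineCoords H X z := by
  have e6 : affineMatrix H z (.inl 0) (.inl 0) = fibreP H z := by simp [affineMatrix, blockMatrix]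
  have e7 : affineMatrix H z (.inl 0) (.inl 1) = fibreQ H z := by simp [affineMatrix, blockMatrix]
  have e8 : affineMatrix H z (.inr (.inl 0)) (.inr (.inl 0)) = fibreP' H z := by
    simp [affineMatrix, blockMatrix]
  have e9 : affineMatrix H z (.inr (.inl 0)) (.inr (.inl 1)) = fibreQ' H z := by
    simp [affineMatrix, blockMatrix]
  have e10 : affineMatrix H z (.inr (.inr ())) (.inr (.inr ())) = rowProduct H 0 1 z := by
    simp [affineMatrix, blockMatrix]
  simp only [affineGroupCoords, hg, e6, e7, e8, e9, e10]
  rfl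

theorem continuous_affineGroupCoords : Continuous affineGroupCoords := by
  have hb : ∀ i : Fin 6, Continuous fun z : EuclideanSpace ℝ (Fin 6) × groupK => z.1 i :=
    fun i => (EuclideanSpace.proj (𝕜 := ℝ) i).continuous.comp continuous_fst
  refine continuous_pi fun i => ?_
  fin_cases i
  exacts [hb 0, hb 1, hb 2, hb 3, hb 4, hb 5, continuous_entry _ _, continuous_entry _ _,
    continuous_entry _ _, continuous_entry _ _, continuous_entry _ _]

theorem injective_affineGroupCoords : Function.Injective affineGroupCoords := by
  rintro ⟨z, g, hg⟩ ⟨z', g', hg'⟩ heq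
  have e := fun i => congrFun heq i
  have e6 : g (.inl 0) (.inl 0) = g' (.inl 0) (.inl 0) := e 6
  have e7 : g (.inl 0) (.inl 1) = g' (.inl 0) (.inl 1) := e 7
  have e8 : g (.inr (.inl 0)) (.inr (.inl 0)) = g' (.inr (.inl 0)) (.inr (.inl 0)) := e 8
  have e9 : g (.inr (.inl 0)) (.inr (.inl 1)) = g' (.inr (.inl 0)) (.inr (.inl 1)) := e 9
  have e10 : g (.inr (.inr ())) (.inr (.inr ())) = g' (.inr (.inr ())) (.inr (.inr ())) := e 10
  have hgg : g = g' := by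
    refine Units.ext ?_
    rw [exists_blockMatrix_of_mem_groupK hg, exists_blockMatrix_of_mem_groupK hg', e6, e7, e8, e9,
      e10]
  have hz : z = z' := by
    ext i
    fin_cases i
    exacts [e 0, e 1, e 2, e 3, e 4, e 5]
  subst hgg hz
  rfl

/-- A vector killed by both components is killed by θ, `Ω 1`, `Ω 2` through the projection and by
the other five forms through k⁻¹dk, hence vanishes by the coframe condition. -/
theorem FlatTrivialization.isLocalPrincipalBundle_paraCR (h : FlatTrivialization U
    (fun i => (θ i).inChart φ) (fun i => (Ω i).inChart φ) (A.inChart φ) H X)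
    (hφ : φ ∈ atlas E M) :
    IsLocalPrincipalBundle (F := EuclideanSpace ℝ (Fin 6)) groupK (φ.source ∩ φ ⁻¹' U)
      (paraCRProj H X ∘ φ) (fun q => affineGroupMap H (φ q)) (kappaForm Ω A) := by
  have hU := φ.isOpen_inter_preimage h.isOpen
  have hcoord := contDiffOn_pi.1 (h.smooth_paraCRCoords h.ne22)
  have smooth_proj := contMDiffOn_comp_chart hφ (contDiffOn_toLp_pi hcoord)
  have smooth_group := fun i j => contMDiffOn_of_eqOn hφ
    (f := fun q => affineGroupMap H (φ q) i j)
    (fun q hq => by rw [h.affineGroupMap_val hq.2]) (h.smooth_affineMatrix i j)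
  have mem : ∀ p ∈ φ.source ∩ φ ⁻¹' U, affineGroupMap H (φ p) ∈ groupK := fun p hp =>
    coordK_mem (h.fibre_ne_zero hp.2).1 (h.fibre_ne_zero hp.2).2.1 (h.fibre_ne_zero hp.2).2.2
  obtain ⟨e, he, hec⟩ := h.affine_chart
  refine ⟨hU, smooth_proj, smooth_group, mem, fun p hp v hv hv' => ?_, ?_, fun p hp v hv => ?_⟩
  · obtain ⟨h0, h1, h2⟩ := (h.mfderiv_paraCRProj_eq_zero_iff hφ hp v).1 hv
    have hk := h.kappaForm_eq hφ hp h1 h2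
    rw [hv', Matrix.mul_zero] at hk
    obtain ⟨k1, k2⟩ := kappaForm_eq_zero hk h1 h2
    exact h.eq_zero hφ hp h0 k1 k2
  · refine isOpenEmbedding_of_coordinates hU (φ.trans e) (fun p hp => ?_)
      (continuous_bundleMap smooth_proj smooth_group mem) isOpen_univ
      continuous_affineGroupCoords.continuousOn injective_affineGroupCoords.injOn
      (fun p => Set.mem_univ _) fun p => ?_
    · rw [OpenPartialHomeomorph.trans_source]
      exact ⟨hp.1, he hp.2⟩
    · rw [OpenPartialHomeomorph.coe_trans, hec]
      exact affineGroupCoords_eq (h.affineGroupMap_val p.2.2) (mem p p.2)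
  · obtain ⟨-, h1, h2⟩ := (h.mfderiv_paraCRProj_eq_zero_iff hφ hp v).1 hv
    exact h.kappaForm_eq hφ hp h1 h2

omit [IsManifold 𝓘(ℝ, E) ∞ M] in
theorem FlatSystemOn.mono {V W : Set M} (h : FlatSystemOn V θ Ω A) (hW : W ⊆ V) :
    FlatSystemOn W θ Ω A where
  dθ1 p hp := h.dθ1 p (hW hp)
  dθ2 p hp := h.dθ2 p (hW hp)
  dθ3 p hp := h.dθ3 p (hW hp)
  dθ4 p hp := h.dθ4 p (hW hp)
  dΩ1 p hp := h.dΩ1 p (hW hp)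
  dΩ2 p hp := h.dΩ2 p (hW hp)
  dΩ3 p hp := h.dΩ3 p (hW hp)
  dΩ4 p hp := h.dΩ4 p (hW hp)
  dΩ5 p hp := h.dΩ5 p (hW hp)
  dΩ6 p hp := h.dΩ6 p (hW hp)
  dA p hp := h.dA p (hW hp)

theorem FlatTrivialization.arisesFromParaCR [FiniteDimensional ℝ E]
    (hdim : Module.finrank ℝ E = 11) (h : FlatTrivialization U
    (fun i => (θ i).inChart φ) (fun i => (Ω i).inChart φ) (A.inChart φ) H X)
    (hcoframe : IsCoframe (Sum.elim θ (Sum.elim Ω fun _ : Unit => A)))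
    (hs : FlatSystemOn Set.univ θ Ω A) (hφ : φ ∈ atlas E M) :
    ArisesFromParaCR (F := EuclideanSpace ℝ (Fin 6)) (φ.source ∩ φ ⁻¹' U) θ Ω A
      (paraCRProj H X ∘ φ) flatModel := by
  have hU := φ.isOpen_inter_preimage h.isOpen
  have hsm : ∀ {f : E → ℝ}, ContDiffOn ℝ ∞ f U →
      ContMDiffOn 𝓘(ℝ, E) 𝓘(ℝ, ℝ) ∞ (f ∘ φ) (φ.source ∩ φ ⁻¹' U) :=
    fun hf => contMDiffOn_comp_chart hφ hf
  -- Here a and b are the last column of H⁻¹. The parameters c vanish because the differentials of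
  -- the slopes involve `Ω 2` and `Ω 1` alone, so these two forms are combinations of dx and dy.
  refine ⟨⟨conformalInverse H 3 3 ∘ φ, fun i => conformalInverse H i.castSucc 3 ∘ φ, fun _ _ => 0,
    fun i j => solderCoeff H i j ∘ φ, fun i j => slopeInverse H i j ∘ φ,
    hsm (h.smooth_conformalInverse 3 3), fun i => hsm (h.smooth_conformalInverse _ _),
    fun _ => contMDiffOn_const, fun i j => hsm (h.smooth_solderCoeff h.ne22 i j),
    fun i j => hsm (h.smooth_slopeInverse i j), fun p hp => ⟨?_, h.solder_det _ hp.2,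
      h.slopeInverse_det hp.2⟩, fun p hp v => ?_, fun p hp q hq hσ ha hb _ hf _ => ?_,
    fun p hp v hσ _ hb _ hf _ => ?_⟩, hs.mono (Set.subset_univ _),
    fun Ω' A' _ _ heq hs' p hp =>
      (hs.mono (Set.subset_univ _)).connection_unique hdim hU hcoframe hs' heq hp⟩
  · exact div_ne_zero (h.ne22 _ hp.2) (h.pos _ hp.2).ne'
  · have hv := h.mfderiv_paraCRProj hφ hp v
    have hlam : flatModel.lam 0 ((paraCRProj H X ∘ φ) p)
        (mfderiv 𝓘(ℝ, E) 𝓘(ℝ, EuclideanSpace ℝ (Fin 6)) (paraCRProj H X ∘ φ) p v) =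
        flatModel.lam 0 ((paraCRProj H X ∘ φ) p) _ := congrArg _ hv
    have hmu := fun j => congrArg (flatModel.mu j ((paraCRProj H X ∘ φ) p)) hv
    have hnu := fun j => congrArg (flatModel.nu j ((paraCRProj H X ∘ φ) p)) hv
    refine ⟨?_, fun i => ?_, fun i => ?_⟩
    · rw [hlam]
      exact h.contact_eq hp.2 (fun i => θ i p v) (Ω 1 p v) (Ω 2 p v) rfl
    · rw [hlam]
      simp only [hnu]
      refine (h.solder_eq hp.2 (fun i => θ i p v) (Ω 1 p v) (Ω 2 p v) rfl i).trans ?_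
      refine congrArg₂ (· + ·) rfl (Finset.sum_congr rfl fun j _ => ?_)
      fin_cases j <;> rfl
    · simp only [hmu]
      rw [zero_mul, zero_add]
      refine (h.slope_eq hp.2 (fun i => θ i p v) (Ω 1 p v) (Ω 2 p v) rfl i).trans ?_
      refine Finset.sum_congr rfl fun j _ => ?_
      fin_cases j <;> rfl
  · refine φ.injOn hp.1 hq.1 (h.eq_of_parameters hp.2 hq.2 (fun i => ?_) ha hb hf)
    exact congrArg (fun z : EuclideanSpace ℝ (Fin 6) => z i) hσ
  · obtain ⟨h0, h1, h2⟩ := (h.mfderiv_paraCRProj_eq_zero_iff hφ hp v).1 hσ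
    obtain ⟨w, hw, hη⟩ := exists_chartVector hφ hp.1 v
    have hd : ∀ {f : E → ℝ}, ContDiffOn ℝ ∞ f U → mvfderiv 𝓘(ℝ, E) (f ∘ φ) p v = 0 →
        fderiv ℝ f (φ p) w = 0 := by
      intro f hf hf0
      have := mvfderiv_comp_chart hφ hp.1 ((hf.contDiffAt (h.isOpen.mem_nhds hp.2)).differentiableAt
        (by simp)).hasFDerivAt v
      exact (congrArg (fderiv ℝ f (φ p)) hw).symm.trans (this.symm.trans hf0)
    refine eq_zero_of_chart hφ hp.1 (hw.trans ?_)
    exact h.eq_zero_of_parameters hp.2 (fun i => (hη _).trans (h0 i)) ((hη _).trans h1)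
      ((hη _).trans h2) (fun i => hd (h.smooth_conformalInverse _ _) (hb i))
      (fun i j => hd (h.smooth_solderCoeff h.ne22 i j) (hf i j))

end ParaCRBundle

end

/-! ### Both fibrations on a common neighbourhood -/

theorem mainTheorem6 {P : Type*} [TopologicalSpace P]
    [ChartedSpace (EuclideanSpace ℝ (Fin 11)) P]
    [IsManifold 𝓘(ℝ, EuclideanSpace ℝ (Fin 11)) ∞ P]
    (θ : Fin 4 → OneForm (EuclideanSpace ℝ (Fin 11)) P)
    (Ω : Fin 6 → OneForm (EuclideanSpace ℝ (Fin 11)) P)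
    (A : OneForm (EuclideanSpace ℝ (Fin 11)) P)
    (hθ : ∀ i, (θ i).Smooth) (hΩ : ∀ i, (Ω i).Smooth) (hA : A.Smooth)
    (hcoframe : IsCoframe (Sum.elim θ (Sum.elim Ω fun _ : Unit => A)))
    (hsystem : FlatSystemOn Set.univ θ Ω A) :
    ∀ p₀ : P, ∃ U : Set P, IsOpen U ∧ p₀ ∈ U ∧
      IsLocallyCO22Bundle U θ Ω A ∧ OriginatesFromFlatParaCR U θ Ω A := by
  intro p₀
  have hdim : Module.finrank ℝ (EuclideanSpace ℝ (Fin 11)) = 11 := by simp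
  obtain ⟨φ, U, H, X, hφ, hp, h⟩ :=
    hsystem.exists_flatTrivialization hdim hθ hΩ hA hcoframe p₀
  exact ⟨φ.source ∩ φ ⁻¹' U, φ.isOpen_inter_preimage h.isOpen, hp, h.isLocallyCO22Bundle hφ,
    EuclideanSpace ℝ (Fin 6), inferInstance, inferInstance, inferInstance, inferInstance,
    inferInstance, flatModel, paraCRProj H X ∘ φ, fun q => affineGroupMap H (φ q),
    flatModel_isParaCR, flatModel_isFlat, h.isLocalPrincipalBundle_paraCR hφ,
    fun p hp v => h.mfderiv_paraCRProj_eq_zero_iff hφ hp v,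
    h.arisesFromParaCR hdim hcoframe hsystem hφ⟩
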